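/- Let $\pi$ be the usual constant, let $$G=L\left(2,\left(\tfrac{-4}{\cdot}\right)\right)=\sum_{k=0}^\infty\frac{(-1)^k}{(2k+1)^2}$$ be Catalan's constant, and let $$K=L\left(2,\left(\tfrac{-3}{\cdot}\right)\right)=\sum_{k=1}^\infty\frac{\left(\frac k3\right)}{k^2},$$ where $\left(\frac k3\right)$ is the Legendre symbol. Then the following sixteen series converge absolutely and have the stated sums: $$\sum_{k=0}^\infty\frac{198k^2-227k+47}{\binom{2k}k^3}=\frac{3264-4\pi^2}{63},\tag{T1}$$ $$\sum_{k=1}^\infty\frac{4884741k^2-7292783k+2041168}{\binom{2k}{k+1}^3}=\frac{68102148-10093535\pi^2}{126},\tag{T1$'$}$$ $$\sum_{k=0}^\infty\frac{(54k^2-33k+18)(-8)^k}{\binom{2k}k^3}=8+2G,\tag{T2}$$ $$\sum_{k=1}^\infty\frac{(11277k^2-13124k+3212)(-8)^k}{\binom{2k}{k+1}^3}=\frac{38954G-24679}3,\tag{T2$'$}$$ $$\sum_{k=0}^\infty\frac{(850k^2-1133k+69)8^k}{\binom{2k}k^2\binom{3k}k}=\frac{885-12\pi^2}5,\tag{T3}$$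 $$\sum_{k=1}^\infty\frac{(4621650k^2-7550827k+1785654)8^k}{\binom{2k}{k+1}^2\binom{3k}{k+1}}=\frac{6728880-1468127\pi^2}5,\tag{T3$'$}$$ $$\sum_{k=0}^\infty\frac{(18k^2-39k-6)16^k}{\binom{2k}k^3}=\frac{16-\pi^2}4,\tag{T4}$$ $$\sum_{k=1}^\infty\frac{(2778k^2-6499k+1679)16^k}{\binom{2k}{k+1}^3}=\frac{89008-20305\pi^2}{12},\tag{T4$'$}$$ $$\sum_{k=0}^\infty\frac{(315k^2-54k+119)(-27)^k}{\binom{2k}k^2\binom{3k}k}=\frac{10+216K}5,\tag{T5}$$ $$\sum_{k=1}^\infty\frac{(3391155k^2-3249747k+646792)(-27)^{k-1}}{\binom{2k}{k+1}^2\binom{3k}{k+1}}=\frac{2344210-5115501K}{30},\tag{T5$'$}$$ $$\sum_{k=0}^\infty\frac{(1298k^2-7807k-3165)64^k}{\binom{2k}k^2\binom{3k}k}=195-192\pi^2,\tag{T6}$$ $$\sum_{k=1}^\infty\frac{(3470742k^2-20527615k+4631490)64^{k-1}}{\binom{2k}{k+1}^2\binom{3k}{k+1}}=387807-198173\pi^2,\tag{T6$'$}$$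 $$\sum_{k=0}^\infty\frac{(2050k^2-5331k-1357)81^k}{\binom{2k}k^2\binom{4k}{2k}}=\frac{8800-2592\pi^2}{35},\tag{T7}$$ $$\sum_{k=1}^\infty\frac{(17439700k^2-47250409k+8929776)81^{k-1}}{\binom{2k}{k+1}^2\binom{4k}{2k+1}}=\frac{143153685-44613764\pi^2}{210},\tag{T7$'$}$$ $$\sum_{k=0}^\infty\frac{(50k^2+93k+22)(-144)^k}{\binom{2k}k^2\binom{4k}{2k}}=\frac{243K-200}4,\tag{T8}$$ $$\sum_{k=1}^\infty\frac{(53725k^2-27494k+3675)(-144)^{k-1}}{\binom{2k}{k+1}^2\binom{4k}{2k+1}}=\frac{78296-122235K}{128}.\tag{T8$'$}$$ -/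

import Mathlib

open scoped Real

/-- Catalan's constant `G = L(2, (-4/·)) = ∑_{k ≥ 0} (-1)^k / (2k+1)^2`. -/
noncomputable def catalanG : ℝ := ∑' k : ℕ, (-1 : ℝ) ^ k / (2 * (k : ℝ) + 1) ^ 2

/-- The constant `K = L(2, (-3/·)) = ∑_{k ≥ 1} (k/3) / k^2`, where `(k/3)` is the Legendre symbol. -/
noncomputable def constK : ℝ :=
  ∑' k : ℕ+, ((legendreSym 3 ((k : ℕ) : ℤ) : ℤ) : ℝ) / ((k : ℕ) : ℝ) ^ 2

/-- The series defining `catalanG` converges. -/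
theorem summable_catalanG : Summable (fun k : ℕ => (-1 : ℝ) ^ k / (2 * (k : ℝ) + 1) ^ 2) := by
  have h := (summable_nat_add_iff 1).2 (Real.summable_one_div_nat_pow.2 (by norm_num : 1 < 2))
  refine Summable.of_norm_bounded h (fun k => ?_)
  rw [norm_div, norm_pow, norm_neg, norm_one, one_pow, Real.norm_of_nonneg (by positivity)]
  push_cast
  gcongr
  linarith [(Nat.cast_nonneg k : (0 : ℝ) ≤ k)]

/-- The series defining `constK` converges. -/
theorem summable_constK :
    Summable (fun k : ℕ+ => ((legendreSym 3 ((k : ℕ) : ℤ) : ℤ) : ℝ) / ((k : ℕ) : ℝ) ^ 2) := by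
  have h : Summable (fun k : ℕ+ => (1 : ℝ) / ((k : ℕ) : ℝ) ^ 2) :=
    (Real.summable_one_div_nat_pow.2 (by norm_num : 1 < 2)).comp_injective PNat.coe_injective
  refine Summable.of_norm_bounded h (fun k => ?_)
  rw [norm_div, Real.norm_of_nonneg (by positivity : (0 : ℝ) ≤ ((k : ℕ) : ℝ) ^ 2)]
  gcongr
  rw [Real.norm_eq_abs]
  by_cases h0 : ((((k : ℕ) : ℤ) : ℤ) : ZMod 3) = 0
  · rw [(legendreSym.eq_zero_iff 3 _).2 h0]; simp
  · rcases legendreSym.eq_one_or_neg_one 3 h0 with h1 | h1 <;> rw [h1] <;> simp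

/-! The sixteen series fall into three families of terms t(k): z^k / (k³ C(2k,k)³) (`cubeTerm`), z^k
/ (k³ C(2k,k)² C(3k,k)) (`tripleTerm`) and z^k / (k³ C(2k,k)² C(4k,2k)) (`quadTerm`). Each of the
eight values of z has one basic evaluation ∑ (αk − β) t(k) = S, with S a rational multiple of π², G
or K. The series with and without a prime are two consequences of the same basic one. Shifting a
lower index only multiplies the term by a rational function, so every summand is a polynomial of
degree 5 in k times t(k). That polynomial equals A(αk − β) plus the contribution of a telescoping
sequence with a quadratic multiplier w(k). The quadratic of the series, w and A together have seven
coefficients, subject to six homogeneous linear equations, which is why such identities exist.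
`HasSum.cubeTerm_telescope` and its two analogues carry out this reduction.

The basic evaluations use three methods.

For z = 1, 16, 8, −8, −27 there is a Wilf–Zeilberger pair (F, G) whose column G(n,0) is the wanted
series up to a constant and whose row F(0,k) is a known sum: ∑ (−1)^k/(k+1)², ∑ 1/(k+1/2)², the
difference of the sums of 1/(k+1/3)² and 1/(k+2/3)², or (for z = 8 and −8) a slower series which is
itself evaluated by a pair. `hasSum_of_wz` makes the exchange of row and column rigorous.

For z = 64 and 81 a complex parameter is inserted. The function f(x) = x² ∑ w_N (aN² − bN − cx²)
∏_{m<N} (m² − x²)(m² − p²x²) is entire and even, and a telescoping certificate makes it 1-periodic.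
Euler's sine product gives f(x) = o(e^{4π|Im x|}) on a period strip, so its Fourier expansion has
only the frequencies −1, 0, 1, and evenness with f(0) = 0 leaves a multiple of sin² πx. The multiple
is found at x = 1/p, where all terms but the first vanish. The behaviour at 0 then gives the sum
(`tsum_pairTerm_zero`).

For z = −144 a deformation T(x) satisfies an inhomogeneous first-order difference equation, and so
does an explicit sum L(x) over simple poles. After L is subtracted suitably, multiplication by 3^x
cos πx gives a periodic function of growth o(e^{2π|Im x|}), hence a constant. Its vanishing
derivative at 0 expresses T(0) through L(0) and L'(0), that is, through arctan(1/√3) and the inverse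
tangent integral Ti₂(1/√3). The latter follows from the two-term functional equation of the Legendre
chi function at e^{iπ/3}. -/

open Filter Topology

/-! ### Wilf–Zeilberger summation, telescoping and geometric decay -/

/-- Summation by a Wilf–Zeilberger pair with a dominated left-hand side. -/
theorem hasSum_of_wz {F G : ℕ → ℕ → ℝ} {B ε c : ℕ → ℝ} {S : ℝ}
    (hFG : ∀ n k, G n (k + 1) - G n k = F (n + 1) k - F n k)
    (hG : ∀ n k, |G n k| ≤ c n * (((k : ℝ) + 1) * B k))
    (hB0 : Tendsto (fun k : ℕ => ((k : ℝ) + 1) * B k) atTop (𝓝 0))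
    (hB : Summable B) (hε : Tendsto ε atTop (𝓝 0))
    (hF : ∀ n k, |F n k| ≤ ε n * B k) (hS : HasSum (F 0) S)
    (hs : Summable fun n => G n 0) : HasSum (fun n => G n 0) S := by
  have hFs : ∀ n, Summable (F n) := fun n =>
    Summable.of_norm_bounded (hB.mul_left (ε n)) fun k => by simpa using hF n k
  have hG0 : ∀ n, Tendsto (G n) atTop (𝓝 0) := fun n => by
    refine squeeze_zero_norm (fun k => by simpa using hG n k) ?_
    simpa using hB0.const_mul (c n)
  -- Summing the pair relation over k leaves only −G n 0 on the left, since G n k → 0; the column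
  -- entry is thus the difference of two consecutive row sums.
  have hstep : ∀ n, G n 0 = (∑' k, F n k) - ∑' k, F (n + 1) k := fun n => by
    have h1 : HasSum (fun k => F (n + 1) k - F n k) ((∑' k, F (n + 1) k) - ∑' k, F n k) :=
      (hFs (n + 1)).hasSum.sub (hFs n).hasSum
    have h2 := h1.tendsto_sum_nat
    have h3 : ∀ K, ∑ k ∈ Finset.range K, (F (n + 1) k - F n k) = G n K - G n 0 := fun K => by
      rw [← Finset.sum_range_sub]
      exact Finset.sum_congr rfl fun k _ => (hFG n k).symm
    simp only [h3] at h2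
    have h4 := tendsto_nhds_unique h2 ((hG0 n).sub_const (G n 0))
    linarith
  have hlim : Tendsto (fun n => ∑' k, F n k) atTop (𝓝 0) := by
    refine squeeze_zero_norm (a := fun n => ε n * ∑' k, B k) (fun n => ?_)
      (by simpa using hε.mul_const (∑' k, B k))
    rw [← tsum_mul_left]
    exact tsum_of_norm_bounded (hB.mul_left (ε n)).hasSum fun k => by simpa using hF n k
  have hsum : ∀ N, ∑ n ∈ Finset.range N, G n 0 = S - ∑' k, F N k := fun N => by
    rw [Finset.sum_congr rfl fun n _ => hstep n, Finset.sum_range_sub', hS.tsum_eq]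
  rw [hs.hasSum_iff_tendsto_nat]
  simp only [hsum]
  simpa using hlim.const_sub S

/-- Adding a telescoping series to a multiple of a convergent one. -/
theorem HasSum.mul_add_telescope {a b v : ℕ → ℝ} {A S T : ℝ} (hb : HasSum b S)
    (hv : Summable v) (h : ∀ n, a n = A * b n + (v n - v (n + 1))) (hT : T = A * S + v 0) :
    HasSum a T := by
  have h1 : HasSum (fun n => v n - v (n + 1)) (v 0) := by
    have h2 : Summable fun n => v n - v (n + 1) := hv.sub ((summable_nat_add_iff 1).2 hv)
    rw [h2.hasSum_iff_tendsto_nat]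
    simp only [Finset.sum_range_sub']
    simpa using hv.tendsto_atTop_zero.const_sub (v 0)
  rw [hT, funext h]
  exact (hb.mul_left A).add h1

/-- A sequence with geometrically decreasing absolute values is bounded by a geometric one. -/
theorem abs_le_geometric {u : ℕ → ℝ} {q : ℝ} (hq : 0 ≤ q) (hu : ∀ n, |u (n + 1)| ≤ q * |u n|)
    (n : ℕ) : |u n| ≤ q ^ n * |u 0| := by
  induction n with
  | zero => simp
  | succ n ih =>
    calc |u (n + 1)| ≤ q * |u n| := hu n
      _ ≤ q * (q ^ n * |u 0|) := by gcongr
      _ = q ^ (n + 1) * |u 0| := by ring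

/-- Polynomial multiples of a geometrically decreasing sequence are summable. -/
theorem summable_pow_mul_of_ratio {u : ℕ → ℝ} {q : ℝ} (hq : 0 ≤ q) (hq1 : q < 1)
    (hu : ∀ n, |u (n + 1)| ≤ q * |u n|) (j : ℕ) : Summable fun n : ℕ => (n : ℝ) ^ j * u n := by
  have h := (summable_pow_mul_geometric_of_norm_lt_one j (r := q)
    (by rwa [Real.norm_of_nonneg hq])).mul_right |u 0|
  refine Summable.of_norm_bounded h fun n => ?_
  rw [norm_mul, norm_pow, Real.norm_natCast, Real.norm_eq_abs, mul_assoc]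
  gcongr
  exact abs_le_geometric hq hu n

theorem summable_polynomial_mul_of_ratio {u : ℕ → ℝ} {q : ℝ} (hq : 0 ≤ q) (hq1 : q < 1)
    (hu : ∀ n, |u (n + 1)| ≤ q * |u n|) (P : Polynomial ℝ) :
    Summable fun n : ℕ => P.eval (n : ℝ) * u n := by
  induction P using Polynomial.induction_on' with
  | add p r hp hr => simpa [add_mul] using hp.add hr
  | monomial j a =>
    simpa [mul_assoc] using (summable_pow_mul_of_ratio hq hq1 hu j).mul_left a

theorem tendsto_linear_mul_pow {q : ℝ} (hq : 0 ≤ q) (hq1 : q < 1) (a b : ℝ) :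
    Tendsto (fun n : ℕ => (a * n + b) * q ^ n) atTop (𝓝 0) := by
  have h1 := tendsto_self_mul_const_pow_of_lt_one hq hq1
  have h2 := tendsto_pow_atTop_nhds_zero_of_lt_one hq hq1
  have h := (h1.const_mul a).add (h2.const_mul b)
  simp only [mul_zero, add_zero] at h
  exact h.congr fun n => by ring

/-! ### Rising products and their growth -/

/-- The rising product `y (y+1) ⋯ (y+n-1)`. -/
noncomputable def rise (y : ℝ) (n : ℕ) : ℝ := ∏ i ∈ Finset.range n, (y + i)

@[simp] theorem rise_zero (y : ℝ) : rise y 0 = 1 := by simp [rise]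

theorem rise_succ (y : ℝ) (n : ℕ) : rise y (n + 1) = rise y n * (y + n) := by
  simp [rise, Finset.prod_range_succ]

theorem rise_pos {y : ℝ} (hy : 0 < y) (n : ℕ) : 0 < rise y n :=
  Finset.prod_pos fun i _ => by positivity

theorem mul_rise_add_one (y : ℝ) (n : ℕ) : y * rise (y + 1) n = rise y (n + 1) := by
  rw [rise, rise, Finset.prod_range_succ']
  push_cast
  rw [mul_comm, add_zero]
  congr 1
  exact Finset.prod_congr rfl fun i _ => by ring

theorem rise_mono {x y : ℝ} (hx : 0 < x) (hxy : x ≤ y) (n : ℕ) : rise x n ≤ rise y n :=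
  Finset.prod_le_prod (fun i _ => by positivity) fun i _ => by linarith

/-- Monotonicity in the base point reduces to y = 1/2. The resulting decay n!/(y+1)_n ≤
(n+1)^{-1/2}, uniform in y, makes the row sums tend to 0 for the pairs that do not decay
geometrically. -/
theorem factorial_mul_sqrt_le_rise {y : ℝ} (hy : 1 / 2 ≤ y) (n : ℕ) :
    (n.factorial : ℝ) * √((n : ℝ) + 1) ≤ rise (y + 1) n := by
  refine le_trans ?_ (rise_mono (by norm_num : (0 : ℝ) < 1 / 2 + 1) (by linarith) n)
  induction n with
  | zero => simp
  | succ n ih =>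
    rw [rise_succ, Nat.factorial_succ]
    push_cast
    -- Squared, this is (n+1)(n+2) ≤ (n+3/2)² times n+1.
    have h : ((n : ℝ) + 1) * √((n : ℝ) + 1 + 1) ≤ √((n : ℝ) + 1) * (1 / 2 + 1 + n) := by
      apply le_of_sq_le_sq _ (by positivity)
      rw [mul_pow, mul_pow, Real.sq_sqrt (by positivity), Real.sq_sqrt (by positivity)]
      nlinarith [(Nat.cast_nonneg n : (0 : ℝ) ≤ n)]
    calc ((n : ℝ) + 1) * (n.factorial : ℝ) * √((n : ℝ) + 1 + 1)
        = n.factorial * (((n : ℝ) + 1) * √((n : ℝ) + 1 + 1)) := by ring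
      _ ≤ n.factorial * (√((n : ℝ) + 1) * (1 / 2 + 1 + n)) := by gcongr
      _ = n.factorial * √((n : ℝ) + 1) * (1 / 2 + 1 + n) := by ring
      _ ≤ _ := by gcongr

theorem tendsto_inv_sqrt_succ : Tendsto (fun n : ℕ => (√((n : ℝ) + 1))⁻¹) atTop (𝓝 0) :=
  tendsto_inv_atTop_zero.comp
    (Real.tendsto_sqrt_atTop.comp (tendsto_atTop_add_const_right _ _ tendsto_natCast_atTop_atTop))

/-! ### Sums of reciprocal squares -/

theorem summable_inv_sq_add {x : ℝ} (hx : 0 < x) :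
    Summable fun k : ℕ => 1 / ((k : ℝ) + x) ^ 2 := by
  rw [← summable_nat_add_iff 1]
  refine Summable.of_nonneg_of_le (fun k => by positivity) (fun k => ?_)
    ((summable_nat_add_iff 1).2 (Real.summable_one_div_nat_pow.2 (by norm_num : 1 < 2)))
  gcongr
  linarith

theorem tendsto_succ_mul_inv_sq_add {x : ℝ} (hx : 0 < x) :
    Tendsto (fun k : ℕ => ((k : ℝ) + 1) * (1 / ((k : ℝ) + x) ^ 2)) atTop (𝓝 0) := by
  have h : Tendsto (fun k : ℕ => (k : ℝ) + x) atTop atTop :=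
    tendsto_atTop_add_const_right _ _ tendsto_natCast_atTop_atTop
  have h1 := tendsto_inv_atTop_zero.comp h
  have h2 := h1.add ((h1.mul h1).const_mul (1 - x))
  simp only [mul_zero, add_zero] at h2
  refine h2.congr fun k => ?_
  have : (k : ℝ) + x ≠ 0 := by positivity
  simp only [Function.comp]
  field_simp
  ring

theorem HasSum.of_eq {ι : Type*} {f g : ι → ℝ} {a b : ℝ} (h : HasSum f a)
    (hfg : ∀ i, g i = f i) (hab : b = a) : HasSum g b := by
  rwa [hab, funext hfg]

/-- `∑ 1/(k+1/2)^2 = π²/2`. -/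
theorem hasSum_inv_half_sq : HasSum (fun k : ℕ => 1 / ((k : ℝ) + 1 / 2) ^ 2) (π ^ 2 / 2) := by
  have hz := hasSum_zeta_two
  have he : HasSum (fun k : ℕ => 1 / ((2 * k : ℕ) : ℝ) ^ 2) (π ^ 2 / 6 / 4) := by
    refine (hz.div_const 4).of_eq (fun k => ?_) rfl
    push_cast
    rw [mul_pow, div_div]
    norm_num
    ring
  have hs := (summable_inv_sq_add (by norm_num : (0 : ℝ) < 1 / 2)).hasSum
  have ho : HasSum (fun k : ℕ => 1 / ((2 * k + 1 : ℕ) : ℝ) ^ 2)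
      ((∑' k : ℕ, 1 / ((k : ℝ) + 1 / 2) ^ 2) / 4) := by
    refine (hs.div_const 4).of_eq (fun k => ?_) rfl
    push_cast
    rw [div_div]
    congr 1
    ring
  have h := (HasSum.even_add_odd (f := fun k : ℕ => 1 / (k : ℝ) ^ 2) he ho).unique hz
  rwa [show (∑' k : ℕ, 1 / ((k : ℝ) + 1 / 2) ^ 2) = π ^ 2 / 2 by linarith] at hs

/-- `∑ (-1)^k/(k+1)^2 = π²/12`. -/
theorem hasSum_alternating_inv_sq :
    HasSum (fun k : ℕ => (-1 : ℝ) ^ k / ((k : ℝ) + 1) ^ 2) (π ^ 2 / 12) := by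
  have he : HasSum (fun k : ℕ => (-1 : ℝ) ^ (2 * k) / (((2 * k : ℕ) : ℝ) + 1) ^ 2)
      (π ^ 2 / 2 / 4) := by
    refine (hasSum_inv_half_sq.div_const 4).of_eq (fun k => ?_) rfl
    rw [pow_mul, div_div, neg_one_sq, one_pow]
    push_cast
    congr 1
    ring
  have ho : HasSum (fun k : ℕ => (-1 : ℝ) ^ (2 * k + 1) / (((2 * k + 1 : ℕ) : ℝ) + 1) ^ 2)
      (-(π ^ 2 / 6) / 4) := by
    have hz : HasSum (fun k : ℕ => 1 / ((k + 1 : ℕ) : ℝ) ^ 2) (π ^ 2 / 6) :=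
      (hasSum_nat_add_iff' (f := fun k : ℕ => 1 / (k : ℝ) ^ 2) 1).2 (by simpa using hasSum_zeta_two)
        |>.of_eq (fun _ => rfl) (by simp)
    refine (hz.neg.div_const 4).of_eq (fun k => ?_) rfl
    rw [pow_succ, pow_mul, neg_one_sq, one_pow]
    push_cast
    have h1 : (k : ℝ) + 1 ≠ 0 := by positivity
    have h2 : 2 * (k : ℝ) + 1 + 1 ≠ 0 := by positivity
    field_simp
    ring
  exact (HasSum.even_add_odd (f := fun k : ℕ => (-1 : ℝ) ^ k / ((k : ℝ) + 1) ^ 2) he ho).of_eq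
    (fun _ => rfl) (by ring)

/-- `∑ (-1)^k/(k+1/2)^2 = 4G`. -/
theorem hasSum_alternating_inv_half_sq :
    HasSum (fun k : ℕ => (-1 : ℝ) ^ k / ((k : ℝ) + 1 / 2) ^ 2) (4 * catalanG) := by
  refine (summable_catalanG.hasSum.mul_left 4).of_eq (fun k => ?_) rfl
  have h1 : 2 * (k : ℝ) + 1 ≠ 0 := by positivity
  have h2 : (k : ℝ) + 1 / 2 ≠ 0 := by positivity
  field_simp
  ring

/-! ### The three families of terms and their ratios -/

/-- `z^k / (k^3 C(2k,k)^3)` at `k = n + 1`. -/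
noncomputable def cubeTerm (z : ℝ) (n : ℕ) : ℝ :=
  z ^ (n + 1) / (((n : ℝ) + 1) ^ 3 * (Nat.choose (2 * (n + 1)) (n + 1) : ℝ) ^ 3)

/-- `z^k / (k^3 C(2k,k)^2 C(3k,k))` at `k = n + 1`. -/
noncomputable def tripleTerm (z : ℝ) (n : ℕ) : ℝ :=
  z ^ (n + 1) / (((n : ℝ) + 1) ^ 3 * ((Nat.choose (2 * (n + 1)) (n + 1) : ℝ) ^ 2 *
    (Nat.choose (3 * (n + 1)) (n + 1) : ℝ)))

/-- `z^k / (k^3 C(2k,k)^2 C(4k,2k))` at `k = n + 1`. -/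
noncomputable def quadTerm (z : ℝ) (n : ℕ) : ℝ :=
  z ^ (n + 1) / (((n : ℝ) + 1) ^ 3 * ((Nat.choose (2 * (n + 1)) (n + 1) : ℝ) ^ 2 *
    (Nat.choose (4 * (n + 1)) (2 * (n + 1)) : ℝ)))

theorem choose_two_mul (k : ℕ) :
    (Nat.choose (2 * k) k : ℝ) = (2 * k).factorial / (k.factorial : ℝ) ^ 2 := by
  rw [Nat.cast_choose ℝ (by omega : k ≤ 2 * k), show 2 * k - k = k by omega, sq]

theorem choose_three_mul (k : ℕ) :
    (Nat.choose (3 * k) k : ℝ) = (3 * k).factorial / (k.factorial * (2 * k).factorial) := by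
  rw [Nat.cast_choose ℝ (by omega : k ≤ 3 * k), show 3 * k - k = 2 * k by omega]

theorem choose_four_mul (k : ℕ) :
    (Nat.choose (4 * k) (2 * k) : ℝ) = (4 * k).factorial / ((2 * k).factorial : ℝ) ^ 2 := by
  rw [Nat.cast_choose ℝ (by omega : 2 * k ≤ 4 * k), show 4 * k - 2 * k = 2 * k by omega, sq]

theorem factorial_ne_zero_real (n : ℕ) : (n.factorial : ℝ) ≠ 0 := by positivity

theorem cubeTerm_eq (z : ℝ) (n : ℕ) :
    cubeTerm z n = z ^ (n + 1) * ((n : ℝ) + 1) ^ 3 * (n.factorial : ℝ) ^ 6 /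
      ((2 * n + 2).factorial : ℝ) ^ 3 := by
  rw [cubeTerm, choose_two_mul, show 2 * (n + 1) = 2 * n + 2 by ring, Nat.factorial_succ n]
  have := factorial_ne_zero_real n
  have := factorial_ne_zero_real (2 * n + 2)
  push_cast
  field_simp

theorem tripleTerm_eq (z : ℝ) (n : ℕ) :
    tripleTerm z n = z ^ (n + 1) * ((n : ℝ) + 1) ^ 2 * (n.factorial : ℝ) ^ 5 /
      ((2 * n + 2).factorial * (3 * n + 3).factorial : ℝ) := by
  rw [tripleTerm, choose_two_mul, choose_three_mul, show 2 * (n + 1) = 2 * n + 2 by ring,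
    show 3 * (n + 1) = 3 * n + 3 by ring, Nat.factorial_succ n]
  have := factorial_ne_zero_real n
  have := factorial_ne_zero_real (2 * n + 2)
  have := factorial_ne_zero_real (3 * n + 3)
  push_cast
  field_simp

theorem quadTerm_eq (z : ℝ) (n : ℕ) :
    quadTerm z n = z ^ (n + 1) * ((n : ℝ) + 1) * (n.factorial : ℝ) ^ 4 /
      ((4 * n + 4).factorial : ℝ) := by
  rw [quadTerm, choose_two_mul, choose_four_mul, show 2 * (n + 1) = 2 * n + 2 by ring,
    show 4 * (n + 1) = 4 * n + 4 by ring, Nat.factorial_succ n]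
  have := factorial_ne_zero_real n
  have := factorial_ne_zero_real (2 * n + 2)
  have := factorial_ne_zero_real (4 * n + 4)
  push_cast
  field_simp

theorem cubeTerm_succ (z : ℝ) (n : ℕ) :
    cubeTerm z (n + 1) = z * ((n : ℝ) + 1) ^ 3 / (8 * (2 * (n : ℝ) + 3) ^ 3) * cubeTerm z n := by
  rw [cubeTerm_eq, cubeTerm_eq, show 2 * (n + 1) + 2 = 2 * n + 2 + 1 + 1 by ring,
    Nat.factorial_succ n, Nat.factorial_succ (2 * n + 2 + 1), Nat.factorial_succ (2 * n + 2)]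
  have := factorial_ne_zero_real n
  have := factorial_ne_zero_real (2 * n + 2)
  push_cast
  field_simp
  ring

theorem tripleTerm_succ (z : ℝ) (n : ℕ) :
    tripleTerm z (n + 1) = z * ((n : ℝ) + 1) ^ 3 /
      (6 * (2 * (n : ℝ) + 3) * (3 * n + 4) * (3 * n + 5)) * tripleTerm z n := by
  rw [tripleTerm_eq, tripleTerm_eq, show 2 * (n + 1) + 2 = 2 * n + 2 + 1 + 1 by ring,
    show 3 * (n + 1) + 3 = 3 * n + 3 + 1 + 1 + 1 by ring,
    Nat.factorial_succ n, Nat.factorial_succ (2 * n + 2 + 1), Nat.factorial_succ (2 * n + 2),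
    Nat.factorial_succ (3 * n + 3 + 1 + 1), Nat.factorial_succ (3 * n + 3 + 1),
    Nat.factorial_succ (3 * n + 3)]
  have := factorial_ne_zero_real n
  have := factorial_ne_zero_real (2 * n + 2)
  have := factorial_ne_zero_real (3 * n + 3)
  push_cast
  field_simp
  ring

theorem quadTerm_succ (z : ℝ) (n : ℕ) :
    quadTerm z (n + 1) = z * ((n : ℝ) + 1) ^ 3 /
      (8 * (2 * (n : ℝ) + 3) * (4 * n + 5) * (4 * n + 7)) * quadTerm z n := by
  rw [quadTerm_eq, quadTerm_eq, show 4 * (n + 1) + 4 = 4 * n + 4 + 1 + 1 + 1 + 1 by ring,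
    Nat.factorial_succ n, Nat.factorial_succ (4 * n + 4 + 1 + 1 + 1),
    Nat.factorial_succ (4 * n + 4 + 1 + 1), Nat.factorial_succ (4 * n + 4 + 1),
    Nat.factorial_succ (4 * n + 4)]
  have := factorial_ne_zero_real n
  have := factorial_ne_zero_real (4 * n + 4)
  push_cast
  field_simp
  ring

/-- The numbers 64, 108 and 256 here and in the two analogues are the exponential growth rates of
the binomial products. Every z in use is smaller in absolute value, so all polynomial multiples of
the terms are summable. -/
theorem cubeTerm_ratio (z : ℝ) (n : ℕ) :
    |cubeTerm z (n + 1)| ≤ |z| / 64 * |cubeTerm z n| := by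
  have h : ((n : ℝ) + 1) ^ 3 / (8 * (2 * (n : ℝ) + 3) ^ 3) ≤ 1 / 64 := by
    rw [div_le_div_iff₀ (by positivity) (by norm_num)]
    exact sub_nonneg.1 (by ring_nf; positivity)
  rw [cubeTerm_succ, abs_mul, mul_div_assoc, abs_mul,
    abs_of_nonneg (by positivity : (0 : ℝ) ≤ ((n : ℝ) + 1) ^ 3 / (8 * (2 * (n : ℝ) + 3) ^ 3)),
    div_eq_mul_one_div |z|]
  gcongr

theorem tripleTerm_ratio (z : ℝ) (n : ℕ) :
    |tripleTerm z (n + 1)| ≤ |z| / 108 * |tripleTerm z n| := by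
  have h : ((n : ℝ) + 1) ^ 3 / (6 * (2 * (n : ℝ) + 3) * (3 * n + 4) * (3 * n + 5)) ≤ 1 / 108 := by
    rw [div_le_div_iff₀ (by positivity) (by norm_num)]
    exact sub_nonneg.1 (by ring_nf; positivity)
  rw [tripleTerm_succ, abs_mul, mul_div_assoc, abs_mul,
    abs_of_nonneg (by positivity : (0 : ℝ) ≤ ((n : ℝ) + 1) ^ 3 / (6 * (2 * (n : ℝ) + 3) * (3 * n + 4) * (3 * n + 5))),
    div_eq_mul_one_div |z|]
  gcongr

theorem quadTerm_ratio (z : ℝ) (n : ℕ) :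
    |quadTerm z (n + 1)| ≤ |z| / 256 * |quadTerm z n| := by
  have h : ((n : ℝ) + 1) ^ 3 / (8 * (2 * (n : ℝ) + 3) * (4 * n + 5) * (4 * n + 7)) ≤ 1 / 256 := by
    rw [div_le_div_iff₀ (by positivity) (by norm_num)]
    exact sub_nonneg.1 (by ring_nf; positivity)
  rw [quadTerm_succ, abs_mul, mul_div_assoc, abs_mul,
    abs_of_nonneg (by positivity : (0 : ℝ) ≤ ((n : ℝ) + 1) ^ 3 / (8 * (2 * (n : ℝ) + 3) * (4 * n + 5) * (4 * n + 7))),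
    div_eq_mul_one_div |z|]
  gcongr

theorem summable_linear_mul {u : ℕ → ℝ} {q : ℝ} (hq : 0 ≤ q) (hq1 : q < 1)
    (hu : ∀ n, |u (n + 1)| ≤ q * |u n|) (a b : ℝ) :
    Summable fun n : ℕ => (a * ((n : ℝ) + 1) - b) * u n := by
  refine (summable_polynomial_mul_of_ratio hq hq1 hu
    (Polynomial.C a * (Polynomial.X + 1) - Polynomial.C b)).congr fun n => ?_
  simp

/-! ### The series at z = 1 -/

section Zeilberger

/-- `n! (n+k)! / (2n+k+1)!` -/
noncomputable def betaWeight (n k : ℕ) : ℝ :=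
  n.factorial * (n + k).factorial / (2 * n + k + 1).factorial

theorem betaWeight_succ_left (n k : ℕ) : betaWeight (n + 1) k =
    betaWeight n k * ((n + 1) * (n + k + 1) / ((2 * n + k + 2) * (2 * n + k + 3))) := by
  rw [betaWeight, betaWeight, show n + 1 + k = n + k + 1 by ring,
    show 2 * (n + 1) + k + 1 = 2 * n + k + 1 + 1 + 1 by ring, Nat.factorial_succ n,
    Nat.factorial_succ (n + k), Nat.factorial_succ (2 * n + k + 1 + 1),
    Nat.factorial_succ (2 * n + k + 1)]
  have := factorial_ne_zero_real (2 * n + k + 1)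
  push_cast
  field_simp
  ring

theorem betaWeight_succ_right (n k : ℕ) : betaWeight n (k + 1) =
    betaWeight n k * ((n + k + 1) / (2 * n + k + 2)) := by
  rw [betaWeight, betaWeight, show n + (k + 1) = n + k + 1 by ring,
    show 2 * n + (k + 1) + 1 = 2 * n + k + 1 + 1 by ring,
    Nat.factorial_succ (n + k), Nat.factorial_succ (2 * n + k + 1)]
  have := factorial_ne_zero_real (2 * n + k + 1)
  push_cast
  field_simp
  ring

theorem betaWeight_nonneg (n k : ℕ) : 0 ≤ betaWeight n k := by rw [betaWeight]; positivity

theorem betaWeight_zero (k : ℕ) : betaWeight 0 k = 1 / ((k : ℝ) + 1) := by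
  rw [betaWeight]
  simp [Nat.factorial_succ]
  have := factorial_ne_zero_real k
  field_simp

theorem betaWeight_le (n k : ℕ) : betaWeight n k ≤ (1 / 2) ^ n * (1 / ((k : ℝ) + 1)) := by
  induction n with
  | zero => simp [betaWeight_zero]
  | succ n ih =>
    rw [betaWeight_succ_left]
    have h : ((n : ℝ) + 1) * (n + k + 1) / ((2 * n + k + 2) * (2 * n + k + 3)) ≤ 1 / 2 := by
      rw [div_le_div_iff₀ (by positivity) (by norm_num)]
      exact sub_nonneg.1 (by ring_nf; positivity)
    calc _ ≤ (1 / 2) ^ n * (1 / ((k : ℝ) + 1)) * (1 / 2) :=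
          mul_le_mul ih h (by positivity) (by positivity)
      _ = _ := by ring

/-- The pair is built on the cube of the beta value B(n+1, n+k+1), which is `betaWeight`. At n = 0
the row is 2(−1)^k/(k+1)², with sum 2 · π²/12. -/
theorem hasSum_cubeTerm_one :
    HasSum (fun n : ℕ => (21 * ((n : ℝ) + 1) - 8) * cubeTerm 1 n) (π ^ 2 / 6) := by
  set F : ℕ → ℕ → ℝ := fun n k => (2 * k + 3 * n + 2) * (-1) ^ k * betaWeight n k ^ 3 with hF
  set Q : ℝ → ℝ → ℝ := fun n k => 21 * n ^ 4 + n ^ 3 * (42 * k - 8) + n ^ 2 * (30 * k ^ 2 - 12 * k)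
    + n * (9 * k ^ 3 - 6 * k ^ 2) + k ^ 4 - k ^ 3 with hQ
  set G : ℕ → ℕ → ℝ := fun n k => Q (n + 1) k * (-1) ^ k *
    (betaWeight n k / (2 * n + k + 2)) ^ 3 with hG
  have hG0 : ∀ n : ℕ, (21 * ((n : ℝ) + 1) - 8) * cubeTerm 1 n = G n 0 := fun n => by
    rw [cubeTerm_eq]
    simp only [hG, hQ, betaWeight]
    rw [show 2 * n + 2 = 2 * n + 1 + 1 by ring, Nat.factorial_succ (2 * n + 1)]
    have := factorial_ne_zero_real (2 * n + 1)
    simp only [add_zero]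
    push_cast
    field_simp
    ring
  rw [funext hG0]
  refine hasSum_of_wz (F := F) (B := fun k : ℕ => 1 / ((k : ℝ) + 1) ^ 2)
    (ε := fun n : ℕ => (3 * n + 2) * (1 / 8) ^ n) (c := fun n : ℕ => 130 * ((n : ℝ) + 1) ^ 4)
    ?_ ?_ (tendsto_succ_mul_inv_sq_add one_pos) (summable_inv_sq_add one_pos)
    (tendsto_linear_mul_pow (by norm_num) (by norm_num) 3 2) ?_ ?_ ?_
  · intro n k
    simp only [hF, hG, hQ]
    rw [betaWeight_succ_left, betaWeight_succ_right, pow_succ (-1 : ℝ) k]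
    push_cast
    field_simp
    ring
  · intro n k
    simp only [hG]
    rw [abs_mul, abs_mul, abs_pow, abs_neg, abs_one, one_pow, mul_one,
      abs_of_nonneg (pow_nonneg (div_nonneg (betaWeight_nonneg n k) (by positivity)) 3)]
    -- The constant 130 is the sum of the absolute values of the coefficients of Q; every monomial
    -- is at most (n+1)⁴(k+1)⁴.
    have h1 : |Q (n + 1) k| ≤ 130 * ((n : ℝ) + 1) ^ 4 * (k + 1) ^ 4 := by
      simp only [hQ]
      rw [abs_le]
      constructor
      · exact sub_nonneg.1 (by ring_nf; positivity)
      · exact sub_nonneg.1 (by ring_nf; positivity)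
    have h2 : betaWeight n k / (2 * n + k + 2) ≤ 1 / ((k : ℝ) + 1) ^ 2 := by
      have h3 : betaWeight n k ≤ 1 / ((k : ℝ) + 1) := (betaWeight_le n k).trans
        (mul_le_of_le_one_left (by positivity) (pow_le_one₀ (by norm_num) (by norm_num)))
      calc betaWeight n k / (2 * n + k + 2) ≤ 1 / ((k : ℝ) + 1) / (k + 1) := by
            gcongr
            · linarith [(Nat.cast_nonneg n : (0 : ℝ) ≤ n)]
            · norm_num
        _ = _ := by field_simp
    have h0 := div_nonneg (betaWeight_nonneg n k) (by positivity : (0 : ℝ) ≤ 2 * n + k + 2)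
    calc _ ≤ 130 * ((n : ℝ) + 1) ^ 4 * (k + 1) ^ 4 * (1 / ((k : ℝ) + 1) ^ 2) ^ 3 := by gcongr
      _ = 130 * ((n : ℝ) + 1) ^ 4 * (1 / ((k : ℝ) + 1) ^ 2) := by field_simp
      _ ≤ _ := by
        gcongr
        exact le_mul_of_one_le_left (by positivity)
          (by linarith [(Nat.cast_nonneg k : (0 : ℝ) ≤ k)])
  · intro n k
    simp only [hF]
    rw [abs_mul, abs_mul, abs_pow, abs_neg, abs_one, one_pow, mul_one,
      abs_of_nonneg (pow_nonneg (betaWeight_nonneg n k) 3), abs_of_nonneg (by positivity)]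
    have h0 := betaWeight_nonneg n k
    calc _ ≤ ((3 * n + 2) * ((k : ℝ) + 1)) * ((1 / 2) ^ n * (1 / ((k : ℝ) + 1))) ^ 3 := by
          gcongr
          · exact sub_nonneg.1 (by ring_nf; positivity)
          · exact betaWeight_le n k
      _ = _ := by
          rw [show (1 / 8 : ℝ) = (1 / 2) ^ 3 by norm_num, ← pow_mul, mul_comm 3 n, pow_mul]
          field_simp
  · refine (hasSum_alternating_inv_sq.mul_left 2).of_eq (fun k => ?_) (by ring)
    simp only [hF, betaWeight_zero]
    push_cast
    field_simp
    ring
  · rw [← funext hG0]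
    exact summable_linear_mul (by norm_num) (by norm_num) (cubeTerm_ratio 1) 21 8

end Zeilberger

/-! ### Wilf–Zeilberger pairs over half-integers: the series at 16, 8 and −8 -/

theorem tendsto_quadratic_mul_pow {q : ℝ} (hq : 0 ≤ q) (hq1 : q < 1) (a b c : ℝ) :
    Tendsto (fun n : ℕ => (a * n ^ 2 + b * n + c) * q ^ n) atTop (𝓝 0) := by
  have h2 := tendsto_pow_const_mul_const_pow_of_lt_one 2 hq hq1
  have h := (h2.const_mul a).add (tendsto_linear_mul_pow hq hq1 b c)
  simp only [mul_zero, add_zero] at h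
  exact h.congr fun n => by ring

theorem rise_half (m : ℕ) :
    rise (1 / 2) m = (2 * m).factorial / (4 ^ m * m.factorial : ℝ) := by
  induction m with
  | zero => simp
  | succ m ih =>
    rw [rise_succ, ih, show 2 * (m + 1) = 2 * m + 1 + 1 by ring, Nat.factorial_succ m,
      Nat.factorial_succ (2 * m + 1), Nat.factorial_succ (2 * m)]
    have := factorial_ne_zero_real m
    push_cast
    field_simp
    ring

theorem rise_thirds (m : ℕ) :
    rise (1 / 3) m * rise (2 / 3) m = (3 * m).factorial / (27 ^ m * m.factorial : ℝ) := by
  induction m with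
  | zero => simp
  | succ m ih =>
    have h : rise (1 / 3) (m + 1) * rise (2 / 3) (m + 1) =
        rise (1 / 3) m * rise (2 / 3) m * ((1 / 3 + m) * (2 / 3 + m)) := by
      rw [rise_succ, rise_succ]
      ring
    rw [h, ih, show 3 * (m + 1) = 3 * m + 1 + 1 + 1 by ring, Nat.factorial_succ m,
      Nat.factorial_succ (3 * m + 1 + 1), Nat.factorial_succ (3 * m + 1),
      Nat.factorial_succ (3 * m)]
    have := factorial_ne_zero_real m
    push_cast
    field_simp
    ring

/-- Shifting the base point of a rising product. -/
theorem rise_add_one {y : ℝ} (hy : y ≠ 0) (n : ℕ) :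
    rise (y + 1) n = rise y n * (y + n) / y := by
  rw [eq_div_iff hy, mul_comm, mul_rise_add_one, rise_succ]

theorem factorial_div_rise_le {y : ℝ} (hy : 1 / 2 ≤ y) (n : ℕ) :
    (n.factorial : ℝ) / rise (y + 1) n ≤ (√((n : ℝ) + 1))⁻¹ := by
  rw [div_le_iff₀ (rise_pos (by linarith) n), inv_mul_eq_div, le_div_iff₀ (by positivity)]
  exact factorial_mul_sqrt_le_rise hy n

theorem factorial_div_rise_half_le (n : ℕ) :
    (n.factorial : ℝ) / rise (1 / 2) (n + 1) ≤ 2 * (√((n : ℝ) + 1))⁻¹ := by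
  have h := factorial_div_rise_le (le_refl (1 / 2 : ℝ)) n
  rw [← mul_rise_add_one]
  have h2 := rise_pos (by norm_num : (0 : ℝ) < 1 / 2 + 1) n
  calc (n.factorial : ℝ) / (1 / 2 * rise (1 / 2 + 1) n)
      = 2 * (n.factorial / rise (1 / 2 + 1) n) := by field_simp
    _ ≤ _ := by gcongr

/-- `∑ 4^k/(k^2 C(2k,k)) = π²/2`, in terms of rising products. -/
theorem hasSum_factorial_div_rise :
    HasSum (fun n : ℕ => (n.factorial : ℝ) / ((n + 1) * rise (1 / 2) (n + 1))) (π ^ 2 / 2) := by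
  set F : ℕ → ℕ → ℝ := fun n k =>
    n.factorial / (((k : ℝ) + 1 / 2) * rise (k + 1 / 2) (n + 1)) with hF
  set G : ℕ → ℕ → ℝ := fun n k => n.factorial / (((n : ℝ) + 1) * rise (k + 1 / 2) (n + 1)) with hG
  have hG0 : ∀ n : ℕ, (n.factorial : ℝ) / ((n + 1) * rise (1 / 2) (n + 1)) = G n 0 := fun n => by
    simp [hG]
  have hFb : ∀ n k, F n k = 1 / ((k : ℝ) + 1 / 2) ^ 2 *
      (n.factorial / rise ((k : ℝ) + 1 / 2 + 1) n) := fun n k => by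
    simp only [hF]
    rw [← mul_rise_add_one]
    have := (rise_pos (by positivity : (0 : ℝ) < k + 1 / 2 + 1) n).ne'
    field_simp
  have hFle : ∀ n k, |F n k| ≤ (√((n : ℝ) + 1))⁻¹ * (1 / ((k : ℝ) + 1 / 2) ^ 2) := fun n k => by
    have := rise_pos (by positivity : (0 : ℝ) < k + 1 / 2 + 1) n
    rw [hFb, abs_of_nonneg (by positivity), mul_comm]
    gcongr
    exact factorial_div_rise_le (by simp) n
  have hsB := summable_inv_sq_add (by norm_num : (0 : ℝ) < 1 / 2)
  rw [funext hG0]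
  refine hasSum_of_wz (F := F) (B := fun k : ℕ => 1 / ((k : ℝ) + 1 / 2) ^ 2)
    (ε := fun n : ℕ => (√((n : ℝ) + 1))⁻¹) (c := fun n : ℕ => 1)
    ?_ ?_ (tendsto_succ_mul_inv_sq_add (by norm_num)) hsB tendsto_inv_sqrt_succ hFle ?_ ?_
  · intro n k
    simp only [hF, hG]
    have hy : (k : ℝ) + 1 / 2 ≠ 0 := by positivity
    push_cast
    rw [show (k : ℝ) + 1 + 1 / 2 = k + 1 / 2 + 1 by ring, rise_add_one hy, rise_succ _ (n + 1),
      Nat.factorial_succ]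
    have := (rise_pos (by positivity : (0 : ℝ) < k + 1 / 2) (n + 1)).ne'
    push_cast
    field_simp
    ring
  · intro n k
    have hr := rise_pos (by positivity : (0 : ℝ) < k + 1 / 2) (n + 1)
    have h1 : G n k = ((k + 1 / 2) / ((n : ℝ) + 1)) * F n k := by
      simp only [hF, hG]
      field_simp
    have h2 : |F n k| ≤ 1 / ((k : ℝ) + 1 / 2) ^ 2 := by
      refine (hFle n k).trans (mul_le_of_le_one_left (by positivity) (inv_le_one_of_one_le₀ ?_))
      rw [Real.one_le_sqrt]
      linarith [(Nat.cast_nonneg n : (0 : ℝ) ≤ n)]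
    rw [h1, abs_mul, one_mul, abs_of_nonneg (by positivity)]
    gcongr
    rw [div_le_iff₀ (by positivity)]
    exact sub_nonneg.1 (by ring_nf; positivity)
  · refine hasSum_inv_half_sq.of_eq (fun k => ?_) rfl
    rw [hFb]
    simp
  -- There is no geometric decay here; the terms are compared with 2(n+1)^{-3/2}.
  · rw [← funext hG0, ← summable_nat_add_iff 1]
    have hbd : ∀ n : ℕ, (n.factorial : ℝ) / ((n + 1) * rise (1 / 2) (n + 1)) ≤
        2 * (1 / ((n : ℝ) + 1) ^ (3 / 2 : ℝ)) := fun n => by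
      have h := factorial_div_rise_half_le n
      have hr := rise_pos (by norm_num : (0 : ℝ) < 1 / 2) (n + 1)
      calc (n.factorial : ℝ) / ((n + 1) * rise (1 / 2) (n + 1))
          = (n.factorial / rise (1 / 2) (n + 1)) * (1 / ((n : ℝ) + 1)) := by field_simp
        _ ≤ 2 * (√((n : ℝ) + 1))⁻¹ * (1 / ((n : ℝ) + 1)) := by gcongr
        _ = _ := by
          rw [show (3 / 2 : ℝ) = 1 + 1 / 2 by norm_num, Real.rpow_add (by positivity),
            Real.rpow_one, Real.sqrt_eq_rpow]
          field_simp
    refine Summable.of_nonneg_of_le (fun n => ?_) (fun n => hbd (n + 1)) ?_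
    · have hr := rise_pos (by norm_num : (0 : ℝ) < 1 / 2) (n + 1 + 1)
      positivity
    · refine Summable.mul_left 2 ?_
      have h := (summable_nat_add_iff 2).2
        (Real.summable_one_div_nat_rpow.2 (by norm_num : (1 : ℝ) < 3 / 2))
      refine h.congr fun n => ?_
      push_cast
      norm_num [add_assoc]

/-- `4 ∑ 4^k/((2k+1)^2 C(2k,k)) = 8G`, in terms of rising products. -/
theorem hasSum_factorial_div_half_rise :
    HasSum (fun n : ℕ => (n.factorial : ℝ) / ((n + 1 / 2) * rise (1 / 2) (n + 1)))
      (8 * catalanG) := by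
  set F : ℕ → ℕ → ℝ := fun n k => (-1) ^ k * ((n + 2 * (k + 1 / 2)) * n.factorial /
    (((k : ℝ) + 1 / 2) * (n + (k + 1 / 2)) * rise (k + 1 / 2) (n + 1))) with hF
  set G : ℕ → ℕ → ℝ := fun n k => (-1) ^ k * (n.factorial /
    ((n + ((k : ℝ) + 1 / 2)) * rise (k + 1 / 2) (n + 1))) with hG
  have hG0 : ∀ n : ℕ, (n.factorial : ℝ) / ((n + 1 / 2) * rise (1 / 2) (n + 1)) = G n 0 :=
    fun n => by simp [hG]
  have hFb : ∀ n k, F n k = (-1) ^ k * (((n + 2 * ((k : ℝ) + 1 / 2)) / (n + (k + 1 / 2))) *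
      (1 / ((k : ℝ) + 1 / 2) ^ 2 * (n.factorial / rise ((k : ℝ) + 1 / 2 + 1) n))) := fun n k => by
    simp only [hF]
    rw [← mul_rise_add_one]
    have := (rise_pos (by positivity : (0 : ℝ) < k + 1 / 2 + 1) n).ne'
    field_simp
  have hFle : ∀ n k, |F n k| ≤ 2 * (√((n : ℝ) + 1))⁻¹ * (1 / ((k : ℝ) + 1 / 2) ^ 2) :=
    fun n k => by
    have := rise_pos (by positivity : (0 : ℝ) < k + 1 / 2 + 1) n
    rw [hFb, abs_mul, abs_pow, abs_neg, abs_one, one_pow, one_mul, abs_of_nonneg (by positivity)]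
    have h1 : (n + 2 * ((k : ℝ) + 1 / 2)) / (n + (k + 1 / 2)) ≤ 2 := by
      rw [div_le_iff₀ (by positivity)]
      linarith [(Nat.cast_nonneg n : (0 : ℝ) ≤ n)]
    have h2 : (n.factorial : ℝ) / rise ((k : ℝ) + 1 / 2 + 1) n ≤ (√((n : ℝ) + 1))⁻¹ :=
      factorial_div_rise_le (by simp) n
    calc _ ≤ 2 * (1 / ((k : ℝ) + 1 / 2) ^ 2 * (√((n : ℝ) + 1))⁻¹) := by gcongr
      _ = _ := by ring
  have hsB := summable_inv_sq_add (by norm_num : (0 : ℝ) < 1 / 2)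
  rw [funext hG0]
  refine hasSum_of_wz (F := F) (B := fun k : ℕ => 1 / ((k : ℝ) + 1 / 2) ^ 2)
    (ε := fun n : ℕ => 2 * (√((n : ℝ) + 1))⁻¹) (c := fun n : ℕ => 2)
    ?_ ?_ (tendsto_succ_mul_inv_sq_add (by norm_num)) hsB
    (by simpa using tendsto_inv_sqrt_succ.const_mul 2) hFle ?_ ?_
  · intro n k
    simp only [hF, hG]
    have hy : (k : ℝ) + 1 / 2 ≠ 0 := by positivity
    push_cast
    rw [show (k : ℝ) + 1 + 1 / 2 = k + 1 / 2 + 1 by ring, rise_add_one hy, rise_succ _ (n + 1),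
      Nat.factorial_succ, pow_succ (-1 : ℝ) k]
    have := (rise_pos (by positivity : (0 : ℝ) < k + 1 / 2) (n + 1)).ne'
    push_cast
    field_simp
    ring
  · intro n k
    have hr := rise_pos (by positivity : (0 : ℝ) < k + 1 / 2) (n + 1)
    have h1 : G n k = ((k + 1 / 2) / ((n : ℝ) + 2 * (k + 1 / 2))) * F n k := by
      simp only [hF, hG]
      field_simp
    have h2 : |F n k| ≤ 2 * (1 / ((k : ℝ) + 1 / 2) ^ 2) := by
      refine (hFle n k).trans ?_
      gcongr
      refine mul_le_of_le_one_right (by norm_num) (inv_le_one_of_one_le₀ ?_)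
      rw [Real.one_le_sqrt]
      linarith [(Nat.cast_nonneg n : (0 : ℝ) ≤ n)]
    have h3 : ((k : ℝ) + 1 / 2) / ((n : ℝ) + 2 * (k + 1 / 2)) ≤ k + 1 := by
      rw [div_le_iff₀ (by positivity)]
      exact sub_nonneg.1 (by ring_nf; positivity)
    rw [h1, abs_mul, abs_of_nonneg (by positivity)]
    calc _ ≤ ((k : ℝ) + 1) * (2 * (1 / ((k : ℝ) + 1 / 2) ^ 2)) := by gcongr
      _ = _ := by ring
  -- At n = 0 the quotient (n + 2y)/(n + y) with y = k + 1/2 equals 2, so the row is 2(−1)^k/y².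
  · refine (hasSum_alternating_inv_half_sq.mul_left 2).of_eq (fun k => ?_) (by ring)
    rw [hFb]
    have hy : (k : ℝ) + 1 / 2 ≠ 0 := by positivity
    simp
    field_simp
  · rw [← funext hG0]
    refine Summable.of_nonneg_of_le (fun n => ?_) (fun n => ?_)
      (hasSum_factorial_div_rise.summable.mul_left 2)
    · have hr := rise_pos (by norm_num : (0 : ℝ) < 1 / 2) (n + 1)
      positivity
    · have hr := rise_pos (by norm_num : (0 : ℝ) < 1 / 2) (n + 1)
      rw [← mul_div_assoc, div_le_div_iff₀ (by positivity) (by positivity)]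
      have h : (n : ℝ) + 1 ≤ 2 * (n + 1 / 2) := by linarith [(Nat.cast_nonneg n : (0 : ℝ) ≤ n)]
      calc (n.factorial : ℝ) * ((n + 1) * rise (1 / 2) (n + 1))
          ≤ n.factorial * ((2 * (n + 1 / 2)) * rise (1 / 2) (n + 1)) := by gcongr
        _ = _ := by ring

theorem le_pow_mul_of_succ_le {u : ℕ → ℝ} {q b : ℝ} (hq : 0 ≤ q) (h0 : u 0 ≤ b)
    (h : ∀ n, u (n + 1) ≤ q * u n) (n : ℕ) : u n ≤ q ^ n * b := by
  induction n with
  | zero => simpa using h0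
  | succ n ih =>
    calc u (n + 1) ≤ q * u n := h n
      _ ≤ q * (q ^ n * b) := by gcongr
      _ = _ := by ring

/-- With H as below the pair is (4n+2)H and (3n+2k+2)H. The row n = 0 is 2/(k+1/2)², of sum π², and
the column k = 0 is twice the wanted series. -/
theorem hasSum_cubeTerm_sixteen :
    HasSum (fun n : ℕ => (3 * ((n : ℝ) + 1) - 1) * cubeTerm 16 n) (π ^ 2 / 2) := by
  set H : ℕ → ℕ → ℝ := fun n k =>
    (n.factorial : ℝ) ^ 4 / ((2 * n + 1).factorial * rise (k + 1 / 2) (n + 1) ^ 2) with hH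
  have hHpos : ∀ n k, 0 ≤ H n k := fun n k => by simp only [hH]; positivity
  have hleft : ∀ n k : ℕ, H (n + 1) k = (n + 1) ^ 4 /
      ((2 * n + 2) * (2 * n + 3) * (k + 1 / 2 + (n + 1)) ^ 2) * H n k := fun n k => by
    simp only [hH]
    rw [show 2 * (n + 1) + 1 = 2 * n + 1 + 1 + 1 by ring, Nat.factorial_succ n,
      Nat.factorial_succ (2 * n + 1 + 1), Nat.factorial_succ (2 * n + 1), rise_succ _ (n + 1)]
    have := (rise_pos (by positivity : (0 : ℝ) < k + 1 / 2) (n + 1)).ne'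
    have := factorial_ne_zero_real (2 * n + 1)
    push_cast
    field_simp
    ring
  have hright : ∀ n k : ℕ, H n (k + 1) =
      ((k + 1 / 2) / (k + 1 / 2 + (n + 1))) ^ 2 * H n k := fun n k => by
    simp only [hH]
    have hy : (k : ℝ) + 1 / 2 ≠ 0 := by positivity
    push_cast
    rw [show (k : ℝ) + 1 + 1 / 2 = k + 1 / 2 + 1 by ring, rise_add_one hy]
    have := (rise_pos (by positivity : (0 : ℝ) < k + 1 / 2) (n + 1)).ne'
    have := factorial_ne_zero_real (2 * n + 1)
    push_cast
    field_simp
  have hH0 : ∀ k, H 0 k = 1 / ((k : ℝ) + 1 / 2) ^ 2 := fun k => by simp [hH, rise_succ]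
  have hHle : ∀ n k : ℕ, H n k ≤ (1 / 4) ^ n * (1 / ((k : ℝ) + 1 / 2) ^ 2) := fun n k => by
    refine le_pow_mul_of_succ_le (u := fun n => H n k) (by norm_num) (hH0 k).le (fun n => ?_) n
    simp only [hleft]
    refine mul_le_mul_of_nonneg_right ?_ (hHpos n k)
    rw [div_le_div_iff₀ (by positivity) (by norm_num)]
    exact sub_nonneg.1 (by ring_nf; positivity)
  have hG0 : ∀ n : ℕ, (3 * ((n : ℝ) + 1) - 1) * cubeTerm 16 n =
      1 / 2 * ((3 * n + 2 * ((0 : ℕ) : ℝ) + 2) * H n 0) := fun n => by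
    rw [cubeTerm_eq]
    simp only [hH]
    rw [Nat.cast_zero, zero_add, rise_half, show 2 * (n + 1) = 2 * n + 1 + 1 by ring,
      Nat.factorial_succ n, Nat.factorial_succ (2 * n + 1)]
    have := factorial_ne_zero_real (2 * n + 1)
    have := factorial_ne_zero_real n
    have h16 : (16 : ℝ) ^ (n + 1) = 4 ^ (n + 1) * 4 ^ (n + 1) := by rw [← mul_pow]; norm_num
    rw [h16]
    push_cast
    field_simp
    ring
  have hs : Summable fun n : ℕ => (3 * (n : ℝ) + 2 * ((0 : ℕ) : ℝ) + 2) * H n 0 := by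
    refine ((summable_linear_mul (by norm_num) (by norm_num) (cubeTerm_ratio 16) 3 1).mul_left
      2).congr fun n => ?_
    rw [hG0]
    ring
  suffices h : HasSum (fun n : ℕ => (3 * (n : ℝ) + 2 * ((0 : ℕ) : ℝ) + 2) * H n 0) (π ^ 2) from
    (h.mul_left (1 / 2)).of_eq hG0 (by ring)
  refine hasSum_of_wz (F := fun n k => (4 * n + 2) * H n k)
    (G := fun n k => (3 * n + 2 * k + 2) * H n k)
    (B := fun k : ℕ => 1 / ((k : ℝ) + 1 / 2) ^ 2)
    (ε := fun n : ℕ => (4 * n + 2) * (1 / 4) ^ n) (c := fun n : ℕ => 3 * n + 2)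
    ?_ ?_ (tendsto_succ_mul_inv_sq_add (by norm_num)) (summable_inv_sq_add (by norm_num))
    (tendsto_linear_mul_pow (by norm_num) (by norm_num) 4 2) ?_ ?_ hs
  · intro n k
    simp only [hleft, hright]
    push_cast
    field_simp
    ring
  · intro n k
    have h0 := hHpos n k
    rw [abs_of_nonneg (by positivity)]
    have h1 : H n k ≤ 1 / ((k : ℝ) + 1 / 2) ^ 2 := (hHle n k).trans
      (mul_le_of_le_one_left (by positivity) (pow_le_one₀ (by norm_num) (by norm_num)))
    calc _ ≤ ((3 * n + 2) * ((k : ℝ) + 1)) * (1 / ((k : ℝ) + 1 / 2) ^ 2) := by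
          gcongr
          exact sub_nonneg.1 (by ring_nf; positivity)
      _ = _ := by ring
  · intro n k
    have h0 := hHpos n k
    rw [abs_of_nonneg (by positivity), mul_assoc]
    gcongr
    exact hHle n k
  · refine (hasSum_inv_half_sq.mul_left 2).of_eq (fun k => ?_) (by ring)
    simp only [hH0]
    norm_num

/-- The row n = 0 of this pair is not a sum of reciprocal squares but twice the series of
`hasSum_factorial_div_rise`, so two pairs are chained. That row decays only like k^{-3/2}, which
still suffices as the dominating sequence B. -/
theorem hasSum_tripleTerm_eight :
    HasSum (fun n : ℕ => (10 * ((n : ℝ) + 1) - 3) * tripleTerm 8 n) (π ^ 2 / 2) := by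
  set H : ℕ → ℕ → ℝ := fun n k => (n.factorial : ℝ) ^ 3 * ((n + k).factorial : ℝ) ^ 2 * 4 ^ k *
    8 ^ (n + 1) / ((3 * n + 2 * k + 3).factorial * (2 * n + 1).factorial) with hH
  have hHpos : ∀ n k, 0 ≤ H n k := fun n k => by simp only [hH]; positivity
  have hleft : ∀ n k : ℕ, H (n + 1) k = 8 * (n + 1) ^ 3 * (n + k + 1) ^ 2 /
      ((3 * n + 2 * k + 4) * (3 * n + 2 * k + 5) * (3 * n + 2 * k + 6) * (2 * n + 2) * (2 * n + 3))
      * H n k := fun n k => by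
    simp only [hH]
    rw [show 2 * (n + 1) + 1 = 2 * n + 1 + 1 + 1 by ring, show n + 1 + k = n + k + 1 by ring,
      show 3 * (n + 1) + 2 * k + 3 = 3 * n + 2 * k + 3 + 1 + 1 + 1 by ring, Nat.factorial_succ n,
      Nat.factorial_succ (2 * n + 1 + 1), Nat.factorial_succ (2 * n + 1), Nat.factorial_succ (n + k),
      Nat.factorial_succ (3 * n + 2 * k + 3 + 1 + 1), Nat.factorial_succ (3 * n + 2 * k + 3 + 1),
      Nat.factorial_succ (3 * n + 2 * k + 3)]
    have := factorial_ne_zero_real (2 * n + 1)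
    have := factorial_ne_zero_real (3 * n + 2 * k + 3)
    push_cast
    field_simp
    ring
  have hright : ∀ n k : ℕ, H n (k + 1) =
      4 * (n + k + 1) ^ 2 / ((3 * n + 2 * k + 4) * (3 * n + 2 * k + 5)) * H n k := fun n k => by
    simp only [hH]
    rw [show n + (k + 1) = n + k + 1 by ring,
      show 3 * n + 2 * (k + 1) + 3 = 3 * n + 2 * k + 3 + 1 + 1 by ring,
      Nat.factorial_succ (n + k),
      Nat.factorial_succ (3 * n + 2 * k + 3 + 1), Nat.factorial_succ (3 * n + 2 * k + 3)]
    have := factorial_ne_zero_real (2 * n + 1)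
    have := factorial_ne_zero_real (3 * n + 2 * k + 3)
    push_cast
    field_simp
    ring
  set B : ℕ → ℝ := fun k => 2 * (k.factorial / ((k + 1) * rise (1 / 2) (k + 1))) with hB
  have hBpos : ∀ k, 0 ≤ B k := fun k => by
    have := rise_pos (by norm_num : (0 : ℝ) < 1 / 2) (k + 1)
    simp only [hB]
    positivity
  have hH0 : ∀ k : ℕ, H 0 k = B k / (2 * k + 3) := fun k => by
    simp only [hH, hB]
    rw [rise_half, show 3 * 0 + 2 * k + 3 = 2 * k + 1 + 1 + 1 by ring,
      show 2 * (k + 1) = 2 * k + 1 + 1 by ring, zero_add, Nat.factorial_succ k,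
      Nat.factorial_succ (2 * k + 1 + 1)]
    have := factorial_ne_zero_real (2 * k + 1 + 1)
    push_cast
    simp only [Nat.factorial_zero, Nat.factorial_one]
    field_simp
    ring
  have hHle : ∀ n k : ℕ, H n k ≤ (2 / 3) ^ n * (B k / (2 * k + 3)) := fun n k => by
    refine le_pow_mul_of_succ_le (u := fun n => H n k) (by norm_num) (hH0 k).le (fun n => ?_) n
    simp only [hleft]
    refine mul_le_mul_of_nonneg_right ?_ (hHpos n k)
    rw [div_le_div_iff₀ (by positivity) (by norm_num)]
    exact sub_nonneg.1 (by ring_nf; positivity)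
  have hB0 : Tendsto (fun k : ℕ => ((k : ℝ) + 1) * B k) atTop (𝓝 0) := by
    refine squeeze_zero (fun k => mul_nonneg (by positivity) (hBpos k)) (fun k => ?_)
      (by simpa using tendsto_inv_sqrt_succ.const_mul 4)
    have h := factorial_div_rise_half_le k
    have hr := rise_pos (by norm_num : (0 : ℝ) < 1 / 2) (k + 1)
    calc ((k : ℝ) + 1) * B k = 2 * (k.factorial / rise (1 / 2) (k + 1)) := by
          simp only [hB]
          field_simp
      _ ≤ 2 * (2 * (√((k : ℝ) + 1))⁻¹) := by gcongr
      _ = _ := by ring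
  have hG0 : ∀ n : ℕ, (10 * ((n : ℝ) + 1) - 3) * tripleTerm 8 n =
      1 / 2 * ((10 * ((n : ℝ) + 1) ^ 2 - 3 * (n + 1) + 12 * ((0 : ℕ) : ℝ) * (n + 1)
        - 2 * ((0 : ℕ) : ℝ) + 4 * ((0 : ℕ) : ℝ) ^ 2) * H n 0) := fun n => by
    rw [tripleTerm_eq]
    simp only [hH]
    rw [Nat.cast_zero, mul_zero, add_zero, show 2 * n + 2 = 2 * n + 1 + 1 by ring,
      Nat.factorial_succ (2 * n + 1)]
    have := factorial_ne_zero_real (2 * n + 1)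
    have := factorial_ne_zero_real (3 * n + 3)
    simp only [mul_zero, add_zero]
    push_cast
    field_simp
    ring
  have hs : Summable fun n : ℕ => (10 * ((n : ℝ) + 1) ^ 2 - 3 * (n + 1)
      + 12 * ((0 : ℕ) : ℝ) * (n + 1) - 2 * ((0 : ℕ) : ℝ) + 4 * ((0 : ℕ) : ℝ) ^ 2) * H n 0 := by
    refine ((summable_linear_mul (by norm_num) (by norm_num) (tripleTerm_ratio 8) 10 3).mul_left
      2).congr fun n => ?_
    rw [hG0]
    ring
  suffices h : HasSum (fun n : ℕ => (10 * ((n : ℝ) + 1) ^ 2 - 3 * (n + 1)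
      + 12 * ((0 : ℕ) : ℝ) * (n + 1) - 2 * ((0 : ℕ) : ℝ) + 4 * ((0 : ℕ) : ℝ) ^ 2) * H n 0)
      (π ^ 2) from (h.mul_left (1 / 2)).of_eq hG0 (by ring)
  refine hasSum_of_wz (F := fun n k => (2 * n + 1) * (2 * k + 3 * n + 3) * H n k)
    (G := fun n k => (10 * ((n : ℝ) + 1) ^ 2 - 3 * (n + 1)
      + 12 * (k : ℝ) * (n + 1) - 2 * (k : ℝ) + 4 * (k : ℝ) ^ 2) * H n k)
    (B := B) (ε := fun n : ℕ => (2 * n ^ 2 + 3 * n + 1) * (2 / 3) ^ n)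
    (c := fun n : ℕ => 30 * ((n : ℝ) + 1) ^ 2)
    ?_ ?_ hB0 (hasSum_factorial_div_rise.summable.mul_left 2)
    (tendsto_quadratic_mul_pow (by norm_num) (by norm_num) 2 3 1) ?_ ?_ hs
  · intro n k
    simp only [hleft, hright]
    push_cast
    field_simp
    ring
  · intro n k
    have h0 := hHpos n k
    have hb := hBpos k
    rw [abs_mul, abs_of_nonneg h0]
    have h1 : H n k ≤ B k / (2 * k + 3) := (hHle n k).trans
      (mul_le_of_le_one_left (by positivity) (pow_le_one₀ (by norm_num) (by norm_num)))
    have h2 : |10 * ((n : ℝ) + 1) ^ 2 - 3 * (n + 1) + 12 * (k : ℝ) * (n + 1) - 2 * (k : ℝ)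
        + 4 * (k : ℝ) ^ 2| ≤ 30 * ((n : ℝ) + 1) ^ 2 * (k + 1) ^ 2 := by
      rw [abs_le]
      constructor
      · exact sub_nonneg.1 (by ring_nf; positivity)
      · exact sub_nonneg.1 (by ring_nf; positivity)
    calc _ ≤ 30 * ((n : ℝ) + 1) ^ 2 * (k + 1) ^ 2 * (B k / (2 * k + 3)) := by gcongr
      _ = 30 * ((n : ℝ) + 1) ^ 2 * (((k : ℝ) + 1) * B k) * ((k + 1) / (2 * k + 3)) := by ring
      _ ≤ _ := by
        refine mul_le_of_le_one_right (by positivity) ?_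
        rw [div_le_one (by positivity)]
        linarith [(Nat.cast_nonneg k : (0 : ℝ) ≤ k)]
  · intro n k
    have h0 := hHpos n k
    have hb := hBpos k
    rw [abs_of_nonneg (by positivity)]
    calc _ ≤ (2 * n + 1) * ((n + 1) * (2 * k + 3)) * ((2 / 3) ^ n * (B k / (2 * k + 3))) := by
          gcongr
          · exact sub_nonneg.1 (by ring_nf; positivity)
          · exact hHle n k
      _ = _ := by
          field_simp
          ring
  · refine (hasSum_factorial_div_rise.mul_left 2).of_eq (fun k => ?_) (by ring)
    simp only [hH0, hB]
    push_cast
    field_simp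
    ring

/-- Again two pairs are chained: the row n = 0 is −1/4 times the series of
`hasSum_factorial_div_half_rise`, with value −(1/4) · 8G. -/
theorem hasSum_cubeTerm_neg_eight :
    HasSum (fun n : ℕ => (3 * ((n : ℝ) + 1) - 1) * cubeTerm (-8) n) (-2 * catalanG) := by
  set H : ℕ → ℕ → ℝ := fun n k => (n.factorial : ℝ) ^ 2 * ((n + 2 * k).factorial /
    (2 * k).factorial) * (k.factorial / rise (1 / 2) k) * (-1 / 8) ^ (n + 1) /
    (rise (1 / 2) (n + 1) * rise (k + 1 / 2) (n + 1) ^ 2) with hH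
  have hleft : ∀ n k : ℕ, H (n + 1) k = -((n + 1) ^ 2 * (n + 2 * k + 1) /
      (8 * (1 / 2 + (n + 1)) * (k + 1 / 2 + (n + 1)) ^ 2)) * H n k := fun n k => by
    simp only [hH]
    rw [show n + 1 + 2 * k = n + 2 * k + 1 by ring, Nat.factorial_succ n,
      Nat.factorial_succ (n + 2 * k), rise_succ _ (n + 1), rise_succ _ (n + 1)]
    have := (rise_pos (by positivity : (0 : ℝ) < k + 1 / 2) (n + 1)).ne'
    have := (rise_pos (by positivity : (0 : ℝ) < 1 / 2) (n + 1)).ne'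
    have := (rise_pos (by positivity : (0 : ℝ) < 1 / 2) k).ne'
    have := factorial_ne_zero_real (2 * k)
    rw [pow_succ _ (n + 1)]
    push_cast
    field_simp
  have hright : ∀ n k : ℕ, H n (k + 1) = ((n + 2 * k + 1) * (n + 2 * k + 2) * (k + 1 / 2) /
      ((2 * k + 1) * 2 * (k + 1 / 2 + (n + 1)) ^ 2)) * H n k := fun n k => by
    simp only [hH]
    have hy : (k : ℝ) + 1 / 2 ≠ 0 := by positivity
    push_cast
    rw [show (k : ℝ) + 1 + 1 / 2 = k + 1 / 2 + 1 by ring, rise_add_one hy,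
      show n + 2 * (k + 1) = n + 2 * k + 1 + 1 by ring, show 2 * (k + 1) = 2 * k + 1 + 1 by ring,
      Nat.factorial_succ k, Nat.factorial_succ (n + 2 * k + 1), Nat.factorial_succ (n + 2 * k),
      Nat.factorial_succ (2 * k + 1), Nat.factorial_succ (2 * k), rise_succ _ k]
    have := (rise_pos (by positivity : (0 : ℝ) < k + 1 / 2) (n + 1)).ne'
    have := (rise_pos (by positivity : (0 : ℝ) < 1 / 2) (n + 1)).ne'
    have := (rise_pos (by positivity : (0 : ℝ) < 1 / 2) k).ne'
    have := factorial_ne_zero_real (2 * k)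
    push_cast
    field_simp
    ring
  set B : ℕ → ℝ := fun k => 1 / 4 * (k.factorial / ((k + 1 / 2) * rise (1 / 2) (k + 1))) with hB
  have hBpos : ∀ k, 0 ≤ B k := fun k => by
    have := rise_pos (by norm_num : (0 : ℝ) < 1 / 2) (k + 1)
    simp only [hB]
    positivity
  have hH0 : ∀ k : ℕ, H 0 k = -B k := fun k => by
    simp only [hH, hB]
    rw [rise_succ _ k, zero_add, rise_succ, rise_succ, zero_add]
    have := (rise_pos (by positivity : (0 : ℝ) < 1 / 2) k).ne'
    have := factorial_ne_zero_real (2 * k)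
    simp only [rise_zero, Nat.factorial_zero]
    push_cast
    field_simp
    ring
  have hHle : ∀ n k : ℕ, |H n k| ≤ (1 / 4) ^ n * B k := fun n k => by
    refine le_pow_mul_of_succ_le (u := fun n => |H n k|) (by norm_num) (b := B k) ?_
      (fun n => ?_) n
    · rw [hH0, abs_neg, abs_of_nonneg (hBpos k)]
    · simp only [hleft]
      rw [abs_mul, abs_neg]
      refine mul_le_mul_of_nonneg_right ?_ (abs_nonneg _)
      rw [abs_of_nonneg (by positivity), div_le_div_iff₀ (by positivity) (by norm_num)]
      exact sub_nonneg.1 (by ring_nf; positivity)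
  have hB0 : Tendsto (fun k : ℕ => ((k : ℝ) + 1) * B k) atTop (𝓝 0) := by
    refine squeeze_zero (fun k => mul_nonneg (by positivity) (hBpos k)) (fun k => ?_)
      (by simpa using tendsto_inv_sqrt_succ)
    have h := factorial_div_rise_half_le k
    have hr := rise_pos (by norm_num : (0 : ℝ) < 1 / 2) (k + 1)
    calc ((k : ℝ) + 1) * B k =
          1 / 4 * ((k + 1) / (k + 1 / 2)) * (k.factorial / rise (1 / 2) (k + 1)) := by
          simp only [hB]
          field_simp
      _ ≤ 1 / 4 * 2 * (2 * (√((k : ℝ) + 1))⁻¹) := by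
          gcongr
          rw [div_le_iff₀ (by positivity)]
          linarith [(Nat.cast_nonneg k : (0 : ℝ) ≤ k)]
      _ = _ := by ring
  have hG0 : ∀ n : ℕ, (3 * ((n : ℝ) + 1) - 1) * cubeTerm (-8) n =
      (3 * n + 2 * ((0 : ℕ) : ℝ) + 2) * H n 0 := fun n => by
    rw [cubeTerm_eq]
    simp only [hH]
    rw [Nat.cast_zero, zero_add, rise_half (n + 1), show 2 * (n + 1) = 2 * n + 2 by ring,
      Nat.factorial_succ n]
    have := factorial_ne_zero_real (2 * n + 2)
    have := factorial_ne_zero_real n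
    -- The three powers of 4 cancel those in the closed form of (1/2)_{n+1}, which occurs cubed at k
    -- = 0.
    have h8 : (-8 : ℝ) ^ (n + 1) = 4 ^ (n + 1) * 4 ^ (n + 1) * 4 ^ (n + 1) * (-1 / 8) ^ (n + 1) := by
      rw [← mul_pow, ← mul_pow, ← mul_pow]; norm_num
    rw [h8]
    simp only [mul_zero, add_zero, Nat.factorial_zero, rise_zero]
    push_cast
    field_simp
    ring
  rw [funext hG0]
  refine hasSum_of_wz (F := fun n k => (2 * n + 1) * H n k)
    (G := fun n k => (3 * n + 2 * k + 2) * H n k)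
    (B := B) (ε := fun n : ℕ => (2 * n + 1) * (1 / 4) ^ n) (c := fun n : ℕ => 3 * n + 2)
    ?_ ?_ hB0 (hasSum_factorial_div_half_rise.summable.mul_left _)
    (tendsto_linear_mul_pow (by norm_num) (by norm_num) 2 1) ?_ ?_ ?_
  · intro n k
    simp only [hleft, hright]
    push_cast
    field_simp
    ring
  · intro n k
    have hb := hBpos k
    rw [abs_mul, abs_of_nonneg (by positivity)]
    have h1 : |H n k| ≤ B k := (hHle n k).trans
      (mul_le_of_le_one_left hb (pow_le_one₀ (by norm_num) (by norm_num)))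
    calc _ ≤ ((3 * n + 2) * ((k : ℝ) + 1)) * B k := by
          gcongr
          exact sub_nonneg.1 (by ring_nf; positivity)
      _ = _ := by ring
  · intro n k
    rw [abs_mul, abs_of_nonneg (by positivity), mul_assoc]
    gcongr
    exact hHle n k
  · refine (hasSum_factorial_div_half_rise.mul_left (-1 / 4)).of_eq (fun k => ?_) (by ring)
    simp only [hH0, hB]
    push_cast
    ring
  · rw [← funext hG0]
    exact summable_linear_mul (by norm_num) (by norm_num) (cubeTerm_ratio (-8)) 3 1

/-! ### The constant K by residues modulo 3, and the series at −27 -/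

theorem hasSum_pnat_iff_nat {f : ℕ → ℝ} {a : ℝ} :
    HasSum (fun k : ℕ+ => f k) a ↔ HasSum (fun n : ℕ => f (n + 1)) a := by
  rw [← Equiv.pnatEquivNat.symm.hasSum_iff]
  rfl

theorem summable_constK_nat :
    Summable (fun k : ℕ => ((legendreSym 3 (k : ℤ) : ℤ) : ℝ) / (k : ℝ) ^ 2) := by
  have h := (hasSum_pnat_iff_nat (f := fun k : ℕ => ((legendreSym 3 (k : ℤ) : ℤ) : ℝ) /
    (k : ℝ) ^ 2)).1 summable_constK.hasSum
  exact (summable_nat_add_iff 1).1 h.summable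

theorem hasSum_constK_nat :
    HasSum (fun k : ℕ => ((legendreSym 3 (k : ℤ) : ℤ) : ℝ) / (k : ℝ) ^ 2) constK := by
  have h := (hasSum_pnat_iff_nat (f := fun k : ℕ => ((legendreSym 3 (k : ℤ) : ℤ) : ℝ) /
    (k : ℝ) ^ 2)).1 summable_constK.hasSum
  have h1 := (hasSum_nat_add_iff (f := fun k : ℕ => ((legendreSym 3 (k : ℤ) : ℤ) : ℝ) /
    (k : ℝ) ^ 2) 1).1 h
  simpa [constK] using h1

theorem legendreSym_three_mul_add (j : ℕ) :
    legendreSym 3 ((3 * j : ℕ) : ℤ) = 0 ∧ legendreSym 3 ((3 * j + 1 : ℕ) : ℤ) = 1 ∧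
      legendreSym 3 ((3 * j + 2 : ℕ) : ℤ) = -1 := by
  refine ⟨?_, ?_, ?_⟩
  · rw [legendreSym.mod 3]
    have : ((3 * j : ℕ) : ℤ) % (3 : ℕ) = 0 := by omega
    rw [this]
    decide
  · rw [legendreSym.mod 3]
    have : ((3 * j + 1 : ℕ) : ℤ) % (3 : ℕ) = 1 := by omega
    rw [this]
    decide
  · rw [legendreSym.mod 3]
    have : ((3 * j + 2 : ℕ) : ℤ) % (3 : ℕ) = 2 := by omega
    rw [this]
    decide

/-- `∑ (1/(k+1/3)^2 - 1/(k+2/3)^2) = 9K`. -/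
theorem hasSum_thirds : HasSum (fun k : ℕ => 1 / ((k : ℝ) + 1 / 3) ^ 2 -
    1 / ((k : ℝ) + 2 / 3) ^ 2) (9 * constK) := by
  have hs := (summable_inv_sq_add (by norm_num : (0 : ℝ) < 1 / 3)).sub
    (summable_inv_sq_add (by norm_num : (0 : ℝ) < 2 / 3))
  have h := Nat.sumByResidueClasses summable_constK_nat 3
  rw [hasSum_constK_nat.tsum_eq, show (Finset.univ : Finset (ZMod 3)) = {0, 1, 2} by decide,
    Finset.sum_insert (by decide), Finset.sum_insert (by decide), Finset.sum_singleton] at h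
  have e0 : ∀ m : ℕ, ((legendreSym 3 (((ZMod.val (0 : ZMod 3) + 3 * m : ℕ)) : ℤ) : ℤ) : ℝ) /
      ((ZMod.val (0 : ZMod 3) + 3 * m : ℕ) : ℝ) ^ 2 = 0 := fun m => by
    rw [show ZMod.val (0 : ZMod 3) + 3 * m = 3 * m by simp, (legendreSym_three_mul_add m).1]
    simp
  have e1 : ∀ m : ℕ, ((legendreSym 3 (((ZMod.val (1 : ZMod 3) + 3 * m : ℕ)) : ℤ) : ℤ) : ℝ) /
      ((ZMod.val (1 : ZMod 3) + 3 * m : ℕ) : ℝ) ^ 2 = 1 / 9 * (1 / ((m : ℝ) + 1 / 3) ^ 2) :=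
    fun m => by
    rw [show ZMod.val (1 : ZMod 3) + 3 * m = 3 * m + 1 by
      rw [show ZMod.val (1 : ZMod 3) = 1 from rfl, add_comm], (legendreSym_three_mul_add m).2.1]
    push_cast
    have : (m : ℝ) + 1 / 3 ≠ 0 := by positivity
    field_simp
    ring
  have e2 : ∀ m : ℕ, ((legendreSym 3 (((ZMod.val (2 : ZMod 3) + 3 * m : ℕ)) : ℤ) : ℤ) : ℝ) /
      ((ZMod.val (2 : ZMod 3) + 3 * m : ℕ) : ℝ) ^ 2 = -(1 / 9) * (1 / ((m : ℝ) + 2 / 3) ^ 2) :=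
    fun m => by
    rw [show ZMod.val (2 : ZMod 3) + 3 * m = 3 * m + 2 by
      rw [show ZMod.val (2 : ZMod 3) = 2 from rfl, add_comm], (legendreSym_three_mul_add m).2.2]
    push_cast
    have : (m : ℝ) + 2 / 3 ≠ 0 := by positivity
    field_simp
    ring
  rw [tsum_congr e0, tsum_congr e1, tsum_congr e2, tsum_zero, zero_add, tsum_mul_left,
    tsum_mul_left] at h
  have h2 := (summable_inv_sq_add (by norm_num : (0 : ℝ) < 1 / 3)).hasSum.sub
    (summable_inv_sq_add (by norm_num : (0 : ℝ) < 2 / 3)).hasSum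
  refine h2.of_eq (fun _ => rfl) ?_
  rw [h]
  ring

/-- At n = 0 the row is (2k+1)/((k+1/3)(k+2/3))². By partial fractions this is 3(1/(k+1/3)² −
1/(k+2/3)²), so the row sums to 3 · 9K. -/
theorem hasSum_tripleTerm_neg_twentySeven :
    HasSum (fun n : ℕ => (15 * ((n : ℝ) + 1) - 4) * tripleTerm (-27) n) (-27 * constK) := by
  set H : ℕ → ℕ → ℝ := fun n k => (-1) ^ n * (rise (4 / 3) n * rise (2 / 3) n *
    (n.factorial : ℝ) ^ 4 / ((2 * n).factorial *
      (rise (k + 1 / 3) (n + 1) * rise (k + 2 / 3) (n + 1)) ^ 2)) with hH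
  have hleft : ∀ n k : ℕ, H (n + 1) k = -((n + 1) ^ 4 * (n + 4 / 3) * (n + 2 / 3) /
      ((2 * n + 1) * (2 * n + 2) * ((k + 1 / 3 + (n + 1)) * (k + 2 / 3 + (n + 1))) ^ 2)) *
      H n k := fun n k => by
    simp only [hH]
    rw [show 2 * (n + 1) = 2 * n + 1 + 1 by ring, Nat.factorial_succ n,
      Nat.factorial_succ (2 * n + 1), Nat.factorial_succ (2 * n), rise_succ _ (n + 1),
      rise_succ _ (n + 1), rise_succ _ n, rise_succ _ n, pow_succ (-1 : ℝ) n]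
    have := (rise_pos (by positivity : (0 : ℝ) < k + 1 / 3) (n + 1)).ne'
    have := (rise_pos (by positivity : (0 : ℝ) < k + 2 / 3) (n + 1)).ne'
    have := factorial_ne_zero_real (2 * n)
    push_cast
    field_simp
    ring
  have hright : ∀ n k : ℕ, H n (k + 1) = ((k + 1 / 3) * (k + 2 / 3) /
      ((k + 1 / 3 + (n + 1)) * (k + 2 / 3 + (n + 1)))) ^ 2 * H n k := fun n k => by
    simp only [hH]
    have h1 : (k : ℝ) + 1 / 3 ≠ 0 := by positivity
    have h2 : (k : ℝ) + 2 / 3 ≠ 0 := by positivity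
    push_cast
    rw [show (k : ℝ) + 1 + 1 / 3 = k + 1 / 3 + 1 by ring, rise_add_one h1,
      show (k : ℝ) + 1 + 2 / 3 = k + 2 / 3 + 1 by ring, rise_add_one h2]
    have := (rise_pos (by positivity : (0 : ℝ) < k + 1 / 3) (n + 1)).ne'
    have := (rise_pos (by positivity : (0 : ℝ) < k + 2 / 3) (n + 1)).ne'
    have := factorial_ne_zero_real (2 * n)
    push_cast
    field_simp
  have hH0 : ∀ k : ℕ, H 0 k = 1 / (((k : ℝ) + 1 / 3) * (k + 2 / 3)) ^ 2 := fun k => by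
    simp [hH, rise_succ]
  set B : ℕ → ℝ := fun k => 1 / ((k : ℝ) + 1 / 3) ^ 2 with hB
  have hBpos : ∀ k, 0 ≤ B k := fun k => by simp only [hB]; positivity
  have hHle : ∀ n k : ℕ, |H n k| ≤ (1 / 2) ^ n * (1 / (((k : ℝ) + 1 / 3) * (k + 2 / 3)) ^ 2) :=
    fun n k => by
    refine le_pow_mul_of_succ_le (u := fun n => |H n k|) (by norm_num) ?_ (fun n => ?_) n
    · simp only [hH0]
      rw [abs_of_nonneg (by positivity)]
    · simp only [hleft]
      rw [abs_mul, abs_neg]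
      refine mul_le_mul_of_nonneg_right ?_ (abs_nonneg _)
      rw [abs_of_nonneg (by positivity), div_le_div_iff₀ (by positivity) (by norm_num)]
      exact sub_nonneg.1 (by ring_nf; positivity)
  have hG0 : ∀ n : ℕ, (15 * ((n : ℝ) + 1) - 4) * tripleTerm (-27) n =
      -((5 / 4 * (n + 2 / 3) * (n + 11 / 15) + 3 / 2 * (n + 2 / 3) * ((0 : ℕ) : ℝ)
        + ((0 : ℕ) : ℝ) ^ 2 / 2) / (n + 1 / 2) * H n 0) := fun n => by
    rw [tripleTerm_eq]
    simp only [hH]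
    rw [Nat.cast_zero, zero_add, zero_add]
    -- Lengthening both products by one factor turns them into (1/3)_{n+1}(2/3)_{n+1}, which
    -- `rise_thirds` writes with factorials.
    have h1 : rise (4 / 3) n * rise (2 / 3) n =
        3 * (rise (1 / 3) (n + 1) * rise (2 / 3) (n + 1)) / (n + 2 / 3) := by
      rw [rise_succ (2 / 3), ← mul_rise_add_one (1 / 3)]
      have : (n : ℝ) + 2 / 3 ≠ 0 := by positivity
      norm_num
      field_simp
      ring
    rw [h1, rise_thirds, show 3 * (n + 1) = 3 * n + 3 by ring,
      show 2 * n + 2 = 2 * n + 1 + 1 by ring, Nat.factorial_succ (2 * n + 1),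
      Nat.factorial_succ (2 * n), Nat.factorial_succ n]
    have := factorial_ne_zero_real (3 * n + 3)
    have := factorial_ne_zero_real (2 * n)
    have := factorial_ne_zero_real n
    have h27 : (-27 : ℝ) ^ (n + 1) = -((-1) ^ n * 27 ^ (n + 1)) := by
      rw [show (-27 : ℝ) = -1 * 27 by norm_num, mul_pow, pow_succ (-1 : ℝ) n]
      ring
    rw [h27]
    push_cast
    field_simp
    ring
  have hs : Summable fun n : ℕ => (5 / 4 * ((n : ℝ) + 2 / 3) * (n + 11 / 15)
      + 3 / 2 * (n + 2 / 3) * ((0 : ℕ) : ℝ) + ((0 : ℕ) : ℝ) ^ 2 / 2) / (n + 1 / 2) * H n 0 := by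
    refine (summable_linear_mul (by norm_num) (by norm_num) (tripleTerm_ratio (-27)) 15
      4).neg.congr fun n => ?_
    rw [hG0, neg_neg]
  suffices h : HasSum (fun n : ℕ => (5 / 4 * ((n : ℝ) + 2 / 3) * (n + 11 / 15)
      + 3 / 2 * (n + 2 / 3) * ((0 : ℕ) : ℝ) + ((0 : ℕ) : ℝ) ^ 2 / 2) / (n + 1 / 2) * H n 0)
      (27 * constK) from h.neg.of_eq hG0 (by ring)
  have hbnd : ∀ k : ℕ, (2 * (k : ℝ) + 1) * (1 / (((k : ℝ) + 1 / 3) * (k + 2 / 3)) ^ 2) ≤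
      3 * B k := fun k => by
    simp only [hB]
    rw [mul_one_div, mul_one_div, div_le_div_iff₀ (by positivity) (by positivity)]
    exact sub_nonneg.1 (by ring_nf; positivity)
  refine hasSum_of_wz (F := fun n k => (n + 1 + 2 * k) * H n k)
    (G := fun n k => (5 / 4 * ((n : ℝ) + 2 / 3) * (n + 11 / 15)
      + 3 / 2 * (n + 2 / 3) * (k : ℝ) + (k : ℝ) ^ 2 / 2) / (n + 1 / 2) * H n k)
    (B := B) (ε := fun n : ℕ => (3 * n + 3) * (1 / 2) ^ n)
    (c := fun n : ℕ => 12 * ((n : ℝ) + 1))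
    ?_ ?_ (tendsto_succ_mul_inv_sq_add (by norm_num)) (summable_inv_sq_add (by norm_num))
    (tendsto_linear_mul_pow (by norm_num) (by norm_num) 3 3) ?_ ?_ hs
  · intro n k
    simp only [hleft, hright]
    push_cast
    field_simp
    ring
  · intro n k
    have hb := hBpos k
    rw [abs_mul, abs_of_nonneg (by positivity)]
    have h1 : |H n k| ≤ 1 / (((k : ℝ) + 1 / 3) * (k + 2 / 3)) ^ 2 := (hHle n k).trans
      (mul_le_of_le_one_left (by positivity) (pow_le_one₀ (by norm_num) (by norm_num)))
    have h2 : (5 / 4 * ((n : ℝ) + 2 / 3) * (n + 11 / 15) + 3 / 2 * (n + 2 / 3) * (k : ℝ)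
        + (k : ℝ) ^ 2 / 2) / (n + 1 / 2) ≤ 4 * (n + 1) * ((k + 1) * (2 * (k : ℝ) + 1)) := by
      rw [div_le_iff₀ (by positivity)]
      exact sub_nonneg.1 (by ring_nf; positivity)
    calc _ ≤ 4 * (n + 1) * ((k + 1) * (2 * (k : ℝ) + 1)) *
          (1 / (((k : ℝ) + 1 / 3) * (k + 2 / 3)) ^ 2) := by gcongr
      _ = 4 * (n + 1) * (k + 1) * ((2 * (k : ℝ) + 1) *
          (1 / (((k : ℝ) + 1 / 3) * (k + 2 / 3)) ^ 2)) := by ring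
      _ ≤ 4 * (n + 1) * (k + 1) * (3 * B k) :=
          mul_le_mul_of_nonneg_left (hbnd k) (by positivity)
      _ = _ := by ring
  · intro n k
    have hb := hBpos k
    rw [abs_mul, abs_of_nonneg (by positivity)]
    calc _ ≤ ((n + 1) * (2 * (k : ℝ) + 1)) *
          ((1 / 2) ^ n * (1 / (((k : ℝ) + 1 / 3) * (k + 2 / 3)) ^ 2)) := by
          gcongr
          · exact sub_nonneg.1 (by ring_nf; positivity)
          · exact hHle n k
      _ = (n + 1) * (1 / 2) ^ n * ((2 * (k : ℝ) + 1) *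
          (1 / (((k : ℝ) + 1 / 3) * (k + 2 / 3)) ^ 2)) := by ring
      _ ≤ (n + 1) * (1 / 2) ^ n * (3 * B k) :=
          mul_le_mul_of_nonneg_left (hbnd k) (by positivity)
      _ = _ := by ring
  · refine (hasSum_thirds.mul_left 3).of_eq (fun k => ?_) (by ring)
    simp only [hH0]
    have h1 : (k : ℝ) + 1 / 3 ≠ 0 := by positivity
    have h2 : (k : ℝ) + 2 / 3 ≠ 0 := by positivity
    push_cast
    field_simp
    ring

/-! ### Periodic holomorphic functions on a vertical strip -/

/-- The integral over a period of a periodic holomorphic function on a vertical strip does not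
depend on the height. -/
theorem integral_eq_integral_of_periodic {f : ℂ → ℂ} {a : ℝ}
    (hf : ∀ z : ℂ, z.re ∈ Set.Icc a (a + 1) → DifferentiableAt ℂ f z)
    (hper : ∀ y : ℝ, f ((a + 1 : ℝ) + y * Complex.I) = f (a + y * Complex.I)) (Y : ℝ) :
    ∫ x : ℝ in a..(a + 1), f x = ∫ x : ℝ in a..(a + 1), f (x + Y * Complex.I) := by
  have h := Complex.integral_boundary_rect_eq_zero_of_differentiableOn f (a : ℂ)
    ((a + 1 : ℝ) + Y * Complex.I) (fun z hz => (hf z ?_).differentiableWithinAt)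
  · simp only [Complex.ofReal_re, Complex.ofReal_im, Complex.add_re, Complex.add_im,
      Complex.mul_re, Complex.mul_im, Complex.I_re, Complex.I_im, mul_zero, mul_one, sub_zero,
      zero_add, add_zero, zero_mul, Complex.ofReal_zero] at h
    rw [intervalIntegral.integral_congr (fun y _ => hper y)] at h
    rw [← sub_eq_zero]
    simpa using h
  · have := hz.1
    simp only [Complex.ofReal_re, Complex.add_re, Complex.mul_re, Complex.I_re, Complex.I_im,
      Complex.ofReal_im, mul_zero, mul_one, sub_zero, add_zero, Set.mem_preimage] at this
    rwa [Set.uIcc_of_le (by linarith)] at this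

/-- A periodic holomorphic function on a vertical strip which is `o(e^{2πM|y|})` is a
trigonometric polynomial of degree less than `M`. -/
theorem exists_eq_sum_exp_of_growth {f : ℂ → ℂ} {a : ℝ} {M : ℕ} {g : ℝ → ℝ}
    (hf : ∀ z : ℂ, z.re ∈ Set.Icc a (a + 1) → DifferentiableAt ℂ f z)
    (hper : ∀ y : ℝ, f ((a + 1 : ℝ) + y * Complex.I) = f (a + y * Complex.I))
    (hg : ∀ z : ℂ, z.re ∈ Set.Icc a (a + 1) → 1 ≤ |z.im| → ‖f z‖ ≤ g |z.im|)
    (hlim : Tendsto (fun y => g y * Real.exp (-(2 * π * M * y))) atTop (𝓝 0)) :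
    ∃ c : ℤ → ℂ, ∀ t : ℝ, t ∈ Set.Ico a (a + 1) →
      f t = ∑ k ∈ Finset.Ioo (-M : ℤ) M, c k * Complex.exp (2 * π * Complex.I * k * t) := by
  have hcoeff : ∀ k : ℤ, (M : ℤ) ≤ |k| →
      ∫ x : ℝ in a..(a + 1), Complex.exp (2 * π * Complex.I * (-k : ℤ) * x) * f x = 0 := by
    intro k hk
    -- The sign s says whether to move the contour up or down so that the k-th exponential decays
    -- like e^{−2π|k|y} at height sy.
    obtain ⟨s, hs, hsk⟩ : ∃ s : ℝ, |s| = 1 ∧ (k : ℝ) * s = -|(k : ℝ)| := by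
      rcases abs_cases (k : ℝ) with ⟨h, -⟩ | ⟨h, -⟩
      · exact ⟨-1, by simp, by rw [h]; ring⟩
      · exact ⟨1, by simp, by rw [h]; ring⟩
    have hk' : (M : ℝ) ≤ |(k : ℝ)| := by exact_mod_cast hk
    set Φ : ℂ → ℂ := fun z => Complex.exp (2 * π * Complex.I * (-k : ℤ) * z) * f z with hΦ
    have hΦd : ∀ z : ℂ, z.re ∈ Set.Icc a (a + 1) → DifferentiableAt ℂ Φ z := fun z hz =>
      DifferentiableAt.mul (by fun_prop) (hf z hz)
    have hΦp : ∀ y : ℝ, Φ ((a + 1 : ℝ) + y * Complex.I) = Φ (a + y * Complex.I) := fun y => by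
      simp only [hΦ, hper]
      congr 1
      rw [Complex.exp_eq_exp_iff_exists_int]
      exact ⟨-k, by push_cast; ring⟩
    have hconst := integral_eq_integral_of_periodic hΦd hΦp
    have hbound : ∀ y : ℝ, 1 ≤ y → ‖∫ x : ℝ in a..(a + 1), Φ x‖ ≤
        g y * Real.exp (-(2 * π * M * y)) := by
      intro y hy
      rw [hconst (s * y)]
      refine (intervalIntegral.norm_integral_le_of_norm_le_const
        (C := g y * Real.exp (-(2 * π * M * y))) fun x hx => ?_).trans (by simp)
      rw [Set.uIoc_of_le (by linarith)] at hx
      have him : |((x : ℂ) + (s * y : ℝ) * Complex.I).im| = y := by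
        simp [abs_mul, hs, abs_of_nonneg (zero_le_one.trans hy)]
      have h1 := hg ((x : ℂ) + (s * y : ℝ) * Complex.I) (by simpa using ⟨hx.1.le, hx.2⟩)
        (by rwa [him])
      rw [him] at h1
      rw [hΦ, norm_mul, Complex.norm_exp, mul_comm]
      refine mul_le_mul h1 (Real.exp_le_exp.2 ?_) (Real.exp_pos _).le ((norm_nonneg _).trans h1)
      have h2 : (2 * π * Complex.I * ((-k : ℤ) : ℂ) * ((x : ℂ) + (s * y : ℝ) * Complex.I)).re
          = 2 * π * (k * s) * y := by
        simp [Complex.mul_re, Complex.mul_im]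
        ring
      rw [h2, hsk]
      have : π * M * y ≤ π * |(k : ℝ)| * y := by
        have := Real.pi_pos
        gcongr
      linarith
    have h0 : ‖∫ x : ℝ in a..(a + 1), Φ x‖ ≤ 0 :=
      -- The Fourier integral does not depend on the height, while its bound tends to 0; hence it
      -- vanishes for |k| ≥ M.
      ge_of_tendsto hlim ((eventually_ge_atTop 1).mono hbound)
    exact norm_le_zero_iff.1 h0
  have : Fact ((0 : ℝ) < 1) := ⟨one_pos⟩
  have hcont : ContinuousOn (fun x : ℝ => f x) (Set.Icc a (a + 1)) := fun x hx =>
    ((hf x (by simpa using hx)).continuousAt.comp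
      Complex.continuous_ofReal.continuousAt).continuousWithinAt
  have hends : (fun x : ℝ => f x) a = (fun x : ℝ => f x) (a + 1) := by
    simpa using (hper 0).symm
  set Fc : C(AddCircle (1 : ℝ), ℂ) := ⟨AddCircle.liftIco 1 a fun x : ℝ => f x,
    AddCircle.liftIco_continuous hends hcont⟩ with hFc
  have hFcoeff : ∀ k : ℤ, fourierCoeff Fc k =
      ∫ x : ℝ in a..(a + 1), Complex.exp (2 * π * Complex.I * (-k : ℤ) * x) * f x := by
    intro k
    rw [hFc]
    simp only [ContinuousMap.coe_mk]
    rw [fourierCoeff_liftIco_eq, fourierCoeffOn_eq_integral]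
    simp only [add_sub_cancel_left, div_one, one_smul]
    refine intervalIntegral.integral_congr fun x _ => ?_
    simp only [smul_eq_mul]
    congr 1
    rw [fourier_coe_apply]
    congr 1
    push_cast
    ring
  have hzero : ∀ k : ℤ, k ∉ Finset.Ioo (-M : ℤ) M → fourierCoeff Fc k = 0 := fun k hk => by
    rw [hFcoeff]
    refine hcoeff k ?_
    simp only [Finset.mem_Ioo, not_and_or, not_lt] at hk
    rcases hk with h | h
    · exact le_abs.2 (Or.inr (by linarith))
    · exact le_abs.2 (Or.inl h)
  -- Only finitely many coefficients are nonzero, so the Fourier series is summable and represents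
  -- the continuous periodic function pointwise.
  refine ⟨fourierCoeff Fc, fun t ht => ?_⟩
  have h1 := has_pointwise_sum_fourier_series_of_summable
    (summable_of_ne_finset_zero (s := Finset.Ioo (-M : ℤ) M) fun k hk => hzero k hk) (t : AddCircle (1 : ℝ))
  have h2 := h1.unique (hasSum_sum_of_ne_finset_zero (s := Finset.Ioo (-M : ℤ) M)
    fun k hk => by rw [hzero k hk, zero_smul])
  have h3 : Fc (t : AddCircle (1 : ℝ)) = f t := by
    rw [hFc]
    simp only [ContinuousMap.coe_mk]
    rw [AddCircle.liftIco_coe_apply ht]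
  rw [← h3, h2]
  refine Finset.sum_congr rfl fun k _ => ?_
  rw [smul_eq_mul, fourier_coe_apply]
  congr 2
  push_cast
  ring

/-! ### Growth of the deformed series and its reduction to sin² -/

/-- By Euler's product at ir, the numbers ∏ (1 + r²/m²) increase to sinh(πr)/(πr), so each is at
most this limit; finally sinh(πr) ≤ e^{πr}. -/
theorem prod_sq_add_sq_le {r : ℝ} (hr : 0 < r) (n : ℕ) :
    ∏ j ∈ Finset.range n, (((j : ℝ) + 1) ^ 2 + r ^ 2) ≤
      (n.factorial : ℝ) ^ 2 * (Real.exp (π * r) / (π * r)) := by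
  have hlim := (Complex.tendsto_euler_sin_prod (r * Complex.I)).norm
  have hnorm : ∀ n : ℕ, ‖(π : ℂ) * (r * Complex.I) * ∏ j ∈ Finset.range n,
      ((1 : ℂ) - (r * Complex.I) ^ 2 / ((j : ℂ) + 1) ^ 2)‖ =
      π * r * ∏ j ∈ Finset.range n, (1 + r ^ 2 / ((j : ℝ) + 1) ^ 2) := fun n => by
    have h1 : ∀ j : ℕ, (1 : ℂ) - (r * Complex.I) ^ 2 / ((j : ℂ) + 1) ^ 2 =
        ((1 + r ^ 2 / ((j : ℝ) + 1) ^ 2 : ℝ) : ℂ) := fun j => by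
      rw [mul_pow, Complex.I_sq]
      push_cast
      ring
    have h2 : (0 : ℝ) ≤ ∏ j ∈ Finset.range n, (1 + r ^ 2 / ((j : ℝ) + 1) ^ 2) :=
      Finset.prod_nonneg fun j _ => by positivity
    rw [Finset.prod_congr rfl fun j _ => h1 j, ← Complex.ofReal_prod, norm_mul, norm_mul, norm_mul,
      Complex.norm_real, Complex.norm_real, Complex.norm_I, Complex.norm_real,
      Real.norm_of_nonneg Real.pi_pos.le, Real.norm_of_nonneg hr.le, Real.norm_of_nonneg h2,
      mul_one]
  simp only [hnorm] at hlim
  have hmono : Monotone fun n : ℕ => π * r * ∏ j ∈ Finset.range n, (1 + r ^ 2 / ((j : ℝ) + 1) ^ 2) := by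
    refine monotone_nat_of_le_succ fun n => ?_
    rw [Finset.prod_range_succ]
    refine mul_le_mul_of_nonneg_left (le_mul_of_one_le_right ?_ ?_) (by positivity)
    · exact Finset.prod_nonneg fun j _ => by positivity
    · exact le_add_of_nonneg_right (by positivity)
  have hsin : ‖Complex.sin (π * (r * Complex.I))‖ ≤ Real.exp (π * r) := by
    rw [← mul_assoc, Complex.sin_mul_I, norm_mul, Complex.norm_I, mul_one, ← Complex.ofReal_mul,
      ← Complex.ofReal_sinh, Complex.norm_real, Real.norm_of_nonneg
      (Real.sinh_nonneg_iff.2 (by positivity)), Real.sinh_eq]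
    have := Real.exp_pos (π * r)
    have := Real.exp_pos (-(π * r))
    linarith
  have h := (hmono.ge_of_tendsto hlim n).trans hsin
  have hfac : ∏ j ∈ Finset.range n, (((j : ℝ) + 1) ^ 2 + r ^ 2) = (n.factorial : ℝ) ^ 2 *
      ∏ j ∈ Finset.range n, (1 + r ^ 2 / ((j : ℝ) + 1) ^ 2) := by
    rw [← Finset.prod_range_add_one_eq_factorial, Nat.cast_prod, ← Finset.prod_pow,
      ← Finset.prod_mul_distrib]
    refine Finset.prod_congr rfl fun j _ => ?_
    push_cast
    field_simp
  rw [hfac]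
  refine mul_le_mul_of_nonneg_left ?_ (by positivity)
  rw [le_div_iff₀ (by positivity)]
  linarith

/-- `∏_{m < N} (m² - z²)(m² - p²z²)` weighted by `w_N (a N² - b N - c z²)`, at `N = n + 1`. -/
noncomputable def pairTerm (w : ℕ → ℝ) (a b c p : ℝ) (n : ℕ) (z : ℂ) : ℂ :=
  w n * (a * ((n : ℂ) + 1) ^ 2 - b * ((n : ℂ) + 1) - c * z ^ 2) *
    ∏ j ∈ Finset.range n, ((((j : ℂ) + 1) ^ 2 - z ^ 2) * (((j : ℂ) + 1) ^ 2 - p ^ 2 * z ^ 2))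

theorem norm_prod_pair_le {p : ℝ} {r : ℝ} {z : ℂ} (hz : ‖z‖ ≤ r)
    (n : ℕ) : ‖∏ j ∈ Finset.range n,
      ((((j : ℂ) + 1) ^ 2 - z ^ 2) * (((j : ℂ) + 1) ^ 2 - p ^ 2 * z ^ 2))‖ ≤
      (∏ j ∈ Finset.range n, (((j : ℝ) + 1) ^ 2 + r ^ 2)) *
        ∏ j ∈ Finset.range n, (((j : ℝ) + 1) ^ 2 + (p * r) ^ 2) := by
  have hz2 : ‖z‖ ^ 2 ≤ r ^ 2 := by gcongr
  have hj : ∀ j : ℕ, ‖((j : ℂ) + 1) ^ 2‖ = ((j : ℝ) + 1) ^ 2 := fun j => by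
    rw [norm_pow, ← Nat.cast_one, ← Nat.cast_add, Complex.norm_natCast]
    push_cast
    rfl
  rw [← Finset.prod_mul_distrib, norm_prod]
  refine Finset.prod_le_prod (fun j _ => norm_nonneg _) fun j _ => ?_
  rw [norm_mul]
  refine mul_le_mul ((norm_sub_le _ _).trans ?_) ((norm_sub_le _ _).trans ?_) (norm_nonneg _)
    (by positivity)
  · rw [hj, norm_pow]
    gcongr
  · rw [hj, norm_mul, norm_pow, norm_pow, Complex.norm_real, Real.norm_eq_abs, sq_abs, mul_pow]
    gcongr

/-- Both the quadratic prefactor and the extra r² are absorbed as the next factor of one of the two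
products, which thereby reach length n + 1. This leaves r^{-2} in the bound. The gain is essential
when p = 3, where the exponential alone is exactly the critical e^{4πr}. -/
theorem norm_pairTerm_le {w : ℕ → ℝ} {a b c p : ℝ} (hw : ∀ n, 0 ≤ w n) (ha : 0 ≤ a) (hb : 0 ≤ b)
    (hc : 0 ≤ c) (hp : 1 ≤ p) {r : ℝ} (hr : 0 < r) {z : ℂ} (hz : ‖z‖ ≤ r) (n : ℕ) :
    r ^ 2 * ‖pairTerm w a b c p n z‖ ≤ w n * ((n + 1).factorial : ℝ) ^ 4 *
      ((a + b + c) * (Real.exp ((1 + p) * π * r) / r ^ 2)) := by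
  have h1 := prod_sq_add_sq_le hr (n + 1)
  have h2 := prod_sq_add_sq_le (by positivity : 0 < p * r) (n + 1)
  have hN : ‖(n : ℂ) + 1‖ = n + 1 := by
    rw [← Nat.cast_one, ← Nat.cast_add, Complex.norm_natCast]; push_cast; rfl
  have h3 : ‖(a : ℂ) * ((n : ℂ) + 1) ^ 2 - b * ((n : ℂ) + 1) - c * z ^ 2‖ ≤
      (a + b + c) * (((n : ℝ) + 1) ^ 2 + r ^ 2) := by
    refine (norm_sub_le _ _).trans ((add_le_add_left (norm_sub_le _ _) _).trans ?_)
    rw [norm_mul, norm_mul, norm_mul, norm_pow, norm_pow, hN, Complex.norm_real, Complex.norm_real,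
      Complex.norm_real, Real.norm_of_nonneg ha, Real.norm_of_nonneg hb, Real.norm_of_nonneg hc]
    have hz2 : ‖z‖ ^ 2 ≤ r ^ 2 := by gcongr
    have hn : (n : ℝ) + 1 ≤ (n + 1) ^ 2 := by nlinarith [(Nat.cast_nonneg n : (0 : ℝ) ≤ n)]
    nlinarith [mul_le_mul_of_nonneg_left hz2 hc, mul_le_mul_of_nonneg_left hn hb,
      mul_nonneg (add_nonneg ha hb) (sq_nonneg r), mul_nonneg hc (sq_nonneg ((n : ℝ) + 1))]
  have hP1 : 0 ≤ ∏ j ∈ Finset.range n, (((j : ℝ) + 1) ^ 2 + r ^ 2) :=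
    Finset.prod_nonneg fun j _ => by positivity
  have hP2 : 0 ≤ ∏ j ∈ Finset.range n, (((j : ℝ) + 1) ^ 2 + (p * r) ^ 2) :=
    Finset.prod_nonneg fun j _ => by positivity
  have hr2 : r ^ 2 ≤ ((n : ℝ) + 1) ^ 2 + (p * r) ^ 2 := by
    have : r ^ 2 ≤ (p * r) ^ 2 := by
      gcongr
      exact le_mul_of_one_le_left hr.le hp
    linarith [sq_nonneg ((n : ℝ) + 1)]
  rw [pairTerm, norm_mul, norm_mul, Complex.norm_real, Real.norm_of_nonneg (hw n)]
  set P1 := ∏ j ∈ Finset.range n, (((j : ℝ) + 1) ^ 2 + r ^ 2)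
  set P2 := ∏ j ∈ Finset.range n, (((j : ℝ) + 1) ^ 2 + (p * r) ^ 2)
  have hwn := hw n
  calc r ^ 2 * (w n * _ * _) ≤ (((n : ℝ) + 1) ^ 2 + (p * r) ^ 2) *
        (w n * ((a + b + c) * (((n : ℝ) + 1) ^ 2 + r ^ 2)) * (P1 * P2)) := by
        refine mul_le_mul hr2 (mul_le_mul (mul_le_mul_of_nonneg_left h3 hwn)
          (norm_prod_pair_le hz n) (norm_nonneg _) (by positivity)) (by positivity) (by positivity)
    _ = w n * (a + b + c) * ((P1 * (((n : ℝ) + 1) ^ 2 + r ^ 2)) *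
        (P2 * (((n : ℝ) + 1) ^ 2 + (p * r) ^ 2))) := by ring
    _ ≤ w n * (a + b + c) * ((((n + 1).factorial : ℝ) ^ 2 * (Real.exp (π * r) / (π * r))) *
        (((n + 1).factorial : ℝ) ^ 2 * (Real.exp (π * (p * r)) / (π * (p * r))))) := by
        rw [Finset.prod_range_succ] at h1 h2
        gcongr
    _ = w n * ((n + 1).factorial : ℝ) ^ 4 * ((a + b + c) *
        (Real.exp ((1 + p) * π * r) / (π ^ 2 * p * r ^ 2))) := by
        rw [show (1 + p) * π * r = π * r + π * (p * r) by ring, Real.exp_add]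
        field_simp
    _ ≤ _ := by
        gcongr
        refine le_mul_of_one_le_left (by positivity) (one_le_mul_of_one_le_of_one_le ?_ hp)
        exact one_le_pow₀ (by linarith [Real.pi_gt_three])

theorem summable_pairTerm_and_differentiable {w : ℕ → ℝ} {a b c p : ℝ} (hw : ∀ n, 0 ≤ w n)
    (ha : 0 ≤ a) (hb : 0 ≤ b) (hc : 0 ≤ c) (hp : 1 ≤ p)
    (hs : Summable fun n => w n * ((n + 1).factorial : ℝ) ^ 4) :
    (∀ z, Summable fun n => pairTerm w a b c p n z) ∧
      Differentiable ℂ fun z => ∑' n, pairTerm w a b c p n z := by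
  have hle : ∀ r : ℝ, 0 < r → ∀ (n : ℕ) (z : ℂ), ‖z‖ ≤ r → ‖pairTerm w a b c p n z‖ ≤
      w n * ((n + 1).factorial : ℝ) ^ 4 *
        ((a + b + c) * (Real.exp ((1 + p) * π * r) / r ^ 2) / r ^ 2) := fun r hr n z hz => by
    rw [← mul_div_assoc, le_div_iff₀ (by positivity), mul_comm]
    exact norm_pairTerm_le hw ha hb hc hp hr hz n
  refine ⟨fun z => Summable.of_norm_bounded (hs.mul_right _) fun n =>
    hle (‖z‖ + 1) (by positivity) n z (by linarith), fun z => ?_⟩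
  have hr : 0 < ‖z‖ + 1 := by positivity
  have h := Complex.differentiableOn_tsum_of_summable_norm (hs.mul_right _)
    (F := pairTerm w a b c p) (U := Metric.ball 0 (‖z‖ + 1))
    (fun n => Differentiable.differentiableOn (by unfold pairTerm; fun_prop)) Metric.isOpen_ball
    (fun n z' hz' => hle (‖z‖ + 1) hr n z' (by simpa using (mem_ball_zero_iff.1 hz').le))
  exact h.differentiableAt (Metric.isOpen_ball.mem_nhds (by simp))

theorem norm_sq_mul_tsum_pairTerm_le {w : ℕ → ℝ} {a b c p : ℝ} (hw : ∀ n, 0 ≤ w n)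
    (ha : 0 ≤ a) (hb : 0 ≤ b) (hc : 0 ≤ c) (hp : 1 ≤ p)
    (hs : Summable fun n => w n * ((n + 1).factorial : ℝ) ^ 4) {z : ℂ} (hz : z ≠ 0) :
    ‖z ^ 2 * ∑' n, pairTerm w a b c p n z‖ ≤ (∑' n, w n * ((n + 1).factorial : ℝ) ^ 4) *
      ((a + b + c) * (Real.exp ((1 + p) * π * ‖z‖) / ‖z‖ ^ 2)) := by
  rw [← tsum_mul_left, ← tsum_mul_right]
  refine tsum_of_norm_bounded (hs.mul_right _).hasSum fun n => ?_
  rw [norm_mul, norm_pow]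
  exact norm_pairTerm_le hw ha hb hc hp (norm_pos_iff.2 hz) le_rfl n

theorem pairTerm_neg (w : ℕ → ℝ) (a b c p : ℝ) (n : ℕ) (z : ℂ) :
    pairTerm w a b c p n (-z) = pairTerm w a b c p n z := by
  simp [pairTerm]

theorem norm_le_abs_im_add_one {z : ℂ} (h : z.re ∈ Set.Icc (-(1 / 4) : ℝ) (-(1 / 4) + 1)) :
    ‖z‖ ≤ |z.im| + 1 := by
  refine (Complex.norm_le_abs_re_add_abs_im z).trans ?_
  have : |z.re| ≤ 1 := abs_le.2 ⟨by linarith [h.1], by linarith [h.2]⟩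
  linarith

/-- If `z² ∑ pairTerm` is periodic then it is a multiple of `sin² πz`. -/
theorem exists_eq_mul_sin_sq {w : ℕ → ℝ} {a b c p : ℝ} (hw : ∀ n, 0 ≤ w n)
    (ha : 0 ≤ a) (hb : 0 ≤ b) (hc : 0 ≤ c) (hp : 1 ≤ p) (hp3 : p ≤ 3)
    (hs : Summable fun n => w n * ((n + 1).factorial : ℝ) ^ 4)
    (hper : ∀ z : ℂ, z.re = -(1 / 4) → (z + 1) ^ 2 * ∑' n, pairTerm w a b c p n (z + 1) =
      z ^ 2 * ∑' n, pairTerm w a b c p n z) :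
    ∃ d : ℂ, ∀ t : ℝ, t ∈ Set.Ico (-(1 / 4) : ℝ) (-(1 / 4) + 1) →
      (t : ℂ) ^ 2 * ∑' n, pairTerm w a b c p n t = d * Complex.sin (π * t) ^ 2 := by
  have hdiff := (summable_pairTerm_and_differentiable hw ha hb hc hp hs).2
  set f : ℂ → ℂ := fun z => z ^ 2 * ∑' n, pairTerm w a b c p n z with hf
  have hfd : Differentiable ℂ f := (differentiable_id.pow 2).mul hdiff
  set C := (∑' n, w n * ((n + 1).factorial : ℝ) ^ 4) * (a + b + c) with hC
  have hC0 : 0 ≤ C := mul_nonneg (tsum_nonneg fun n => mul_nonneg (hw n) (by positivity))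
    (by positivity)
  have hfper : ∀ y : ℝ, f ((-(1 / 4) + 1 : ℝ) + y * Complex.I) =
      f ((-(1 / 4) : ℝ) + y * Complex.I) := fun y => by
    have h := hper (((-(1 / 4) : ℝ) : ℂ) + y * Complex.I) (by simp)
    simp only [hf]
    rw [← h, show ((-(1 / 4) + 1 : ℝ) : ℂ) + y * Complex.I =
      ((-(1 / 4) : ℝ) : ℂ) + y * Complex.I + 1 by push_cast; ring]
  have hgrow : ∀ z : ℂ, z.re ∈ Set.Icc (-(1 / 4) : ℝ) (-(1 / 4) + 1) → 1 ≤ |z.im| →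
      ‖f z‖ ≤ C * (Real.exp (4 * π * (|z.im| + 1)) / |z.im| ^ 2) := fun z hz hy => by
    have hle := norm_le_abs_im_add_one hz
    have hge : |z.im| ≤ ‖z‖ := Complex.abs_im_le_norm z
    have hz0 : z ≠ 0 := norm_pos_iff.1 (lt_of_lt_of_le one_pos (hy.trans hge))
    refine (norm_sq_mul_tsum_pairTerm_le hw ha hb hc hp hs hz0).trans ?_
    rw [← mul_assoc, ← hC]
    have := Real.pi_pos
    have h4 : (1 + p) * π * ‖z‖ ≤ 4 * π * (|z.im| + 1) := by
      gcongr
      linarith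
    have hy0 : 0 < |z.im| := by linarith
    gcongr
  -- Since 1 + p ≤ 4, the growth is at most a constant times e^{4πy}/y²; the factor y^{-2} excludes
  -- the frequencies ±2, so M = 2 is allowed.
  have hlim : Tendsto (fun y : ℝ => C * (Real.exp (4 * π * (y + 1)) / y ^ 2) *
      Real.exp (-(2 * π * (2 : ℕ) * y))) atTop (𝓝 0) := by
    have h1 : Tendsto (fun y : ℝ => C * Real.exp (4 * π) * (y ^ 2)⁻¹) atTop (𝓝 0) := by
      simpa using (tendsto_inv_atTop_zero.comp
        (tendsto_pow_atTop (two_ne_zero))).const_mul (C * Real.exp (4 * π))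
    refine h1.congr fun y => ?_
    rw [show 4 * π * (y + 1) = 4 * π + 4 * π * y by ring, Real.exp_add,
      show -(2 * π * ((2 : ℕ) : ℝ) * y) = -(4 * π * y) by push_cast; ring, Real.exp_neg]
    have := (Real.exp_pos (4 * π * y)).ne'
    field_simp
  obtain ⟨k, hk⟩ := exists_eq_sum_exp_of_growth (M := 2)
    (g := fun y => C * (Real.exp (4 * π * (y + 1)) / y ^ 2)) (fun z _ => hfd z) hfper hgrow hlim
  have hIoo : Finset.Ioo (-(2 : ℕ) : ℤ) (2 : ℕ) = {-1, 0, 1} := by decide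
  rw [hIoo] at hk
  have hk' : ∀ t : ℝ, t ∈ Set.Ico (-(1 / 4) : ℝ) (-(1 / 4) + 1) → f t =
      k 0 + (k 1 + k (-1)) * Complex.cos (2 * π * t) +
        (k 1 - k (-1)) * Complex.sin (2 * π * t) * Complex.I := fun t ht => by
    rw [hk t ht]
    have e1 : Complex.exp (2 * π * Complex.I * (1 : ℤ) * t) =
        Complex.cos (2 * π * t) + Complex.sin (2 * π * t) * Complex.I := by
      rw [← Complex.exp_mul_I]
      congr 1
      push_cast
      ring
    have e2 : Complex.exp (2 * π * Complex.I * (-1 : ℤ) * t) =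
        Complex.cos (2 * π * t) - Complex.sin (2 * π * t) * Complex.I := by
      rw [show Complex.cos (2 * π * t) - Complex.sin (2 * π * t) * Complex.I =
        Complex.cos (-(2 * π * t)) + Complex.sin (-(2 * π * t)) * Complex.I by
          rw [Complex.cos_neg, Complex.sin_neg]; ring, ← Complex.exp_mul_I]
      congr 1
      push_cast
      ring
    rw [Finset.sum_insert (by decide), Finset.sum_insert (by decide), Finset.sum_singleton,
      e1, e2]
    simp only [Int.cast_zero, mul_zero, zero_mul, Complex.exp_zero]
    ring
  have hfeven : ∀ z, f (-z) = f z := fun z => by simp only [hf, pairTerm_neg, neg_sq]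
  -- Comparing f at ±1/8, where sin(2πt) is nonzero, turns evenness into the vanishing of the sine
  -- coefficient.
  have h8 := hk' (1 / 8) ⟨by norm_num, by norm_num⟩
  have h8' := hk' (-(1 / 8)) ⟨by norm_num, by norm_num⟩
  rw [Complex.ofReal_neg, hfeven, h8, mul_neg, Complex.cos_neg, Complex.sin_neg] at h8'
  have hsin : Complex.sin (2 * π * ((1 / 8 : ℝ) : ℂ)) ≠ 0 := by
    rw [show (2 : ℂ) * π * ((1 / 8 : ℝ) : ℂ) = ((2 * π * (1 / 8) : ℝ) : ℂ) by push_cast; ring,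
      ← Complex.ofReal_sin, Complex.ofReal_ne_zero]
    have := Real.pi_pos
    exact (Real.sin_pos_of_pos_of_lt_pi (by positivity) (by linarith)).ne'
  have hk1 : k 1 - k (-1) = 0 := by
    have h9 : (k 1 - k (-1)) * (Complex.sin (2 * π * ((1 / 8 : ℝ) : ℂ)) * Complex.I) = 0 := by
      linear_combination h8' / 2
    exact (mul_eq_zero.1 h9).resolve_right (mul_ne_zero hsin Complex.I_ne_zero)
  -- From f(0) = 0 the cosine coefficient is −k 0, so f(t) = k 0 · (1 − cos 2πt) = 2 · k 0 · sin²
  -- πt.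
  have h0 := hk' 0 ⟨by norm_num, by norm_num⟩
  simp only [hf, Complex.ofReal_zero, mul_zero, Complex.cos_zero, Complex.sin_zero] at h0
  refine ⟨2 * k 0, fun t ht => ?_⟩
  have ht := hk' t ht
  rw [mul_assoc 2, Complex.cos_two_mul, Complex.cos_sq', hk1] at ht
  simp only [hf] at ht
  rw [ht]
  linear_combination (2 * Complex.sin (π * t) ^ 2 - 1) * h0

/-- The value at `0` of a periodic `∑ pairTerm` is determined by any other value. -/
theorem tsum_pairTerm_zero {w : ℕ → ℝ} {a b c p : ℝ} (hw : ∀ n, 0 ≤ w n)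
    (ha : 0 ≤ a) (hb : 0 ≤ b) (hc : 0 ≤ c) (hp : 1 ≤ p) (hp3 : p ≤ 3)
    (hs : Summable fun n => w n * ((n + 1).factorial : ℝ) ^ 4)
    (hper : ∀ z : ℂ, z.re = -(1 / 4) → (z + 1) ^ 2 * ∑' n, pairTerm w a b c p n (z + 1) =
      z ^ 2 * ∑' n, pairTerm w a b c p n z) {t : ℝ}
    (ht : t ∈ Set.Ico (-(1 / 4) : ℝ) (-(1 / 4) + 1)) :
    (∑' n, pairTerm w a b c p n 0) * Complex.sin (π * t) ^ 2 =
      π ^ 2 * ((t : ℂ) ^ 2 * ∑' n, pairTerm w a b c p n t) := by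
  obtain ⟨d, hd⟩ := exists_eq_mul_sin_sq hw ha hb hc hp hp3 hs hper
  have hdiff := (summable_pairTerm_and_differentiable hw ha hb hc hp hs).2
  have h1 : Tendsto (fun x : ℝ => ∑' n, pairTerm w a b c p n x) (𝓝[≠] 0)
      (𝓝 (∑' n, pairTerm w a b c p n 0)) := by
    have h := (hdiff.continuous.comp Complex.continuous_ofReal).tendsto 0
    simp only [Function.comp, Complex.ofReal_zero] at h
    exact h.mono_left nhdsWithin_le_nhds
  have h2 : Tendsto (fun x : ℝ => d * ((Real.sin (π * x) / x : ℝ) : ℂ) ^ 2) (𝓝[≠] 0)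
      (𝓝 (d * (π : ℂ) ^ 2)) := by
    have h3 : HasDerivAt (fun x : ℝ => Real.sin (π * x)) π 0 := by
      have h4 := ((hasDerivAt_id (0 : ℝ)).const_mul π).sin
      simpa using h4
    have h5 := h3.tendsto_slope_zero
    refine Tendsto.const_mul d (((Complex.continuous_ofReal.tendsto π).comp ?_).pow 2)
    refine h5.congr fun x => ?_
    simp [div_eq_inv_mul]
  have h6 : (fun x : ℝ => ∑' n, pairTerm w a b c p n x) =ᶠ[𝓝[≠] 0]
      fun x : ℝ => d * ((Real.sin (π * x) / x : ℝ) : ℂ) ^ 2 := by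
    have h7 : ∀ᶠ x : ℝ in 𝓝[≠] 0, x ∈ Set.Ico (-(1 / 4) : ℝ) (-(1 / 4) + 1) :=
      mem_nhdsWithin_of_mem_nhds (Ico_mem_nhds (by norm_num) (by norm_num))
    filter_upwards [h7, self_mem_nhdsWithin] with x hx hx0
    have hx0' : (x : ℂ) ≠ 0 := Complex.ofReal_ne_zero.2 hx0
    have := hd x hx
    push_cast
    rw [div_pow, ← mul_div_assoc, ← this]
    field_simp
  rw [tendsto_nhds_unique (h1.congr' h6) h2, hd t ht]
  ring

/-! ### The shift z ↦ z + 1, and the series at 64 and 81 -/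

/-- `∏_{m ≤ n} (m² - x²)`. -/
noncomputable def sqProd (x : ℂ) (n : ℕ) : ℂ := ∏ j ∈ Finset.range n, (((j : ℂ) + 1) ^ 2 - x ^ 2)

theorem sqProd_zero (x : ℂ) : sqProd x 0 = 1 := by simp [sqProd]

theorem sqProd_succ (x : ℂ) (n : ℕ) : sqProd x (n + 1) = sqProd x n * (((n : ℂ) + 1) ^ 2 - x ^ 2) := by
  simp [sqProd, Finset.prod_range_succ]

/-- Write m² − x² = (m − x)(m + x): the shift moves two strings of consecutive linear factors by one
step, so only end factors change. -/
theorem sqProd_add_one {x : ℂ} (hx : ∀ m : ℕ, (m : ℂ) - x ≠ 0) (hx1 : x + 1 ≠ 0) (n : ℕ) :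
    sqProd (x + 1) n = -x * (x + n + 1) / ((x + 1) * (n - x)) * sqProd x n := by
  induction n with
  | zero =>
    have h := hx 0
    simp only [sqProd_zero, Nat.cast_zero, add_zero, zero_sub] at h ⊢
    have hx0 : x ≠ 0 := neg_ne_zero.1 h
    field_simp
  | succ n ih =>
    have h1 := hx n
    have h2 := hx (n + 1)
    push_cast at h2
    rw [sqProd_succ, sqProd_succ, ih]
    push_cast
    field_simp
    ring

/-- On Re z = −1/4 the numbers z, 2z, 3z and their integer shifts have real part in (1/4)ℤ ∖ ℤ. This
is why the period strip begins at −1/4: no certificate denominator vanishes there. -/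
theorem natCast_sub_ne_zero_of_re {x : ℂ} {k : ℤ} (hk : 4 * x.re = k) (hk4 : ¬ (4 : ℤ) ∣ k) (m : ℕ) :
    (m : ℂ) - x ≠ 0 := fun h => hk4 ⟨m, by
  have h1 := congrArg Complex.re h
  simp only [Complex.sub_re, Complex.natCast_re, Complex.zero_re] at h1
  have h2 : (k : ℝ) = 4 * m := by linarith
  exact_mod_cast h2⟩

theorem pairTerm_eq_sqProd (w : ℕ → ℝ) (a b c p : ℝ) (n : ℕ) (z : ℂ) : pairTerm w a b c p n z =
    w n * (a * ((n : ℂ) + 1) ^ 2 - b * ((n : ℂ) + 1) - c * z ^ 2) *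
      (sqProd z n * sqProd (p * z) n) := by
  rw [pairTerm, sqProd, sqProd, ← Finset.prod_mul_distrib]
  simp only [mul_pow]

/-- Two series whose termwise difference telescopes to zero have the same sum. -/
theorem tsum_eq_tsum_of_telescope {u v F : ℕ → ℂ} (hu : Summable u) (hv : Summable v)
    (h0 : F 0 = 0) (hF : ∀ n, u n - v n = F (n + 1) - F n) (hlim : Tendsto F atTop (𝓝 0)) :
    ∑' n, u n = ∑' n, v n := by
  rw [← sub_eq_zero, ← hu.tsum_sub hv]
  have h := (hu.sub hv).hasSum.tendsto_sum_nat
  simp only [hF, Finset.sum_range_sub, h0, sub_zero] at h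
  simp only [hF]
  exact tendsto_nhds_unique h hlim

theorem norm_sqProd_pair_le (p : ℝ) (hp : 1 ≤ p) (z : ℂ) :
    ∃ C : ℝ, 0 ≤ C ∧ ∀ n, ‖sqProd z n * sqProd (p * z) n‖ ≤ C * (n.factorial : ℝ) ^ 4 := by
  have hr : 0 < ‖z‖ + 1 := by positivity
  refine ⟨Real.exp (π * (‖z‖ + 1)) / (π * (‖z‖ + 1)) *
    (Real.exp (π * (p * (‖z‖ + 1))) / (π * (p * (‖z‖ + 1)))), by positivity, fun n => ?_⟩
  have h := norm_prod_pair_le (p := p) (z := z) (r := ‖z‖ + 1) (by linarith) n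
  rw [sqProd, sqProd, ← Finset.prod_mul_distrib]
  simp only [mul_pow (p : ℂ)]
  refine h.trans ((mul_le_mul (prod_sq_add_sq_le hr n) (prod_sq_add_sq_le (by positivity) n)
    (Finset.prod_nonneg fun j _ => by positivity) (by positivity)).trans_eq (by ring))

theorem one_half_le_norm_natCast_sub {x : ℂ} {n : ℕ} (h : x.re + 1 / 2 ≤ n) : 1 / 2 ≤ ‖(n : ℂ) - x‖ := by
  refine le_trans ?_ (Complex.re_le_norm _)
  simp only [Complex.sub_re, Complex.natCast_re]
  linarith

theorem tendsto_telescoper {F : ℕ → ℂ} {x₁ x₂ x₃ : ℂ} {s : ℕ → ℝ} {C : ℝ} (hC : 0 ≤ C)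
    (hF : ∀ n, ‖F n‖ ≤ C * s n / (‖(n : ℂ) - x₁‖ * ‖(n : ℂ) - x₂‖ * ‖(n : ℂ) - x₃‖))
    (hs0 : ∀ n, 0 ≤ s n) (hs : Tendsto s atTop (𝓝 0)) : Tendsto F atTop (𝓝 0) := by
  refine squeeze_zero_norm' ?_ (by simpa using hs.const_mul (C * 8))
  have h1 : ∀ x : ℂ, ∀ᶠ n : ℕ in atTop, 1 / 2 ≤ ‖(n : ℂ) - x‖ := fun x =>
    (tendsto_natCast_atTop_atTop.eventually_ge_atTop (x.re + 1 / 2)).mono fun n hn =>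
      one_half_le_norm_natCast_sub hn
  filter_upwards [h1 x₁, h1 x₂, h1 x₃] with n hn1 hn2 hn3
  refine (hF n).trans ?_
  have hsn := hs0 n
  rw [div_le_iff₀ (by positivity)]
  have h8 : (1 : ℝ) / 2 * (1 / 2) * (1 / 2) ≤ ‖(n : ℂ) - x₁‖ * ‖(n : ℂ) - x₂‖ * ‖(n : ℂ) - x₃‖ := by
    gcongr
  nlinarith [mul_le_mul_of_nonneg_left h8 (mul_nonneg hC hsn)]

theorem pairTerm_zero (w : ℕ → ℝ) (a b c p : ℝ) (n : ℕ) : pairTerm w a b c p n 0 =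
    ((w n * (n.factorial : ℝ) ^ 4 * (a * ((n : ℝ) + 1) ^ 2 - b * ((n : ℝ) + 1)) : ℝ) : ℂ) := by
  have h : ∏ j ∈ Finset.range n, ((j : ℂ) + 1) = n.factorial := by
    rw [← Finset.prod_range_add_one_eq_factorial]
    push_cast
    rfl
  rw [pairTerm]
  simp only [zero_pow two_ne_zero, mul_zero, sub_zero, Finset.prod_mul_distrib, Finset.prod_pow, h]
  push_cast
  ring

theorem pow_mul_factorial_pow_eq {W u : ℝ} {n : ℕ}
    (h : W * ((n + 1).factorial : ℝ) ^ 4 = ((n : ℝ) + 1) ^ 3 * u) :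
    W * (n.factorial : ℝ) ^ 4 * ((n : ℝ) + 1) = u := by
  rw [Nat.factorial_succ] at h
  have hn : ((n : ℝ) + 1) ^ 3 ≠ 0 := by positivity
  apply mul_left_cancel₀ hn
  rw [← h]
  push_cast
  ring

/-- The deformation has p = 2 and reduces at z = 0 to twice the series. At z = 1/2 the factor 1 −
4z² kills all terms but the first, so f(1/2) = (1/4) · (32/3) · (11 − 3 − 2) = 16 and the deformed
sum at 0 is 16π². -/
theorem hasSum_tripleTerm_sixtyFour :
    HasSum (fun n : ℕ => (11 * ((n : ℝ) + 1) - 3) * tripleTerm 64 n) (8 * π ^ 2) := by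
  set W : ℕ → ℝ := fun n => 64 ^ n * n.factorial / ((3 * n).factorial * (2 * n).factorial) with hW
  set w : ℕ → ℝ := fun n => 2 * W (n + 1) with hwdef
  have hw : ∀ n, 0 ≤ w n := fun n => by simp only [hwdef, hW]; positivity
  have hWsucc : ∀ n, W (n + 1) = W n * (64 /
      ((3 * n + 1) * (3 * n + 2) * 6 * (n + 1) * (2 * n + 1))) := fun n => by
    simp only [hW]
    rw [show 3 * (n + 1) = 3 * n + 1 + 1 + 1 by ring, show 2 * (n + 1) = 2 * n + 1 + 1 by ring]
    simp only [Nat.factorial_succ]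
    have := factorial_ne_zero_real (3 * n)
    have := factorial_ne_zero_real (2 * n)
    push_cast
    field_simp
    ring
  have hterm : ∀ n, W (n + 1) * ((n + 1).factorial : ℝ) ^ 4 = (n + 1) ^ 3 * tripleTerm 64 n :=
    fun n => by
    rw [tripleTerm_eq]
    simp only [hW]
    rw [show 3 * (n + 1) = 3 * n + 3 by ring, show 2 * (n + 1) = 2 * n + 2 by ring,
      Nat.factorial_succ n]
    push_cast
    ring
  have hs : Summable fun n => w n * ((n + 1).factorial : ℝ) ^ 4 := by
    refine (summable_polynomial_mul_of_ratio (by norm_num) (by norm_num) (tripleTerm_ratio 64)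
      (2 * (Polynomial.X + 1) ^ 3)).congr fun n => ?_
    simp only [hwdef]
    rw [mul_assoc, hterm]
    simp
    ring
  have hlim0 : Tendsto (fun n : ℕ => (n : ℝ) * (W n * (n.factorial : ℝ) ^ 4)) atTop (𝓝 0) := by
    rw [← tendsto_add_atTop_iff_nat 1]
    refine (summable_polynomial_mul_of_ratio (by norm_num) (by norm_num) (tripleTerm_ratio 64)
      ((Polynomial.X + 1) ^ 4)).tendsto_atTop_zero.congr fun n => ?_
    rw [hterm]
    simp
    ring
  have hsum := (summable_pairTerm_and_differentiable hw (by norm_num : (0 : ℝ) ≤ 11)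
    (by norm_num : (0 : ℝ) ≤ 3) (by norm_num : (0 : ℝ) ≤ 8) (by norm_num : (1 : ℝ) ≤ 2) hs).1
  have hper : ∀ z : ℂ, z.re = -(1 / 4) → (z + 1) ^ 2 * ∑' n, pairTerm w 11 3 8 2 n (z + 1) =
      z ^ 2 * ∑' n, pairTerm w 11 3 8 2 n z := by
    intro z hz
    rw [← tsum_mul_left, ← tsum_mul_left]
    have hne : ∀ {x : ℂ} (k : ℤ), 4 * x.re = k → ¬ (4 : ℤ) ∣ k → ∀ m : ℕ, (m : ℂ) - x ≠ 0 :=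
      fun k hk h4 m => natCast_sub_ne_zero_of_re hk h4 m
    have n1 := hne (x := z) (-1) (by rw [hz]; norm_num) (by norm_num)
    have n2 := hne (x := 2 * z) (-2) (by simp [hz]; norm_num) (by norm_num)
    have n3 := hne (x := 2 * z + 1) 2 (by simp [hz]; norm_num) (by norm_num)
    have m1 : z + 1 ≠ 0 := by
      simpa [add_comm] using hne (x := -z) 1 (by simp [hz]) (by norm_num) 1
    have m2 : 2 * z + 1 ≠ 0 := by
      have h := n3 0
      rwa [Nat.cast_zero, zero_sub, neg_ne_zero] at h
    have m3 : 2 * z + 1 + 1 ≠ 0 := by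
      rw [show 2 * z + 1 + 1 = 2 * (z + 1) by ring]
      exact mul_ne_zero two_ne_zero m1
    -- The telescoping certificate for f(z+1) − f(z). Its factor n makes F 0 vanish, so no boundary
    -- term remains.
    set F : ℕ → ℂ := fun n => 64 * n * z ^ 2 * (W n * (sqProd z n * sqProd ((2 : ℝ) * z) n)) /
      (((n : ℂ) - z) * (n - 2 * z) * (n - (2 * z + 1))) with hF
    refine tsum_eq_tsum_of_telescope (F := F) ((hsum _).mul_left _) ((hsum _).mul_left _)
      (by simp [hF]) (fun n => ?_) ?_
    · have hW1 : ((W (n + 1) : ℝ) : ℂ) = W n * (64 /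
          ((3 * n + 1) * (3 * n + 2) * 6 * (n + 1) * (2 * n + 1))) := by
        rw [hWsucc]; push_cast; rfl
      simp only [hF, pairTerm_eq_sqProd, hwdef, sqProd_succ]
      push_cast
      rw [hW1, sqProd_add_one n1 m1, show 2 * (z + 1) = 2 * z + 1 + 1 by ring,
        sqProd_add_one n3 m3, sqProd_add_one n2 m2]
      have k1 := n1 n
      have k2 := n2 n
      have k3 := n3 n
      have l1 := n1 (n + 1)
      have l2 := n2 (n + 1)
      have l3 : (n : ℂ) + 1 - (2 * z + 1) ≠ 0 := by
        rw [show (n : ℂ) + 1 - (2 * z + 1) = n - 2 * z by ring]; exact k2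
      push_cast at l1 l2
      have c1 : (3 * (n : ℂ) + 1) ≠ 0 := by exact_mod_cast Nat.succ_ne_zero (3 * n)
      have c2 : (3 * (n : ℂ) + 2) ≠ 0 := by exact_mod_cast Nat.succ_ne_zero (3 * n + 1)
      have c3 : (n : ℂ) + 1 ≠ 0 := by exact_mod_cast Nat.succ_ne_zero n
      have c4 : (2 * (n : ℂ) + 1) ≠ 0 := by exact_mod_cast Nat.succ_ne_zero (2 * n)
      generalize ((W n : ℝ) : ℂ) = A
      generalize sqProd z n = B
      generalize sqProd (2 * z) n = D
      rw [show (n : ℂ) + 1 - (2 * z + 1) = n - 2 * z by ring]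
      rw [mul_comm 2 z] at *
      field_simp
      ring
    · obtain ⟨C, hC, hCle⟩ := norm_sqProd_pair_le 2 (by norm_num) z
      refine tendsto_telescoper (x₁ := z) (x₂ := 2 * z) (x₃ := 2 * z + 1)
        (C := 64 * ‖z‖ ^ 2 * C) (by positivity) (fun n => ?_) (fun n => ?_) hlim0
      · have hWn : 0 ≤ W n := by simp only [hW]; positivity
        simp only [hF, norm_div, norm_mul, norm_pow, Complex.norm_natCast, Complex.norm_real,
          Real.norm_of_nonneg hWn, Complex.norm_ofNat]
        gcongr ?_ / _
        have := hCle n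
        rw [norm_mul] at this
        calc _ = 64 * n * ‖z‖ ^ 2 * W n * (‖sqProd z n‖ * ‖sqProd ((2 : ℝ) * z) n‖) := by ring
          _ ≤ 64 * n * ‖z‖ ^ 2 * W n * (C * (n.factorial : ℝ) ^ 4) := by gcongr
          _ = _ := by ring
      · simp only [hW]; positivity
  have hval := tsum_pairTerm_zero hw (by norm_num) (by norm_num) (by norm_num) (by norm_num)
    (by norm_num) hs hper (t := 1 / 2) ⟨by norm_num, by norm_num⟩
  rw [show ∑' n, pairTerm w 11 3 8 2 n ((1 / 2 : ℝ) : ℂ) = pairTerm w 11 3 8 2 0 ((1 / 2 : ℝ) : ℂ) from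
    tsum_eq_single 0 fun n hn => by
      obtain ⟨m, rfl⟩ := Nat.exists_eq_succ_of_ne_zero hn
      rw [pairTerm, Finset.prod_eq_zero (i := 0) (by simp) (by push_cast; norm_num), mul_zero]]
    at hval
  have hw0 : w 0 = 32 / 3 := by
    simp only [hwdef, hW]
    norm_num [Nat.factorial]
  have h1 : Complex.sin (π * ((1 / 2 : ℝ) : ℂ)) = 1 := by
    rw [show (π : ℂ) * ((1 / 2 : ℝ) : ℂ) = π / 2 by push_cast; ring, Complex.sin_pi_div_two]
  rw [h1, pairTerm, hw0] at hval
  have h2 := (hsum 0).hasSum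
  have h3 : ∀ n, pairTerm w 11 3 8 2 n 0 =
      ((2 * ((11 * ((n : ℝ) + 1) - 3) * tripleTerm 64 n) : ℝ) : ℂ) := fun n => by
    rw [pairTerm_zero, ← pow_mul_factorial_pow_eq (hterm n)]
    simp only [hwdef]
    push_cast
    ring
  rw [show ∑' n, pairTerm w 11 3 8 2 n 0 = ((16 * π ^ 2 : ℝ) : ℂ) by
    push_cast at hval ⊢
    simp only [Finset.prod_range_zero] at hval
    linear_combination hval, funext h3, Complex.hasSum_ofReal] at h2
  exact (h2.mul_left (1 / 2)).of_eq (fun n => by ring) (by ring)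

/-- Here p = 3 and the shift moves 3z by three steps. At z = 1/3 only the first term survives:
f(1/3) = (1/9) · (27/8) · 24 = 9, while sin²(π/3) = 3/4, which gives 12π² at z = 0. -/
theorem hasSum_quadTerm_eightyOne :
    HasSum (fun n : ℕ => (35 * ((n : ℝ) + 1) - 8) * quadTerm 81 n) (12 * π ^ 2) := by
  set W : ℕ → ℝ := fun n => 81 ^ n / (4 * n).factorial with hW
  set w : ℕ → ℝ := fun n => W (n + 1) with hwdef
  have hw : ∀ n, 0 ≤ w n := fun n => by simp only [hwdef, hW]; positivity
  have hWsucc : ∀ n, W (n + 1) = W n * (81 /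
      ((4 * n + 1) * (4 * n + 2) * (4 * n + 3) * (4 * (n + 1)))) := fun n => by
    simp only [hW]
    rw [show 4 * (n + 1) = 4 * n + 1 + 1 + 1 + 1 by ring]
    simp only [Nat.factorial_succ]
    have := factorial_ne_zero_real (4 * n)
    push_cast
    field_simp
    ring
  have hterm : ∀ n, W (n + 1) * ((n + 1).factorial : ℝ) ^ 4 = (n + 1) ^ 3 * quadTerm 81 n :=
    fun n => by
    rw [quadTerm_eq]
    simp only [hW]
    rw [show 4 * (n + 1) = 4 * n + 4 by ring, Nat.factorial_succ n]
    push_cast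
    ring
  have hs : Summable fun n => w n * ((n + 1).factorial : ℝ) ^ 4 := by
    refine (summable_polynomial_mul_of_ratio (by norm_num) (by norm_num) (quadTerm_ratio 81)
      ((Polynomial.X + 1) ^ 3)).congr fun n => ?_
    simp only [hwdef]
    rw [hterm]
    simp
  have hlim0 : Tendsto (fun n : ℕ => (n : ℝ) * (W n * (n.factorial : ℝ) ^ 4)) atTop (𝓝 0) := by
    rw [← tendsto_add_atTop_iff_nat 1]
    refine (summable_polynomial_mul_of_ratio (by norm_num) (by norm_num) (quadTerm_ratio 81)
      ((Polynomial.X + 1) ^ 4)).tendsto_atTop_zero.congr fun n => ?_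
    rw [hterm]
    simp
    ring
  have hsum := (summable_pairTerm_and_differentiable hw (by norm_num : (0 : ℝ) ≤ 35)
    (by norm_num : (0 : ℝ) ≤ 8) (by norm_num : (0 : ℝ) ≤ 27) (by norm_num : (1 : ℝ) ≤ 3) hs).1
  have hper : ∀ z : ℂ, z.re = -(1 / 4) → (z + 1) ^ 2 * ∑' n, pairTerm w 35 8 27 3 n (z + 1) =
      z ^ 2 * ∑' n, pairTerm w 35 8 27 3 n z := by
    intro z hz
    rw [← tsum_mul_left, ← tsum_mul_left]
    have hne : ∀ {x : ℂ} (k : ℤ), 4 * x.re = k → ¬ (4 : ℤ) ∣ k → ∀ m : ℕ, (m : ℂ) - x ≠ 0 :=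
      fun k hk h4 m => natCast_sub_ne_zero_of_re hk h4 m
    have n1 := hne (x := z) (-1) (by rw [hz]; norm_num) (by norm_num)
    have n2 := hne (x := 3 * z) (-3) (by simp [hz]; norm_num) (by norm_num)
    have n3 := hne (x := 3 * z + 1) 1 (by simp [hz]; norm_num) (by norm_num)
    have n4 := hne (x := 3 * z + 1 + 1) 5 (by simp [hz]; norm_num) (by norm_num)
    have m1 : z + 1 ≠ 0 := by
      simpa [add_comm] using hne (x := -z) 1 (by simp [hz]) (by norm_num) 1
    have m2 : 3 * z + 1 ≠ 0 := by
      have h := n3 0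
      rwa [Nat.cast_zero, zero_sub, neg_ne_zero] at h
    have m3 : 3 * z + 1 + 1 ≠ 0 := by
      have h := n4 0
      rwa [Nat.cast_zero, zero_sub, neg_ne_zero] at h
    have m4 : 3 * z + 1 + 1 + 1 ≠ 0 := by
      rw [show 3 * z + 1 + 1 + 1 = 3 * (z + 1) by ring]
      exact mul_ne_zero three_ne_zero m1
    set F : ℕ → ℂ := fun n => -162 * n * (2 * z + 1) * z ^ 2 *
      (W n * (sqProd z n * sqProd ((3 : ℝ) * z) n)) /
      (((n : ℂ) - z) * (n - 3 * z) * (n - (3 * z + 1)) * (n - (3 * z + 1 + 1))) with hF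
    refine tsum_eq_tsum_of_telescope (F := F) ((hsum _).mul_left _) ((hsum _).mul_left _)
      (by simp [hF]) (fun n => ?_) ?_
    · have hW1 : ((W (n + 1) : ℝ) : ℂ) = W n * (81 /
          ((4 * n + 1) * (4 * n + 2) * (4 * n + 3) * (4 * (n + 1)))) := by
        rw [hWsucc]; push_cast; rfl
      simp only [hF, pairTerm_eq_sqProd, hwdef, sqProd_succ]
      push_cast
      rw [hW1, sqProd_add_one n1 m1, show 3 * (z + 1) = 3 * z + 1 + 1 + 1 by ring,
        sqProd_add_one n4 m4, sqProd_add_one n3 m3, sqProd_add_one n2 m2]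
      have k1 := n1 n
      have k2 := n2 n
      have k3 := n3 n
      have k4 := n4 n
      have l1 := n1 (n + 1)
      have l2 := n2 (n + 1)
      push_cast at l1 l2
      have c1 : (4 * (n : ℂ) + 1) ≠ 0 := by exact_mod_cast Nat.succ_ne_zero (4 * n)
      have c2 : (4 * (n : ℂ) + 2) ≠ 0 := by exact_mod_cast Nat.succ_ne_zero (4 * n + 1)
      have c3 : (4 * (n : ℂ) + 3) ≠ 0 := by exact_mod_cast Nat.succ_ne_zero (4 * n + 2)
      have c4 : (n : ℂ) + 1 ≠ 0 := by exact_mod_cast Nat.succ_ne_zero n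
      generalize ((W n : ℝ) : ℂ) = A
      generalize sqProd z n = B
      generalize sqProd (3 * z) n = D
      rw [show (n : ℂ) + 1 - (3 * z + 1) = n - 3 * z by ring,
        show (n : ℂ) + 1 - (3 * z + 1 + 1) = n - (3 * z + 1) by ring]
      rw [mul_comm 3 z] at *
      field_simp
      ring
    · obtain ⟨C, hC, hCle⟩ := norm_sqProd_pair_le 3 (by norm_num) z
      refine tendsto_telescoper (x₁ := z) (x₂ := 3 * z) (x₃ := 3 * z + 1)
        (C := 162 * ‖2 * z + 1‖ * ‖z‖ ^ 2 * C * 4) (by positivity) (fun n => ?_) (fun n => ?_) hlim0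
      · have hWn : 0 ≤ W n := by simp only [hW]; positivity
        -- The certificate has four denominators and `tendsto_telescoper` takes three. The real part
        -- n − 5/4 keeps the fourth at distance at least 1/4 from 0, whence the factor 4 in the
        -- constant.
        have h4 : 1 / 4 ≤ ‖(n : ℂ) - (3 * z + 1 + 1)‖ := by
          refine le_trans ?_ (Complex.abs_re_le_norm _)
          have hre : ((n : ℂ) - (3 * z + 1 + 1)).re = n - 5 / 4 := by simp [hz]; norm_num
          rw [hre, le_abs]
          rcases le_or_gt n 1 with h | h
          · right
            have : (n : ℝ) ≤ 1 := by exact_mod_cast h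
            linarith
          · left
            have : (2 : ℝ) ≤ n := by exact_mod_cast h
            linarith
        have hk := norm_pos_iff.2 (n1 n)
        have hk2 := norm_pos_iff.2 (n2 n)
        have hk3 := norm_pos_iff.2 (n3 n)
        have := hCle n
        rw [norm_mul] at this
        simp only [hF, norm_div, norm_mul, norm_neg, norm_pow, Complex.norm_natCast,
          Complex.norm_real, Real.norm_of_nonneg hWn, Complex.norm_ofNat]
        rw [← div_div, div_le_iff₀ (by positivity)]
        refine (div_le_div_of_nonneg_right ?_ (by positivity)).trans_eq
          (div_mul_eq_mul_div _ _ _).symm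
        calc _ = 162 * n * ‖2 * z + 1‖ * ‖z‖ ^ 2 * W n *
              (‖sqProd z n‖ * ‖sqProd ((3 : ℝ) * z) n‖) := by ring
          _ ≤ 162 * n * ‖2 * z + 1‖ * ‖z‖ ^ 2 * W n * (C * (n.factorial : ℝ) ^ 4) := by gcongr
          _ = 162 * ‖2 * z + 1‖ * ‖z‖ ^ 2 * C * (n * (W n * (n.factorial : ℝ) ^ 4)) *
              (4 * (1 / 4)) := by ring
          _ ≤ 162 * ‖2 * z + 1‖ * ‖z‖ ^ 2 * C * (n * (W n * (n.factorial : ℝ) ^ 4)) *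
              (4 * ‖(n : ℂ) - (3 * z + 1 + 1)‖) := by gcongr
          _ = _ := by ring
      · simp only [hW]; positivity
  have hval := tsum_pairTerm_zero hw (by norm_num) (by norm_num) (by norm_num) (by norm_num)
    (by norm_num) hs hper (t := 1 / 3) ⟨by norm_num, by norm_num⟩
  rw [show ∑' n, pairTerm w 35 8 27 3 n ((1 / 3 : ℝ) : ℂ) = pairTerm w 35 8 27 3 0 ((1 / 3 : ℝ) : ℂ) from
    tsum_eq_single 0 fun n hn => by
      obtain ⟨m, rfl⟩ := Nat.exists_eq_succ_of_ne_zero hn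
      rw [pairTerm, Finset.prod_eq_zero (i := 0) (by simp) (by push_cast; norm_num), mul_zero]]
    at hval
  have hw0 : w 0 = 27 / 8 := by
    simp only [hwdef, hW]
    norm_num [Nat.factorial]
  have h1 : Complex.sin (π * ((1 / 3 : ℝ) : ℂ)) ^ 2 = 3 / 4 := by
    rw [show (π : ℂ) * ((1 / 3 : ℝ) : ℂ) = ((π / 3 : ℝ) : ℂ) by push_cast; ring,
      ← Complex.ofReal_sin, ← Complex.ofReal_pow, Real.sin_pi_div_three, div_pow,
      Real.sq_sqrt (by norm_num)]
    push_cast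
    norm_num
  rw [h1, pairTerm, hw0] at hval
  have h2 := (hsum 0).hasSum
  have h3 : ∀ n, pairTerm w 35 8 27 3 n 0 =
      (((35 * ((n : ℝ) + 1) - 8) * quadTerm 81 n : ℝ) : ℂ) := fun n => by
    rw [pairTerm_zero, ← pow_mul_factorial_pow_eq (hterm n)]
    simp only [hwdef]
    push_cast
    ring
  rw [show ∑' n, pairTerm w 35 8 27 3 n 0 = ((12 * π ^ 2 : ℝ) : ℂ) by
    push_cast at hval ⊢
    simp only [Finset.prod_range_zero] at hval
    linear_combination 4 / 3 * hval, funext h3, Complex.hasSum_ofReal] at h2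
  exact h2

/-! ### Polynomial telescoping in each family, and shifted binomials -/

/-- The added sequence is (2k−1)³ w(k) t(k) with k = n + 1 and w quadratic. The cube cancels the
denominator of the term ratio, so the difference of consecutive terms is again a polynomial times
t(k). The analogues use (2k−1)(3k−1)(3k−2) and (2k−1)(4k−1)(4k−3). -/
theorem HasSum.cubeTerm_telescope {z α β S : ℝ} (hz : |z| < 64)
    (h : HasSum (fun n : ℕ => (α * ((n : ℝ) + 1) - β) * cubeTerm z n) S) (A w₀ w₁ w₂ : ℝ) :
    HasSum (fun n : ℕ => (A * (α * ((n : ℝ) + 1) - β)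
      + (2 * (n : ℝ) + 1) ^ 3 * (w₀ + w₁ * ((n : ℝ) + 1) + w₂ * ((n : ℝ) + 1) ^ 2)
      - z / 8 * ((n : ℝ) + 1) ^ 3 * (w₀ + w₁ * ((n : ℝ) + 2) + w₂ * ((n : ℝ) + 2) ^ 2)) *
        cubeTerm z n) (A * S + (w₀ + w₁ + w₂) * (z / 8)) := by
  refine h.mul_add_telescope (A := A) (v := fun n => (2 * (n : ℝ) + 1) ^ 3 *
    (w₀ + w₁ * ((n : ℝ) + 1) + w₂ * ((n : ℝ) + 1) ^ 2) * cubeTerm z n)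
    ((summable_polynomial_mul_of_ratio (q := |z| / 64) (by positivity) (by linarith)
      (cubeTerm_ratio z) ((2 * Polynomial.X + 1) ^ 3 * (Polynomial.C w₀ +
        Polynomial.C w₁ * (Polynomial.X + 1) + Polynomial.C w₂ * (Polynomial.X + 1) ^ 2))).congr
      fun n => by simp) (fun n => ?_) ?_
  · rw [cubeTerm_succ]
    push_cast
    field_simp
    ring
  · have h0 : cubeTerm z 0 = z / 8 := by simp [cubeTerm]; norm_num
    rw [h0]
    push_cast
    ring

theorem HasSum.tripleTerm_telescope {z α β S : ℝ} (hz : |z| < 108)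
    (h : HasSum (fun n : ℕ => (α * ((n : ℝ) + 1) - β) * tripleTerm z n) S) (A w₀ w₁ w₂ : ℝ) :
    HasSum (fun n : ℕ => (A * (α * ((n : ℝ) + 1) - β)
      + (2 * (n : ℝ) + 1) * (3 * n + 2) * (3 * n + 1) *
        (w₀ + w₁ * ((n : ℝ) + 1) + w₂ * ((n : ℝ) + 1) ^ 2)
      - z / 6 * ((n : ℝ) + 1) ^ 3 * (w₀ + w₁ * ((n : ℝ) + 2) + w₂ * ((n : ℝ) + 2) ^ 2)) *
        tripleTerm z n) (A * S + (w₀ + w₁ + w₂) * (z / 6)) := by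
  refine h.mul_add_telescope (A := A) (v := fun n => (2 * (n : ℝ) + 1) * (3 * n + 2) * (3 * n + 1) *
    (w₀ + w₁ * ((n : ℝ) + 1) + w₂ * ((n : ℝ) + 1) ^ 2) * tripleTerm z n)
    ((summable_polynomial_mul_of_ratio (q := |z| / 108) (by positivity) (by linarith)
      (tripleTerm_ratio z) ((2 * Polynomial.X + 1) * (3 * Polynomial.X + 2) *
        (3 * Polynomial.X + 1) * (Polynomial.C w₀ +
        Polynomial.C w₁ * (Polynomial.X + 1) + Polynomial.C w₂ * (Polynomial.X + 1) ^ 2))).congr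
      fun n => by simp) (fun n => ?_) ?_
  · rw [tripleTerm_succ]
    push_cast
    field_simp
    ring
  · have h0 : tripleTerm z 0 = z / 12 := by simp [tripleTerm]; norm_num
    rw [h0]
    push_cast
    ring

theorem HasSum.quadTerm_telescope {z α β S : ℝ} (hz : |z| < 256)
    (h : HasSum (fun n : ℕ => (α * ((n : ℝ) + 1) - β) * quadTerm z n) S) (A w₀ w₁ w₂ : ℝ) :
    HasSum (fun n : ℕ => (A * (α * ((n : ℝ) + 1) - β)
      + (2 * (n : ℝ) + 1) * (4 * n + 3) * (4 * n + 1) *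
        (w₀ + w₁ * ((n : ℝ) + 1) + w₂ * ((n : ℝ) + 1) ^ 2)
      - z / 8 * ((n : ℝ) + 1) ^ 3 * (w₀ + w₁ * ((n : ℝ) + 2) + w₂ * ((n : ℝ) + 2) ^ 2)) *
        quadTerm z n) (A * S + (w₀ + w₁ + w₂) * (z / 8)) := by
  refine h.mul_add_telescope (A := A) (v := fun n => (2 * (n : ℝ) + 1) * (4 * n + 3) * (4 * n + 1) *
    (w₀ + w₁ * ((n : ℝ) + 1) + w₂ * ((n : ℝ) + 1) ^ 2) * quadTerm z n)
    ((summable_polynomial_mul_of_ratio (q := |z| / 256) (by positivity) (by linarith)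
      (quadTerm_ratio z) ((2 * Polynomial.X + 1) * (4 * Polynomial.X + 3) *
        (4 * Polynomial.X + 1) * (Polynomial.C w₀ +
        Polynomial.C w₁ * (Polynomial.X + 1) + Polynomial.C w₂ * (Polynomial.X + 1) ^ 2))).congr
      fun n => by simp) (fun n => ?_) ?_
  · rw [quadTerm_succ]
    push_cast
    field_simp
    ring
  · have h0 : quadTerm z 0 = z / 24 := by simp [quadTerm, Nat.choose]; norm_num
    rw [h0]
    push_cast
    ring

theorem cast_choose_succ {N k : ℕ} (h : k ≤ N) :
    (N.choose (k + 1) : ℝ) = N.choose k * ((N : ℝ) - k) / ((k : ℝ) + 1) := by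
  rw [eq_div_iff (by positivity), ← Nat.cast_sub h]
  exact_mod_cast Nat.choose_succ_right_eq N k

theorem cast_choose_ne_zero {N k : ℕ} (h : k ≤ N) : (N.choose k : ℝ) ≠ 0 :=
  Nat.cast_ne_zero.2 (Nat.choose_pos h).ne'

theorem pow_div_choose_cube (z : ℝ) (n : ℕ) :
    z ^ (n + 1) / (Nat.choose (2 * (n + 1)) (n + 1) : ℝ) ^ 3 = ((n : ℝ) + 1) ^ 3 * cubeTerm z n := by
  have := cast_choose_ne_zero (by omega : n + 1 ≤ 2 * (n + 1))
  rw [cubeTerm]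
  field_simp

/-- As C(2k,k+1) = C(2k,k) · k/(k+1), the shifted index replaces the factor k³ by (k+1)³. -/
theorem pow_div_choose_succ_cube (z : ℝ) (n : ℕ) :
    z ^ (n + 1) / (Nat.choose (2 * (n + 1)) (n + 1 + 1) : ℝ) ^ 3 =
      ((n : ℝ) + 2) ^ 3 * cubeTerm z n := by
  have := cast_choose_ne_zero (by omega : n + 1 ≤ 2 * (n + 1))
  rw [cast_choose_succ (by omega), cubeTerm]
  push_cast
  rw [show 2 * ((n : ℝ) + 1) - (n + 1) = n + 1 by ring]
  field_simp
  ring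

theorem one_div_choose_cube (n : ℕ) :
    1 / (Nat.choose (2 * (n + 1)) (n + 1) : ℝ) ^ 3 = ((n : ℝ) + 1) ^ 3 * cubeTerm 1 n := by
  rw [← pow_div_choose_cube, one_pow]

theorem one_div_choose_succ_cube (n : ℕ) :
    1 / (Nat.choose (2 * (n + 1)) (n + 1 + 1) : ℝ) ^ 3 = ((n : ℝ) + 2) ^ 3 * cubeTerm 1 n := by
  rw [← pow_div_choose_succ_cube, one_pow]

theorem pow_div_choose_triple (z : ℝ) (n : ℕ) :
    z ^ (n + 1) / ((Nat.choose (2 * (n + 1)) (n + 1) : ℝ) ^ 2 *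
      (Nat.choose (3 * (n + 1)) (n + 1) : ℝ)) = ((n : ℝ) + 1) ^ 3 * tripleTerm z n := by
  have := cast_choose_ne_zero (by omega : n + 1 ≤ 2 * (n + 1))
  have := cast_choose_ne_zero (by omega : n + 1 ≤ 3 * (n + 1))
  rw [tripleTerm]
  field_simp

theorem pow_div_choose_succ_triple (z : ℝ) (n : ℕ) :
    z ^ (n + 1) / ((Nat.choose (2 * (n + 1)) (n + 1 + 1) : ℝ) ^ 2 *
      (Nat.choose (3 * (n + 1)) (n + 1 + 1) : ℝ)) = ((n : ℝ) + 2) ^ 3 / 2 * tripleTerm z n := by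
  have := cast_choose_ne_zero (by omega : n + 1 ≤ 2 * (n + 1))
  have := cast_choose_ne_zero (by omega : n + 1 ≤ 3 * (n + 1))
  rw [cast_choose_succ (by omega : n + 1 ≤ 2 * (n + 1)),
    cast_choose_succ (by omega : n + 1 ≤ 3 * (n + 1)), tripleTerm]
  push_cast
  rw [show 2 * ((n : ℝ) + 1) - (n + 1) = n + 1 by ring,
    show 3 * ((n : ℝ) + 1) - (n + 1) = 2 * (n + 1) by ring]
  field_simp
  ring

theorem pow_div_choose_quad (z : ℝ) (n : ℕ) :
    z ^ (n + 1) / ((Nat.choose (2 * (n + 1)) (n + 1) : ℝ) ^ 2 *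
      (Nat.choose (4 * (n + 1)) (2 * (n + 1)) : ℝ)) = ((n : ℝ) + 1) ^ 3 * quadTerm z n := by
  have := cast_choose_ne_zero (by omega : n + 1 ≤ 2 * (n + 1))
  have := cast_choose_ne_zero (by omega : 2 * (n + 1) ≤ 4 * (n + 1))
  rw [quadTerm]
  field_simp

theorem pow_div_choose_succ_quad (z : ℝ) (n : ℕ) :
    z ^ (n + 1) / ((Nat.choose (2 * (n + 1)) (n + 1 + 1) : ℝ) ^ 2 *
      (Nat.choose (4 * (n + 1)) (2 * (n + 1) + 1) : ℝ)) =
      ((n : ℝ) + 2) ^ 2 * (2 * n + 3) / 2 * quadTerm z n := by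
  have := cast_choose_ne_zero (by omega : n + 1 ≤ 2 * (n + 1))
  have := cast_choose_ne_zero (by omega : 2 * (n + 1) ≤ 4 * (n + 1))
  rw [cast_choose_succ (by omega : n + 1 ≤ 2 * (n + 1)),
    cast_choose_succ (by omega : 2 * (n + 1) ≤ 4 * (n + 1)), quadTerm]
  push_cast
  rw [show 2 * ((n : ℝ) + 1) - (n + 1) = n + 1 by ring,
    show 4 * ((n : ℝ) + 1) - 2 * (n + 1) = 2 * (n + 1) by ring]
  field_simp
  ring

theorem pow_div_eq_pow_succ_div {z : ℝ} (hz : z ≠ 0) (n : ℕ) (d : ℝ) :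
    z ^ n / d = z⁻¹ * (z ^ (n + 1) / d) := by
  rw [pow_succ]
  field_simp

theorem HasSum.of_nat_succ {f g : ℕ → ℝ} {a b : ℝ} (h : HasSum g a)
    (hfg : ∀ n, f (n + 1) = g n) (hab : b = a + f 0) : HasSum f b := by
  rw [← funext hfg] at h
  rw [hab, add_comm]
  exact h.zero_add

theorem HasSum.of_succPNat {f : ℕ+ → ℝ} {g : ℕ → ℝ} {a b : ℝ} (h : HasSum g a)
    (hfg : ∀ n : ℕ, f n.succPNat = g n) (hab : b = a) : HasSum f b := by
  rw [hab, ← Equiv.pnatEquivNat.symm.hasSum_iff]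
  exact h.of_eq hfg rfl

/-! ### The deformation of the series at −144 and its difference equation -/

/-- `∏_{i < M} (x + i + 3/2)`. -/
noncomputable def halfProd (x : ℂ) (M : ℕ) : ℂ := ∏ i ∈ Finset.range M, (x + (i + 3 / 2))

theorem halfProd_succ (x : ℂ) (M : ℕ) : halfProd x (M + 1) = halfProd x M * (x + (M + 3 / 2)) := by
  simp [halfProd, Finset.prod_range_succ]

theorem mul_halfProd_add_one (x : ℂ) (M : ℕ) :
    (x + 3 / 2) * halfProd (x + 1) M = (x + (M + 3 / 2)) * halfProd x M := by
  induction M with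
  | zero => simp [halfProd]
  | succ M ih =>
    rw [halfProd_succ, halfProd_succ, ← mul_assoc, ih]
    push_cast
    ring

theorem halfProd_ne_zero {x : ℂ} (hx : -(3 / 2) < x.re) (M : ℕ) : halfProd x M ≠ 0 := by
  refine Finset.prod_ne_zero_iff.2 fun i _ h => ?_
  have h1 := congrArg Complex.re h
  simp only [Complex.add_re, Complex.natCast_re, Complex.zero_re] at h1
  norm_num at h1
  linarith [(Nat.cast_nonneg i : (0 : ℝ) ≤ i)]

/-- The hypergeometric term of the series deforming `∑ (5n - 1) (-144)^n / (n³ C(2n,n)² C(4n,2n))`. -/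
noncomputable def deformCore (x : ℂ) (N : ℕ) : ℂ :=
  (-9 / 4) ^ (N + 1) * N.factorial * sqProd x N /
    ((1 / 2 - x) * halfProd (-x) N * halfProd x (2 * N + 1))

theorem deformCore_succ {x : ℂ} (h1 : -(7 / 8) < x.re) (h2 : x.re < 3 / 8) (N : ℕ) :
    deformCore x (N + 1) = -9 / 4 * (N + 1) * ((N + 1) ^ 2 - x ^ 2) /
      ((-x + (N + 3 / 2)) * (x + (2 * N + 1 + 3 / 2)) * (x + (2 * N + 2 + 3 / 2))) *
        deformCore x N := by
  have e1 := halfProd_ne_zero (x := -x) (by simp; linarith) N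
  have e2 := halfProd_ne_zero (x := x) (by linarith) (2 * N + 1)
  have e3 := halfProd_ne_zero (x := -x) (by simp; linarith) (N + 1)
  have e4 := halfProd_ne_zero (x := x) (by linarith) (2 * N + 1 + 1 + 1)
  rw [deformCore, deformCore, show 2 * (N + 1) + 1 = 2 * N + 1 + 1 + 1 by ring]
  rw [halfProd_succ] at e3 ⊢
  rw [halfProd_succ, halfProd_succ] at e4 ⊢
  rw [sqProd_succ, Nat.factorial_succ, pow_succ _ (N + 1)]
  have e5 := right_ne_zero_of_mul e3
  have e6 := right_ne_zero_of_mul e4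
  have e7 := right_ne_zero_of_mul (left_ne_zero_of_mul e4)
  have e8 : 1 / 2 - x ≠ 0 := fun h => by
    have h3 := congrArg Complex.re h
    norm_num at h3
    linarith
  push_cast at e5 e6 e7 ⊢
  generalize (-x + ((N : ℂ) + 3 / 2)) = a at *
  generalize (x + (2 * (N : ℂ) + 1 + 3 / 2)) = b at *
  generalize (x + (2 * (N : ℂ) + 2 + 3 / 2)) = c at *
  field_simp

/-- All products are strings of linear factors in x, so the shift only affects their ends; on Re x =
−3/4 none of the factors involved vanishes. -/
theorem deformCore_add_one {x : ℂ} (hx : x.re = -(3 / 4)) (N : ℕ) :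
    deformCore (x + 1) N = x * (x + N + 1) * (N + 1 / 2 - x) * (x + 3 / 2) /
      ((x + 1) * (N - x) * (x + 1 / 2) * (x + (2 * N + 5 / 2))) * deformCore x N := by
  have n0 : ∀ m : ℕ, (m : ℂ) - x ≠ 0 := natCast_sub_ne_zero_of_re (k := -3) (by rw [hx]; norm_num)
    (by norm_num)
  have ne : ∀ {z : ℂ}, z.re ≠ 0 → z ≠ 0 := fun h h0 => h (by rw [h0, Complex.zero_re])
  have n1 : x + 1 ≠ 0 := ne (by norm_num [hx])
  have n2 : x + 1 / 2 ≠ 0 := ne (by norm_num [hx])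
  have n3 : x + 3 / 2 ≠ 0 := ne (by norm_num [hx])
  have n4 : 1 / 2 - x ≠ 0 := ne (by norm_num [hx])
  have n5 : (N : ℂ) + 1 / 2 - x ≠ 0 := ne (by
    norm_num [hx]; have := (Nat.cast_nonneg N : (0 : ℝ) ≤ N); linarith)
  have n6 : x + (2 * (N : ℂ) + 5 / 2) ≠ 0 := ne (by
    norm_num [hx]; have := (Nat.cast_nonneg N : (0 : ℝ) ≤ N); linarith)
  have n7 := n0 N
  have e1 := halfProd_ne_zero (x := -x) (by norm_num [hx]) N
  have e2 := halfProd_ne_zero (x := x) (by norm_num [hx]) (2 * N + 1)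
  have s1 : halfProd (x + 1) (2 * N + 1) = (x + (2 * N + 5 / 2)) * halfProd x (2 * N + 1) /
      (x + 3 / 2) := by
    rw [eq_div_iff n3, mul_comm, mul_halfProd_add_one]
    push_cast
    ring
  have s2 : halfProd (-(x + 1)) N = (1 / 2 - x) * halfProd (-x) N / (N + 1 / 2 - x) := by
    have h := mul_halfProd_add_one (-(x + 1)) N
    rw [show -(x + 1) + 1 = -x by ring] at h
    rw [eq_div_iff n5]
    linear_combination -h
  rw [deformCore, deformCore, s1, s2, sqProd_add_one n0 n1,
    show 1 / 2 - (x + 1) = -(x + 1 / 2) by ring]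
  generalize sqProd x N = q
  generalize halfProd x (2 * N + 1) = p at *
  generalize halfProd (-x) N = r at *
  generalize (x + (2 * (N : ℂ) + 5 / 2)) = a at *
  have h1 : 2 * x + 1 ≠ 0 := by
    intro h
    exact n2 (by linear_combination h / 2)
  generalize (N : ℂ) + 1 / 2 - x = b at *
  generalize (1 : ℂ) / 2 - x = c at *
  generalize x + 1 / 2 = d at *
  generalize x + 3 / 2 = e at *
  generalize (N : ℂ) - x = g at *
  field_simp

/-- The bound must be uniform in Im x. The factors m ± x of the numerator are dominated one by one
by the half-integer factors of the denominator; the remaining denominator is bounded below by real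
parts, and the central binomial estimate turns (9/4)^N into (9/16)^N. -/
theorem norm_deformCore_le {x : ℂ} (h1 : -(7 / 8) < x.re) (h2 : x.re < 3 / 8) (N : ℕ) :
    ‖deformCore x N‖ ≤ 30 * ((2 * N + 1) * (9 / 16) ^ N) := by
  have hle : ∀ {a b : ℂ}, |a.re| ≤ |b.re| → |a.im| = |b.im| → ‖a‖ ≤ ‖b‖ := fun {a b} hr hi => by
    rw [Complex.norm_eq_sqrt_sq_add_sq, Complex.norm_eq_sqrt_sq_add_sq]
    refine Real.sqrt_le_sqrt (add_le_add (sq_le_sq.2 hr) (sq_le_sq.2 hi.le))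
  have hq : ‖sqProd x N‖ ≤ ‖halfProd (-x) N‖ * ‖halfProd x N‖ := by
    rw [sqProd, halfProd, halfProd, ← norm_mul, ← Finset.prod_mul_distrib, norm_prod, norm_prod]
    refine Finset.prod_le_prod (fun _ _ => norm_nonneg _) fun i _ => ?_
    rw [show ((i : ℂ) + 1) ^ 2 - x ^ 2 = (-x + (i + 1)) * (x + (i + 1)) by ring, norm_mul, norm_mul]
    have hi : (0 : ℝ) ≤ i := Nat.cast_nonneg i
    refine mul_le_mul (hle ?_ ?_) (hle ?_ ?_) (norm_nonneg _) (norm_nonneg _)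
    · norm_num
      rw [abs_of_nonneg (by linarith), abs_of_nonneg (by linarith)]
      linarith
    · norm_num
    · norm_num
      rw [abs_of_nonneg (by linarith), abs_of_nonneg (by linarith)]
      linarith
    · norm_num
  have hsplit : halfProd x (2 * N + 1) = halfProd x N *
      ∏ i ∈ Finset.range (N + 1), (x + ((N + i : ℕ) + 3 / 2)) := by
    rw [halfProd, show 2 * N + 1 = N + (N + 1) by ring, Finset.prod_range_add, halfProd]
  -- The bound 5/8 is 3/2 − 7/8, from the first of the remaining factors; each later one exceeds the
  -- corresponding N + i + 1.
  have hbig : 5 / 8 * ∏ i ∈ Finset.range N, ((N : ℝ) + i + 1) ≤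
      ‖∏ i ∈ Finset.range (N + 1), (x + ((N + i : ℕ) + 3 / 2))‖ := by
    rw [norm_prod, Finset.prod_range_succ', mul_comm]
    refine mul_le_mul (Finset.prod_le_prod (fun i _ => by positivity) fun i _ => ?_) ?_
      (by norm_num) (Finset.prod_nonneg fun _ _ => norm_nonneg _)
    · refine le_trans ?_ (Complex.re_le_norm _)
      norm_num
      linarith
    · refine le_trans ?_ (Complex.re_le_norm _)
      norm_num
      linarith [(Nat.cast_nonneg N : (0 : ℝ) ≤ N)]
  have hasc : (N.factorial : ℝ) * ∏ i ∈ Finset.range N, ((N : ℝ) + i + 1) =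
      (2 * N).factorial := by
    have h := Nat.factorial_mul_ascFactorial N N
    rw [Nat.ascFactorial_eq_prod_range, ← two_mul] at h
    rw [← h]
    push_cast
    congr 1
    exact Finset.prod_congr rfl fun i _ => by ring
  have hcb : (4 : ℝ) ^ N * ((N.factorial : ℝ) * N.factorial) ≤ (2 * N + 1) * (2 * N).factorial := by
    have h := Nat.four_pow_le_two_mul_add_one_mul_central_binom N
    have h' : (4 : ℝ) ^ N ≤ (2 * N + 1) * (Nat.choose (2 * N) N : ℝ) := by exact_mod_cast h
    rw [choose_two_mul] at h'
    calc (4 : ℝ) ^ N * ((N.factorial : ℝ) * N.factorial) ≤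
        ((2 * N + 1) * ((2 * N).factorial / (N.factorial : ℝ) ^ 2)) *
          ((N.factorial : ℝ) * N.factorial) := by gcongr
      _ = _ := by
        have := factorial_ne_zero_real N
        field_simp
  have hP : (4 : ℝ) ^ N * N.factorial ≤ (2 * N + 1) * ∏ i ∈ Finset.range N, ((N : ℝ) + i + 1) := by
    have hN : (0 : ℝ) < N.factorial := by positivity
    refine le_of_mul_le_mul_left ?_ hN
    calc (N.factorial : ℝ) * (4 ^ N * N.factorial) = 4 ^ N * ((N.factorial : ℝ) * N.factorial) := by
          ring
      _ ≤ _ := hcb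
      _ = _ := by rw [← hasc]; ring
  have hc : 1 / 8 ≤ ‖1 / 2 - x‖ := by
    refine le_trans ?_ (Complex.re_le_norm _)
    norm_num
    linarith
  have e1 := norm_pos_iff.2 (halfProd_ne_zero (x := -x) (by simp; linarith) N)
  have e2 := norm_pos_iff.2 (halfProd_ne_zero (x := x) (by linarith) N)
  rw [deformCore, hsplit]
  simp only [norm_div, norm_mul, norm_pow, Complex.norm_natCast]
  rw [div_le_iff₀ (by
    have : (0 : ℝ) < 5 / 8 * ∏ i ∈ Finset.range N, ((N : ℝ) + i + 1) :=
      mul_pos (by norm_num) (Finset.prod_pos fun i _ => by positivity)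
    have := this.trans_le hbig
    have : 0 < ‖1 / 2 - x‖ := by linarith
    positivity)]
  set P := ∏ i ∈ Finset.range N, ((N : ℝ) + i + 1) with hPdef
  have hP0 : 0 ≤ P := Finset.prod_nonneg fun i _ => by positivity
  set R := ‖∏ i ∈ Finset.range (N + 1), (x + ((N + i : ℕ) + 3 / 2))‖
  have h94 : ‖(-9 : ℂ)‖ / ‖(4 : ℂ)‖ = 9 / 4 := by norm_num
  rw [h94]
  have hpow : (9 / 4 : ℝ) ^ (N + 1) = 9 / 4 * ((9 / 16) ^ N * 4 ^ N) := by
    rw [← mul_pow, pow_succ]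
    norm_num
    ring
  calc (9 / 4 : ℝ) ^ (N + 1) * N.factorial * ‖sqProd x N‖
      ≤ (9 / 4) ^ (N + 1) * N.factorial * (‖halfProd (-x) N‖ * ‖halfProd x N‖) := by gcongr
    _ = 9 / 4 * (9 / 16) ^ N * (4 ^ N * N.factorial) * (‖halfProd (-x) N‖ * ‖halfProd x N‖) := by
        rw [hpow]; ring
    _ ≤ 9 / 4 * (9 / 16) ^ N * ((2 * N + 1) * P) * (‖halfProd (-x) N‖ * ‖halfProd x N‖) := by
        gcongr
    -- The constants satisfy 9/4 = 28.8 · (1/8)(5/8), rounded up to 30.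
    _ ≤ 30 * (9 / 16) ^ N * ((2 * N + 1) * (1 / 8 * (5 / 8 * P))) *
        (‖halfProd (-x) N‖ * ‖halfProd x N‖) := by
        have : 0 ≤ (9 / 16 : ℝ) ^ N * ((2 * N + 1) * P) * (‖halfProd (-x) N‖ * ‖halfProd x N‖) := by
          positivity
        nlinarith
    _ ≤ 30 * (9 / 16) ^ N * ((2 * N + 1) * (‖1 / 2 - x‖ * R)) *
        (‖halfProd (-x) N‖ * ‖halfProd x N‖) := by
        gcongr
    _ = _ := by ring

theorem summable_quadratic_mul_pow :
    Summable fun N : ℕ => (5 * (N : ℝ) + 4) * (30 * ((2 * N + 1) * (9 / 16) ^ N)) := by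
  refine (summable_polynomial_mul_of_ratio (q := 9 / 16) (u := fun n => (9 / 16) ^ n) (by norm_num)
    (by norm_num) (fun n => ?_) ((5 * Polynomial.X + 4) * (30 * (2 * Polynomial.X + 1)))).congr
    fun n => ?_
  · rw [abs_of_nonneg (by positivity), abs_of_nonneg (by positivity), pow_succ, mul_comm]
  · simp
    ring

/-- The deformation of `∑ (5n - 1) (-144)^n / (n³ C(2n,n)² C(4n,2n))`. -/
noncomputable def deformSum (x : ℂ) : ℂ := ∑' N : ℕ, (5 * (N : ℂ) + 4 + x) * deformCore x N

theorem norm_deformTerm_le {x : ℂ} (h1 : -(7 / 8) < x.re) (h2 : x.re < 3 / 8) (N : ℕ) :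
    ‖(5 * (N : ℂ) + 4 + x) * deformCore x N‖ ≤
      (5 * (N : ℝ) + 4) * (30 * ((2 * N + 1) * (9 / 16) ^ N)) * (1 + ‖x‖) := by
  rw [norm_mul]
  have h : ‖5 * (N : ℂ) + 4 + x‖ ≤ (5 * (N : ℝ) + 4) * (1 + ‖x‖) := by
    refine (norm_add_le _ _).trans ?_
    have : ‖5 * (N : ℂ) + 4‖ = 5 * (N : ℝ) + 4 := by
      have := Complex.norm_natCast (5 * N + 4)
      push_cast at this
      exact this
    rw [this]
    nlinarith [norm_nonneg x, mul_nonneg (Nat.cast_nonneg N : (0 : ℝ) ≤ N) (norm_nonneg x)]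
  calc _ ≤ (5 * (N : ℝ) + 4) * (1 + ‖x‖) * (30 * ((2 * N + 1) * (9 / 16) ^ N)) :=
        mul_le_mul h (norm_deformCore_le h1 h2 N) (norm_nonneg _) (by positivity)
    _ = _ := by ring

theorem summable_deformTerm {x : ℂ} (h1 : -(7 / 8) < x.re) (h2 : x.re < 3 / 8) :
    Summable fun N : ℕ => (5 * (N : ℂ) + 4 + x) * deformCore x N :=
  Summable.of_norm_bounded (summable_quadratic_mul_pow.mul_right _) (norm_deformTerm_le h1 h2)

theorem norm_deformSum_le {x : ℂ} (h1 : -(7 / 8) < x.re) (h2 : x.re < 3 / 8) :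
    ‖deformSum x‖ ≤
      (∑' N : ℕ, (5 * (N : ℝ) + 4) * (30 * ((2 * N + 1) * (9 / 16) ^ N))) * (1 + ‖x‖) := by
  rw [← tsum_mul_right]
  exact tsum_of_norm_bounded (summable_quadratic_mul_pow.mul_right _).hasSum
    (norm_deformTerm_le h1 h2)

theorem differentiableAt_deformSum {x : ℂ} (h1 : -(7 / 8) < x.re) (h2 : x.re < 3 / 8) :
    DifferentiableAt ℂ deformSum x := by
  set U : Set ℂ := {z | -(7 / 8) < z.re ∧ z.re < 3 / 8} ∩ Metric.ball 0 (‖x‖ + 1) with hU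
  have hUo : IsOpen U := ((isOpen_lt continuous_const Complex.continuous_re).inter
    (isOpen_lt Complex.continuous_re continuous_const)).inter Metric.isOpen_ball
  have h := Complex.differentiableOn_tsum_of_summable_norm (U := U)
    (F := fun (N : ℕ) (x : ℂ) => (5 * (N : ℂ) + 4 + x) * deformCore x N)
    (summable_quadratic_mul_pow.mul_right (1 + (‖x‖ + 1))) (fun N z hz => ?_) hUo
    (fun N z hz => ?_)
  · exact h.differentiableAt (hUo.mem_nhds ⟨⟨h1, h2⟩, by simp⟩)
  · have e1 := halfProd_ne_zero (x := -z) (by simp; linarith [hz.1.2]) N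
    have e2 := halfProd_ne_zero (x := z) (by linarith [hz.1.1]) (2 * N + 1)
    have e3 : 1 / 2 - z ≠ 0 := fun h => by
      have h3 := congrArg Complex.re h
      norm_num at h3
      linarith [hz.1.2]
    unfold deformCore halfProd sqProd at *
    refine DifferentiableAt.differentiableWithinAt ?_
    refine DifferentiableAt.mul (by fun_prop) (DifferentiableAt.div (by fun_prop) (by fun_prop) ?_)
    exact mul_ne_zero (mul_ne_zero e3 e1) e2
  · refine (norm_deformTerm_le hz.1.1 hz.1.2 N).trans ?_
    have := (mem_ball_zero_iff.1 hz.2).le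
    gcongr

/-- `∑ (-1)^j 3^{-j-1} / (x - j - 1/2)`. -/
noncomputable def poleSum (x : ℂ) : ℂ := ∑' j : ℕ, (-1 / 3) ^ j / 3 * (x - (j + 1 / 2))⁻¹

theorem re_le_norm_sub_half {x : ℂ} (h : x.re < 3 / 8) (j : ℕ) : 1 / 8 ≤ ‖x - (j + 1 / 2)‖ := by
  rw [norm_sub_rev]
  refine le_trans ?_ (Complex.re_le_norm _)
  norm_num
  linarith [(Nat.cast_nonneg j : (0 : ℝ) ≤ j)]

theorem norm_poleTerm_le {x : ℂ} (h : x.re < 3 / 8) (j : ℕ) :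
    ‖(-1 / 3 : ℂ) ^ j / 3 * (x - (j + 1 / 2))⁻¹‖ ≤ 8 / 3 * (1 / 3) ^ j := by
  have h1 := re_le_norm_sub_half h j
  have h3 : ‖(-1 / 3 : ℂ)‖ = 1 / 3 := by norm_num
  rw [norm_mul, norm_div, norm_pow, h3, norm_inv, Complex.norm_ofNat]
  have h2 : ‖x - (j + 1 / 2)‖⁻¹ ≤ 8 := by
    rw [inv_le_comm₀ (by linarith) (by norm_num)]
    linarith
  calc _ ≤ (1 / 3 : ℝ) ^ j / 3 * 8 := by gcongr
    _ = _ := by ring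

theorem summable_poleTerm {x : ℂ} (h : x.re < 3 / 8) :
    Summable fun j : ℕ => (-1 / 3 : ℂ) ^ j / 3 * (x - (j + 1 / 2))⁻¹ :=
  Summable.of_norm_bounded ((summable_geometric_of_lt_one (by norm_num) (by norm_num)).mul_left _)
    (norm_poleTerm_le h)

theorem norm_poleSum_le {x : ℂ} (h : x.re < 3 / 8) : ‖poleSum x‖ ≤ 4 := by
  have hs := (hasSum_geometric_of_lt_one (by norm_num : (0 : ℝ) ≤ 1 / 3) (by norm_num)).mul_left
    (8 / 3)
  refine (tsum_of_norm_bounded hs (norm_poleTerm_le h)).trans (by norm_num)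

theorem hasDerivAt_poleSum {x : ℂ} (h : x.re < 3 / 8) :
    HasDerivAt poleSum (∑' j : ℕ, -((-1 / 3) ^ j / 3 / (x - (j + 1 / 2)) ^ 2)) x := by
  have hU : IsOpen {z : ℂ | z.re < 3 / 8} := isOpen_lt Complex.continuous_re continuous_const
  have hd : ∀ (j : ℕ) (z : ℂ), z.re < 3 / 8 → HasDerivAt
      (fun z : ℂ => (-1 / 3 : ℂ) ^ j / 3 * (z - (j + 1 / 2))⁻¹)
      (-((-1 / 3) ^ j / 3 / (z - (j + 1 / 2)) ^ 2)) z := fun j z hz => by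
    have hne : z - (j + 1 / 2) ≠ 0 := norm_pos_iff.1 (lt_of_lt_of_le (by norm_num)
      (re_le_norm_sub_half hz j))
    have h1 := (((hasDerivAt_id z).sub_const ((j : ℂ) + 1 / 2)).inv hne).const_mul ((-1 / 3 : ℂ) ^ j / 3)
    refine h1.congr_deriv ?_
    simp only [id]
    ring
  have hsum : Summable fun j : ℕ => 8 / 3 * (1 / 3 : ℝ) ^ j :=
    (summable_geometric_of_lt_one (by norm_num) (by norm_num)).mul_left _
  have hF : ∀ j : ℕ, DifferentiableOn ℂ (fun z : ℂ => (-1 / 3 : ℂ) ^ j / 3 * (z - (j + 1 / 2))⁻¹)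
      {z : ℂ | z.re < 3 / 8} := fun j z hz => (hd j z hz).differentiableAt.differentiableWithinAt
  have h1 := Complex.differentiableOn_tsum_of_summable_norm hsum hF hU
    (fun j z hz => norm_poleTerm_le hz j)
  have h2 := Complex.hasSum_deriv_of_summable_norm hsum hF hU
    (fun j z hz => norm_poleTerm_le hz j) h
  have h3 := (h1.differentiableAt (hU.mem_nhds h)).hasDerivAt
  rw [← h2.tsum_eq, tsum_congr fun j => (hd j x h).deriv] at h3
  exact h3

/-- The term j = 0 at x + 1 gives the inhomogeneity; reindexing the others reproduces the series at
x with factor −1/3. -/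
theorem poleSum_add_one {x : ℂ} (h : x.re + 1 < 3 / 8) :
    3 * poleSum (x + 1) = 1 / (x + 1 / 2) - poleSum x := by
  have hs := summable_poleTerm (x := x + 1) (by simpa using h)
  rw [poleSum, hs.tsum_eq_zero_add, poleSum, mul_add, ← tsum_mul_left,
    sub_eq_add_neg (1 / (x + 1 / 2)), ← tsum_neg]
  congr 1
  · rw [show x + 1 - (((0 : ℕ) : ℂ) + 1 / 2) = x + 1 / 2 by push_cast; ring]
    simp
  · refine tsum_congr fun j => ?_
    rw [show x + 1 - (((j + 1 : ℕ) : ℂ) + 1 / 2) = x - (j + 1 / 2) by push_cast; ring]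
    ring

/-- The weighted combination of terms at x + 1 and x telescopes through Φ below, and the right-hand
side is the boundary value Φ 0. -/
theorem deformSum_add_one {x : ℂ} (hx : x.re = -(3 / 4)) :
    3 * (x + 1) / (x + 3 / 2) * deformSum (x + 1) + x / (x + 1 / 2) * deformSum x =
      9 / (x + 1 / 2) := by
  have n0 : ∀ m : ℕ, (m : ℂ) - x ≠ 0 := natCast_sub_ne_zero_of_re (k := -3) (by rw [hx]; norm_num)
    (by norm_num)
  have ne : ∀ {z : ℂ}, z.re ≠ 0 → z ≠ 0 := fun h h0 => h (by rw [h0, Complex.zero_re])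
  have n1 : x + 1 ≠ 0 := ne (by norm_num [hx])
  have n2 : x + 1 / 2 ≠ 0 := ne (by norm_num [hx])
  have n3 : x + 3 / 2 ≠ 0 := ne (by norm_num [hx])
  have n4 : 1 / 2 - x ≠ 0 := ne (by norm_num [hx])
  have n8 : x ≠ 0 := ne (by norm_num [hx])
  have r1 : -(7 / 8) < x.re := by rw [hx]; norm_num
  have r2 : x.re < 3 / 8 := by rw [hx]; norm_num
  have hs0 := summable_deformTerm r1 r2
  have hs1 := summable_deformTerm (x := x + 1) (by norm_num [hx]) (by norm_num [hx])
  set Φ : ℕ → ℂ := fun N => 4 * x / (x + 1 / 2) * ((N + 1 / 2 - x) * (2 * N + 3 / 2 + x) /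
    (N - x) * deformCore x N) with hΦ
  have hstep : ∀ N : ℕ, 3 * (x + 1) / (x + 3 / 2) * ((5 * (N : ℂ) + 4 + (x + 1)) *
      deformCore (x + 1) N) + x / (x + 1 / 2) * ((5 * (N : ℂ) + 4 + x) * deformCore x N) =
      Φ N - Φ (N + 1) := fun N => by
    have hN : (0 : ℝ) ≤ N := Nat.cast_nonneg N
    have k1 := n0 N
    have k2 := n0 (N + 1)
    have k3 : -x + ((N : ℂ) + 3 / 2) ≠ 0 := ne (by norm_num [hx]; linarith)
    have k4 : x + (2 * (N : ℂ) + 1 + 3 / 2) ≠ 0 := ne (by norm_num [hx]; linarith)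
    have k5 : x + (2 * (N : ℂ) + 2 + 3 / 2) ≠ 0 := ne (by norm_num [hx]; linarith)
    simp only [hΦ]
    rw [deformCore_add_one hx, deformCore_succ r1 r2]
    generalize deformCore x N = q
    push_cast at k2 ⊢
    rw [show (N : ℂ) + 1 + 1 / 2 - x = -x + (N + 3 / 2) by ring,
      show 2 * ((N : ℂ) + 1) + 3 / 2 + x = x + (2 * N + 2 + 3 / 2) by ring,
      show x + (2 * (N : ℂ) + 5 / 2) = x + (2 * N + 1 + 3 / 2) by ring,
      show ((N : ℂ) + 1) ^ 2 - x ^ 2 = (N + 1 - x) * (N + 1 + x) by ring]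
    have hlhs : 3 * (x + 1) / (x + 3 / 2) * ((5 * (N : ℂ) + 4 + (x + 1)) *
        (x * (x + N + 1) * (N + 1 / 2 - x) * (x + 3 / 2) /
          ((x + 1) * (N - x) * (x + 1 / 2) * (x + (2 * N + 1 + 3 / 2))) * q)) =
        x / (x + 1 / 2) * q * (3 * (5 * (N : ℂ) + 4 + (x + 1)) * (x + N + 1) * (N + 1 / 2 - x) /
          ((N - x) * (x + (2 * N + 1 + 3 / 2)))) := by
      generalize x + 1 / 2 = d at *
      generalize x + 3 / 2 = e at *
      generalize (N : ℂ) - x = g at *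
      generalize x + (2 * (N : ℂ) + 1 + 3 / 2) = a at *
      field_simp
    have hrhs : 4 * x / (x + 1 / 2) * ((-x + ((N : ℂ) + 3 / 2)) * (x + (2 * N + 2 + 3 / 2)) /
        (N + 1 - x) * (-9 / 4 * (N + 1) * ((N + 1 - x) * (N + 1 + x)) /
        ((-x + (N + 3 / 2)) * (x + (2 * N + 1 + 3 / 2)) * (x + (2 * N + 2 + 3 / 2))) * q)) =
        x / (x + 1 / 2) * q * (-9 * (N + 1) * (N + 1 + x) / (x + (2 * N + 1 + 3 / 2))) := by
      generalize x + 1 / 2 = d at *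
      generalize (N : ℂ) + 1 - x = g at *
      generalize x + (2 * (N : ℂ) + 1 + 3 / 2) = a at *
      generalize x + (2 * (N : ℂ) + 2 + 3 / 2) = b at *
      generalize -x + ((N : ℂ) + 3 / 2) = c at *
      field_simp
    rw [hlhs, hrhs]
    have hmain : 3 * (5 * (N : ℂ) + 4 + (x + 1)) * (x + N + 1) * (N + 1 / 2 - x) /
        ((N - x) * (x + (2 * N + 1 + 3 / 2))) + (5 * N + 4 + x) =
        4 * ((N + 1 / 2 - x) * (2 * N + 3 / 2 + x) / (N - x)) -
          -9 * (N + 1) * (N + 1 + x) / (x + (2 * N + 1 + 3 / 2)) := by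
      rw [div_add' _ _ _ (mul_ne_zero k1 k4), mul_div_assoc', div_sub_div _ _ k1 k4,
        div_eq_div_iff (mul_ne_zero k1 k4) (mul_ne_zero k1 k4)]
      ring
    linear_combination x / (x + 1 / 2) * q * hmain
  have hlim : Tendsto Φ atTop (𝓝 0) := by
    have hz : Tendsto (fun N : ℕ => ‖4 * x / (x + 1 / 2)‖ * ((4 * (1 + ‖x‖) ^ 2) *
        (((N : ℝ) + 1) ^ 2 * (30 * ((2 * N + 1) * (9 / 16) ^ N))))) atTop (𝓝 0) := by
      have h := (summable_polynomial_mul_of_ratio (q := 9 / 16) (u := fun n => (9 / 16) ^ n)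
        (by norm_num) (by norm_num) (fun n => by
          rw [abs_of_nonneg (by positivity), abs_of_nonneg (by positivity), pow_succ, mul_comm])
        ((Polynomial.X + 1) ^ 2 * (30 * (2 * Polynomial.X + 1)))).tendsto_atTop_zero
      have h' := (h.const_mul (4 * (1 + ‖x‖) ^ 2)).const_mul ‖4 * x / (x + 1 / 2)‖
      simp only [mul_zero] at h'
      refine h'.congr fun n => ?_
      simp only [Polynomial.eval_mul, Polynomial.eval_pow, Polynomial.eval_add, Polynomial.eval_X,
        Polynomial.eval_one, Polynomial.eval_ofNat]
      ring
    refine squeeze_zero_norm (fun N => ?_) hz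
    simp only [hΦ]
    rw [norm_mul, norm_mul]
    have hN : (0 : ℝ) ≤ N := Nat.cast_nonneg N
    have hxn := norm_nonneg x
    have hNx := mul_nonneg hN hxn
    have b1 : ‖(N : ℂ) + 1 / 2 - x‖ ≤ (N + 1) * (1 + ‖x‖) := by
      refine (norm_sub_le _ _).trans ((add_le_add_left (norm_add_le _ _) _).trans ?_)
      rw [Complex.norm_natCast]
      norm_num
      nlinarith
    have b2 : ‖2 * (N : ℂ) + 3 / 2 + x‖ ≤ 2 * ((N + 1) * (1 + ‖x‖)) := by
      refine (norm_add_le _ _).trans ((add_le_add_left (norm_add_le _ _) _).trans ?_)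
      rw [norm_mul, Complex.norm_natCast]
      norm_num
      nlinarith
    have b3 : 1 / 2 ≤ ‖(N : ℂ) - x‖ := one_half_le_norm_natCast_sub (by rw [hx]; linarith)
    have b4 : ‖(N : ℂ) + 1 / 2 - x‖ * ‖2 * (N : ℂ) + 3 / 2 + x‖ / ‖(N : ℂ) - x‖ ≤
        (4 * (1 + ‖x‖) ^ 2) * ((N : ℝ) + 1) ^ 2 := by
      rw [div_le_iff₀ (by linarith)]
      calc _ ≤ ((N + 1) * (1 + ‖x‖)) * (2 * ((N + 1) * (1 + ‖x‖))) :=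
            mul_le_mul b1 b2 (norm_nonneg _) (by positivity)
        _ = (4 * (1 + ‖x‖) ^ 2) * ((N : ℝ) + 1) ^ 2 * (1 / 2) := by ring
        _ ≤ _ := by gcongr
    refine mul_le_mul_of_nonneg_left ?_ (norm_nonneg _)
    rw [← mul_assoc, norm_div, norm_mul]
    exact mul_le_mul b4 (norm_deformCore_le r1 r2 N) (norm_nonneg _) (by positivity)
  have hsum := ((hs1.mul_left (3 * (x + 1) / (x + 3 / 2))).add
    (hs0.mul_left (x / (x + 1 / 2)))).hasSum.tendsto_sum_nat
  simp only [hstep, Finset.sum_range_sub'] at hsum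
  have h0 := tendsto_nhds_unique hsum (hlim.const_sub (Φ 0))
  rw [sub_zero] at h0
  rw [deformSum, deformSum, ← tsum_mul_left, ← tsum_mul_left, ← (hs1.mul_left _).tsum_add
    (hs0.mul_left _), tsum_congr hstep, h0]
  simp only [hΦ, deformCore, sqProd_zero]
  have : halfProd x (2 * 0 + 1) = x + 3 / 2 := by simp [halfProd]
  rw [this, show halfProd (-x) 0 = 1 by simp [halfProd]]
  push_cast
  rw [show (2 : ℂ) * 0 + 3 / 2 + x = x + 3 / 2 by ring, show (0 : ℂ) + 1 / 2 - x = 1 / 2 - x by ring]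
  generalize x + 1 / 2 = d at *
  generalize x + 3 / 2 = e at *
  generalize (1 : ℂ) / 2 - x = c at *
  simp only [zero_sub, Nat.factorial_zero]
  field_simp
  norm_num

theorem norm_cos_le_exp_abs_im (z : ℂ) : ‖Complex.cos z‖ ≤ Real.exp |z.im| := by
  have h1 : ‖Complex.exp (z * Complex.I)‖ ≤ Real.exp |z.im| := by
    rw [Complex.norm_exp]
    refine Real.exp_le_exp.2 ?_
    simpa using neg_le_abs z.im
  have h2 : ‖Complex.exp (-z * Complex.I)‖ ≤ Real.exp |z.im| := by
    rw [Complex.norm_exp]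
    refine Real.exp_le_exp.2 ?_
    simpa using le_abs_self z.im
  rw [Complex.cos, norm_div, Complex.norm_ofNat]
  have := norm_add_le (Complex.exp (z * Complex.I)) (Complex.exp (-z * Complex.I))
  linarith

/-- Let T and L denote `deformSum` and `poleSum`. Their difference equations show that R(z)/(z +
1/2) = zT/(z + 1/2) − 9L is multiplied by −1/3 under z ↦ z + 1, and 3^z cos πz by −3. The product f
is therefore periodic, hence constant by its growth, and f'(0) = 0 reads 2T(0) − 9L'(0) − 9 L(0) log
3 = 0. -/
theorem two_mul_deformSum_zero : 2 * deformSum 0 = 9 * (Complex.log 3 * poleSum 0 +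
    ∑' j : ℕ, -((-1 / 3) ^ j / 3 / ((0 : ℂ) - (j + 1 / 2)) ^ 2)) := by
  -- The point z = −1/2 lies inside the strip; `dslope` divides cos πz by z + 1/2 with the removable
  -- singularity filled in.
  set D : ℂ → ℂ := dslope (fun z => Complex.cos (π * z)) (-1 / 2) with hD
  set E : ℂ → ℂ := fun z => Complex.exp (Complex.log 3 * z) with hE
  set R : ℂ → ℂ := fun z => z * deformSum z - 9 * (z + 1 / 2) * poleSum z with hR
  set f : ℂ → ℂ := fun z => D z * E z * R z with hf
  have hcos0 : Complex.cos (π * (-1 / 2)) = 0 := by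
    rw [show (π : ℂ) * (-1 / 2) = -(π / 2) by ring, Complex.cos_neg, Complex.cos_pi_div_two]
  have hDne : ∀ z, z ≠ -1 / 2 → D z = Complex.cos (π * z) / (z + 1 / 2) := fun z hz => by
    rw [hD, dslope_of_ne _ hz, slope_def_field, hcos0, sub_zero]
    congr 1
    ring
  have hDd : Differentiable ℂ D := fun z => by
    have h : DifferentiableOn ℂ (fun z : ℂ => Complex.cos (π * z)) Set.univ :=
      (by fun_prop : Differentiable ℂ fun z : ℂ => Complex.cos (π * z)).differentiableOn
    exact ((Complex.differentiableOn_dslope univ_mem).2 h).differentiableAt univ_mem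
  have hRd : ∀ z : ℂ, -(7 / 8) < z.re → z.re < 3 / 8 → DifferentiableAt ℂ R z := fun z h1 h2 =>
    (differentiableAt_id.mul (differentiableAt_deformSum h1 h2)).sub
      (DifferentiableAt.mul (by fun_prop) (hasDerivAt_poleSum h2).differentiableAt)
  have hfd : ∀ z : ℂ, -(7 / 8) < z.re → z.re < 3 / 8 → DifferentiableAt ℂ f z := fun z h1 h2 =>
    ((hDd z).mul (by simp only [hE]; fun_prop)).mul (hRd z h1 h2)
  have hstrip : ∀ z : ℂ, z.re ∈ Set.Icc (-(3 / 4) : ℝ) (-(3 / 4) + 1) →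
      -(7 / 8) < z.re ∧ z.re < 3 / 8 := fun z hz => ⟨by linarith [hz.1], by linarith [hz.2]⟩
  have hper : ∀ x : ℂ, x.re = -(3 / 4) → f (x + 1) = f x := fun x hx => by
    have ne : ∀ {z : ℂ}, z.re ≠ 0 → z ≠ 0 := fun h h0 => h (by rw [h0, Complex.zero_re])
    have n2 : x + 1 / 2 ≠ 0 := ne (by norm_num [hx])
    have n3 : x + 3 / 2 ≠ 0 := ne (by norm_num [hx])
    have hE1 : E (x + 1) = 3 * E x := by
      simp only [hE]
      rw [mul_add, mul_one, Complex.exp_add, Complex.exp_log three_ne_zero, mul_comm]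
    have hp := poleSum_add_one (x := x) (by rw [hx]; norm_num)
    have hd := deformSum_add_one hx
    simp only [hf]
    rw [hDne x fun h => n2 (by rw [h]; ring),
      hDne (x + 1) fun h => n3 (by linear_combination h), hE1,
      show (π : ℂ) * (x + 1) = π * x + π by ring, Complex.cos_add_pi,
      show x + 1 + 1 / 2 = x + 3 / 2 by ring]
    have hR1 : 3 * R (x + 1) / (x + 3 / 2) + R x / (x + 1 / 2) = 0 := by
      have e1 : 3 * R (x + 1) / (x + 3 / 2) = 3 * (x + 1) / (x + 3 / 2) * deformSum (x + 1) -
          9 * (3 * poleSum (x + 1)) := by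
        simp only [hR]
        rw [show x + 1 + 1 / 2 = x + 3 / 2 by ring]
        generalize x + 3 / 2 = d at *
        field_simp
      have e2 : R x / (x + 1 / 2) = x / (x + 1 / 2) * deformSum x - 9 * poleSum x := by
        simp only [hR]
        generalize x + 1 / 2 = d at *
        field_simp
      rw [e1, e2, hp]
      linear_combination hd
    linear_combination -Complex.cos (π * x) * E x * hR1
  have hE_le : ∀ z : ℂ, z.re ≤ 1 → ‖E z‖ ≤ 3 := fun z hz => by
    simp only [hE]
    have h3 : Complex.log 3 = (Real.log 3 : ℂ) := by
      rw [show (3 : ℂ) = ((3 : ℝ) : ℂ) by norm_num, Complex.ofReal_log (by norm_num)]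
    rw [h3, Complex.norm_exp, Complex.re_ofReal_mul]
    calc _ ≤ Real.exp (Real.log 3 * 1) := by
          have : 0 ≤ Real.log 3 := Real.log_nonneg (by norm_num)
          gcongr
      _ = 3 := by rw [mul_one, Real.exp_log (by norm_num)]
  set S := ∑' N : ℕ, (5 * (N : ℝ) + 4) * (30 * ((2 * N + 1) * (9 / 16) ^ N)) with hS
  have hS0 : 0 ≤ S := tsum_nonneg fun N => by positivity
  -- The cosine contributes e^{π|y|} and the rest is polynomial, so M = 1 leaves only the constant
  -- frequency. In g, the 3 bounds 3^z on the strip and 36 = 9 · 4 comes from the pole sum.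
  obtain ⟨k, hk⟩ := exists_eq_sum_exp_of_growth (f := f) (a := -(3 / 4)) (M := 1)
    (g := fun y => Real.exp (π * y) * 3 * ((S + 36) * (y + 3) ^ 2))
    (fun z hz => hfd z (hstrip z hz).1 (hstrip z hz).2)
    (fun y => by
      have h := hper (((-(3 / 4) : ℝ) : ℂ) + y * Complex.I) (by simp)
      rw [← h, show ((-(3 / 4) + 1 : ℝ) : ℂ) + y * Complex.I =
        ((-(3 / 4) : ℝ) : ℂ) + y * Complex.I + 1 by push_cast; ring])
    (fun z hz hy => by
      have hs := hstrip z hz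
      have hzn : ‖z‖ ≤ |z.im| + 1 := by
        refine (Complex.norm_le_abs_re_add_abs_im z).trans ?_
        have : |z.re| ≤ 1 := abs_le.2 ⟨by linarith [hz.1], by linarith [hz.2]⟩
        linarith
      have hz2 : 1 ≤ ‖z + 1 / 2‖ := by
        refine hy.trans ?_
        have := Complex.abs_im_le_norm (z + 1 / 2)
        norm_num at this ⊢
        exact this
      have hDz : ‖D z‖ ≤ Real.exp (π * |z.im|) := by
        rw [hDne z fun h => by
          rw [h] at hy
          norm_num at hy, norm_div]
        refine (div_le_self (norm_nonneg _) hz2).trans ((norm_cos_le_exp_abs_im _).trans_eq ?_)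
        rw [Complex.im_ofReal_mul, abs_mul, abs_of_pos Real.pi_pos]
      have hRz : ‖R z‖ ≤ (S + 36) * (|z.im| + 3) ^ 2 := by
        have h1 := norm_deformSum_le hs.1 hs.2
        have h2 := norm_poleSum_le hs.2
        have h3 : ‖9 * (z + 1 / 2)‖ ≤ 9 * (|z.im| + 3) := by
          rw [norm_mul, Complex.norm_ofNat]
          have := norm_add_le z (1 / 2)
          norm_num at this ⊢
          linarith
        simp only [hR]
        refine (norm_sub_le _ _).trans ?_
        rw [norm_mul, norm_mul _ (poleSum z)]
        have hy3 : 1 ≤ |z.im| + 3 := by linarith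
        have h4 : ‖deformSum z‖ ≤ S * (|z.im| + 3) :=
          h1.trans (mul_le_mul_of_nonneg_left (by linarith) hS0)
        calc _ ≤ (|z.im| + 3) * (S * (|z.im| + 3)) + 9 * (|z.im| + 3) * 4 :=
              add_le_add (mul_le_mul (by linarith) h4 (norm_nonneg _) (by positivity))
                (mul_le_mul h3 h2 (norm_nonneg _) (by positivity))
          _ ≤ (|z.im| + 3) * (S * (|z.im| + 3)) + 9 * (|z.im| + 3) * 4 * (|z.im| + 3) :=
              add_le_add le_rfl (le_mul_of_one_le_right (by positivity) hy3)
          _ = _ := by ring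
      have hEz := hE_le z (by linarith [hz.2])
      simp only [hf]
      rw [norm_mul, norm_mul]
      gcongr) (by
      have h := ((Real.tendsto_pow_mul_exp_neg_atTop_nhds_zero 2).comp
        (tendsto_atTop_add_const_right atTop (3 : ℝ) tendsto_id)).const_mul (3 * (S + 36) * Real.exp 3)
      simp only [mul_zero] at h
      refine squeeze_zero' ((eventually_ge_atTop 0).mono fun y hy => by positivity)
        ((eventually_ge_atTop 0).mono fun y hy => ?_) h
      simp only [Function.comp, id]
      have h2 : Real.exp (π * y) * Real.exp (-(2 * π * (1 : ℕ) * y)) ≤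
          Real.exp 3 * Real.exp (-(y + 3)) := by
        rw [← Real.exp_add, ← Real.exp_add]
        refine Real.exp_le_exp.2 ?_
        push_cast
        nlinarith [Real.pi_gt_three]
      calc _ = 3 * (S + 36) * (y + 3) ^ 2 *
            (Real.exp (π * y) * Real.exp (-(2 * π * (1 : ℕ) * y))) := by ring
        _ ≤ 3 * (S + 36) * (y + 3) ^ 2 * (Real.exp 3 * Real.exp (-(y + 3))) := by gcongr
        _ = _ := by ring)
  have hconst : ∀ᶠ t : ℝ in 𝓝 0, f t = k 0 := by
    have hIco : Set.Ico (-(3 / 4) : ℝ) (-(3 / 4) + 1) ∈ 𝓝 (0 : ℝ) :=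
      Ico_mem_nhds (by norm_num) (by norm_num)
    filter_upwards [hIco] with t ht
    have hIoo : Finset.Ioo (-(1 : ℕ) : ℤ) (1 : ℕ) = {0} := by decide
    rw [hk t ht, hIoo, Finset.sum_singleton]
    simp
  have hT := (differentiableAt_deformSum (x := 0) (by norm_num) (by norm_num)).hasDerivAt
  have hL := hasDerivAt_poleSum (x := 0) (by norm_num)
  generalize (∑' j : ℕ, -((-1 / 3 : ℂ) ^ j / 3 / ((0 : ℂ) - (j + 1 / 2)) ^ 2)) = X at hL ⊢
  have hz : HasDerivAt (fun z : ℂ => z + 1 / 2) 1 0 := (hasDerivAt_id (0 : ℂ)).add_const _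
  have hEd : HasDerivAt E (Complex.log 3) 0 := by
    have h := ((hasDerivAt_id (0 : ℂ)).const_mul (Complex.log 3)).cexp
    simpa using h
  have hC : HasDerivAt (fun z : ℂ => Complex.cos (π * z)) 0 0 := by
    have h := ((hasDerivAt_id (0 : ℂ)).const_mul (π : ℂ)).ccos
    simpa using h
  have hQ := (((hasDerivAt_id (0 : ℂ)).mul hT).div hz (by norm_num)).sub (hL.const_mul 9)
  have hF := (hC.mul hEd).mul hQ
  have hfeq : (fun t : ℝ => f t) =ᶠ[𝓝 0] fun _ => k 0 := hconst
  have hFeq : f =ᶠ[𝓝 0] fun z => Complex.cos (π * z) * E z *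
      (z * deformSum z / (z + 1 / 2) - 9 * poleSum z) := by
    have hne : ∀ᶠ z : ℂ in 𝓝 0, z ≠ -1 / 2 := isOpen_ne.mem_nhds (by norm_num)
    filter_upwards [hne] with z hz
    have hz' : z + 1 / 2 ≠ 0 := fun h => hz (by linear_combination h)
    simp only [hf, hR]
    rw [hDne z hz]
    generalize z + 1 / 2 = d at *
    field_simp
  -- Constancy is known on real points only, so the complex derivative is compared along the real
  -- axis.
  have h0 := ((hF.congr_of_eventuallyEq hFeq).comp_ofReal (z := 0)).unique
    ((hasDerivAt_const (0 : ℝ) (k 0)).congr_of_eventuallyEq hfeq)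
  simp only [id, mul_zero, Complex.cos_zero, zero_mul, zero_add, one_mul, mul_one, hE,
    Complex.exp_zero, Pi.mul_apply, sub_zero] at h0
  norm_num at h0
  linear_combination h0

/-! ### The Legendre chi function and Ti₂(1/√3) -/

/-- The Legendre chi function of order two. -/
noncomputable def legendreChi (x : ℂ) : ℂ := ∑' k : ℕ, x ^ (2 * k + 1) / (2 * (k : ℂ) + 1) ^ 2

theorem summable_inv_odd_sq : Summable fun k : ℕ => 1 / (2 * (k : ℝ) + 1) ^ 2 := by
  refine ((summable_inv_sq_add (by norm_num : (0 : ℝ) < 1 / 2)).mul_left (1 / 4)).congr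
    fun k => ?_
  have : (k : ℝ) + 1 / 2 ≠ 0 := by positivity
  field_simp
  ring

theorem norm_two_mul_add_one (k : ℕ) : ‖2 * (k : ℂ) + 1‖ = 2 * (k : ℝ) + 1 := by
  exact_mod_cast Complex.norm_natCast (2 * k + 1)

theorem norm_legendreChi_term_le {x : ℂ} (hx : ‖x‖ ≤ 1) (k : ℕ) :
    ‖x ^ (2 * k + 1) / (2 * (k : ℂ) + 1) ^ 2‖ ≤ 1 / (2 * (k : ℝ) + 1) ^ 2 := by
  rw [norm_div, norm_pow, norm_pow, norm_two_mul_add_one]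
  gcongr
  exact pow_le_one₀ (norm_nonneg _) hx

theorem hasSum_legendreChi {x : ℂ} (hx : ‖x‖ ≤ 1) :
    HasSum (fun k : ℕ => x ^ (2 * k + 1) / (2 * (k : ℂ) + 1) ^ 2) (legendreChi x) :=
  (Summable.of_norm_bounded summable_inv_odd_sq (norm_legendreChi_term_le hx)).hasSum

theorem continuousOn_legendreChi : ContinuousOn legendreChi (Metric.closedBall 0 1) :=
  continuousOn_tsum (fun k => by fun_prop) summable_inv_odd_sq
    fun k x hx => norm_legendreChi_term_le (by simpa using hx) k

/-- This is the arctangent series at −ix, multiplied by i. -/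
theorem hasSum_artanh {x : ℂ} (hx : ‖x‖ < 1) :
    HasSum (fun k : ℕ => x ^ (2 * k + 1) / (2 * (k : ℂ) + 1))
      (Complex.log ((1 + x) / (1 - x)) / 2) := by
  have h := (Complex.hasSum_arctan (z := -Complex.I * x) (by simpa using hx)).mul_left Complex.I
  rw [Complex.arctan, show -Complex.I * x * Complex.I = x by
    linear_combination -x * Complex.I_sq] at h
  have e : Complex.I * (-Complex.I / 2 * Complex.log ((1 + x) / (1 - x))) =
      Complex.log ((1 + x) / (1 - x)) / 2 := by
    linear_combination -(Complex.log ((1 + x) / (1 - x)) / 2) * Complex.I_sq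
  rw [e] at h
  refine h.congr_fun fun k => ?_
  have hI : (-Complex.I * x) ^ (2 * k + 1) = -Complex.I * (-1) ^ k * x ^ (2 * k + 1) := by
    rw [mul_pow, pow_succ (-Complex.I), pow_mul, neg_sq, Complex.I_sq]
    ring
  have h1 : ((-1 : ℂ) ^ k) * (-1) ^ k = 1 := by rw [← mul_pow]; norm_num
  rw [hI]
  push_cast
  linear_combination (x ^ (2 * k + 1) / (2 * (k : ℂ) + 1)) * ((-1) ^ k * (-1) ^ k * Complex.I_sq - h1)

theorem one_add_ne_zero_of_norm_lt {x : ℂ} (hx : ‖x‖ < 1) : 1 + x ≠ 0 := fun h => by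
  rw [show x = -1 by linear_combination h] at hx
  norm_num at hx

theorem re_one_sub_div_one_add_pos {x : ℂ} (hx : ‖x‖ < 1) : 0 < ((1 - x) / (1 + x)).re := by
  have h0 := Complex.normSq_pos.2 (one_add_ne_zero_of_norm_lt hx)
  have h1 : x.re * x.re + x.im * x.im < 1 := by
    rw [← Complex.normSq_apply, Complex.normSq_eq_norm_sq]
    exact pow_lt_one₀ (norm_nonneg _) hx (by norm_num)
  rw [Complex.div_re, ← add_div]
  refine div_pos ?_ h0
  simp
  linarith

theorem norm_one_sub_div_one_add_lt {x : ℂ} (hx : 0 < x.re) : ‖(1 - x) / (1 + x)‖ < 1 := by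
  have h0 : 0 < ‖1 + x‖ := norm_pos_iff.2 fun h => by
    have := congrArg Complex.re h
    simp at this
    linarith
  rw [norm_div, div_lt_one h0]
  refine lt_of_pow_lt_pow_left₀ 2 h0.le ?_
  rw [← Complex.normSq_eq_norm_sq, ← Complex.normSq_eq_norm_sq, Complex.normSq_apply,
    Complex.normSq_apply]
  simp
  linarith

theorem hasDerivAt_legendreChi {x : ℂ} (hx : ‖x‖ < 1) (hx0 : x ≠ 0) :
    HasDerivAt legendreChi (-Complex.log ((1 - x) / (1 + x)) / (2 * x)) x := by
  have hd : ∀ (k : ℕ) (w : ℂ), HasDerivAt (fun x : ℂ => x ^ (2 * k + 1) / (2 * (k : ℂ) + 1) ^ 2)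
      (w ^ (2 * k) / (2 * (k : ℂ) + 1)) w := fun k w => by
    have h := (hasDerivAt_pow (2 * k + 1) w).div_const ((2 * (k : ℂ) + 1) ^ 2)
    have hk : 2 * (k : ℂ) + 1 ≠ 0 := by exact_mod_cast (by omega : 2 * k + 1 ≠ 0)
    refine h.congr_deriv ?_
    push_cast
    generalize 2 * (k : ℂ) + 1 = a at *
    field_simp
  have hF : ∀ (k : ℕ) (w : ℂ), w ∈ Metric.ball (0 : ℂ) 1 →
      ‖w ^ (2 * k + 1) / (2 * (k : ℂ) + 1) ^ 2‖ ≤ 1 / (2 * (k : ℝ) + 1) ^ 2 := fun k w hw =>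
    norm_legendreChi_term_le (by simpa using (Metric.mem_ball.1 hw).le) k
  have hfd : ∀ k : ℕ, DifferentiableOn ℂ (fun x : ℂ => x ^ (2 * k + 1) / (2 * (k : ℂ) + 1) ^ 2)
      (Metric.ball 0 1) := fun k w _ => (hd k w).differentiableAt.differentiableWithinAt
  have hmem : x ∈ Metric.ball (0 : ℂ) 1 := by simpa using hx
  have h1 := Complex.hasSum_deriv_of_summable_norm summable_inv_odd_sq hfd Metric.isOpen_ball hF
    hmem
  have h2 := (Complex.differentiableOn_tsum_of_summable_norm summable_inv_odd_sq hfd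
    Metric.isOpen_ball hF).differentiableAt (Metric.isOpen_ball.mem_nhds hmem)
  have h3 := ((hasSum_artanh hx).div_const x).unique (h1.congr_fun fun k => by
    rw [(hd k x).deriv, pow_succ, div_right_comm, mul_div_cancel_right₀ _ hx0])
  have h4 : Complex.log ((1 + x) / (1 - x)) = -Complex.log ((1 - x) / (1 + x)) := by
    rw [← inv_div (1 - x), Complex.log_inv]
    exact (Complex.mem_slitPlane_iff_arg.1 (Or.inl (re_one_sub_div_one_add_pos hx))).1
  have h5 := h2.hasDerivAt
  rw [← h3, h4, div_div] at h5
  exact h5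

/-- The sum `χ₂(x) + χ₂((1 - x) / (1 + x)) + log x log ((1 - x) / (1 + x)) / 2`, constant on the
right half of the unit disc. -/
noncomputable def chiPair (x : ℂ) : ℂ := legendreChi x + legendreChi ((1 - x) / (1 + x)) +
  Complex.log x * Complex.log ((1 - x) / (1 + x)) / 2

/-- The map x ↦ (1−x)/(1+x) is an involution, so the derivative of each chi term cancels against the
product-rule term of the logarithms that differentiates the same argument's logarithm. -/
theorem hasDerivAt_chiPair {x : ℂ} (hx : ‖x‖ < 1) (hx0 : 0 < x.re) : HasDerivAt chiPair 0 x := by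
  have n0 : x ≠ 0 := fun h => by simp [h] at hx0
  have n1 := one_add_ne_zero_of_norm_lt hx
  have n2 : 1 - x ≠ 0 := fun h => by
    rw [show x = 1 by linear_combination -h] at hx
    norm_num at hx
  have hy : HasDerivAt (fun x : ℂ => (1 - x) / (1 + x)) (-2 / (1 + x) ^ 2) x := by
    refine (((hasDerivAt_id x).const_sub 1).div ((hasDerivAt_id x).const_add 1) n1).congr_deriv ?_
    simp only [id]
    ring
  have hyn := norm_one_sub_div_one_add_lt hx0
  have hyr := re_one_sub_div_one_add_pos hx
  have hy0 : (1 - x) / (1 + x) ≠ 0 := div_ne_zero n2 n1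
  have e : (1 - (1 - x) / (1 + x)) / (1 + (1 - x) / (1 + x)) = x := by
    have : 1 + (1 - x) / (1 + x) ≠ 0 := one_add_ne_zero_of_norm_lt hyn
    rw [div_eq_iff this]
    field_simp
    ring
  have h1 := hasDerivAt_legendreChi hx n0
  have h2 := hasDerivAt_legendreChi hyn hy0
  rw [e] at h2
  have h := (h1.add (HasDerivAt.comp x h2 hy)).add
    (((Complex.hasDerivAt_log (Or.inl hx0)).mul (hy.clog (Or.inl hyr))).div_const 2)
  refine h.congr_deriv ?_
  generalize Complex.log ((1 - x) / (1 + x)) = u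
  generalize Complex.log x = v
  field_simp
  ring

/-- The function is constant on a connected set and real at x = 1/2, whose image under the
involution is 1/3. Only the imaginary part is needed later, so the constant itself is never
computed. -/
theorem chiPair_im_eq_zero {x : ℂ} (hx : ‖x‖ < 1) (hx0 : 0 < x.re) : (chiPair x).im = 0 := by
  have ho : IsOpen {z : ℂ | 0 < z.re} := isOpen_lt continuous_const Complex.continuous_re
  have hc : Convex ℝ {z : ℂ | 0 < z.re} := convex_halfSpace_re_gt 0
  obtain ⟨a, ha⟩ := (Metric.isOpen_ball.inter ho).exists_is_const_of_deriv_eq_zero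
    (f := chiPair) ((convex_ball (0 : ℂ) 1).inter hc).isPreconnected
    (fun z hz => (hasDerivAt_chiPair (by simpa using hz.1) hz.2).differentiableAt.differentiableWithinAt)
    (fun z hz => (hasDerivAt_chiPair (by simpa using hz.1) hz.2).deriv)
  have hchi : ∀ t : ℝ, legendreChi t = ((∑' k : ℕ, t ^ (2 * k + 1) / (2 * (k : ℝ) + 1) ^ 2 : ℝ) : ℂ) :=
    fun t => by
      rw [legendreChi, Complex.ofReal_tsum]
      push_cast
      rfl
  rw [ha x ⟨by simpa using hx, hx0⟩, ← ha ((1 / 2 : ℝ) : ℂ) ⟨by norm_num, by norm_num⟩, chiPair,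
    show (1 - ((1 / 2 : ℝ) : ℂ)) / (1 + ((1 / 2 : ℝ) : ℂ)) = ((1 / 3 : ℝ) : ℂ) by
      push_cast
      norm_num, hchi, hchi, ← Complex.ofReal_log (by norm_num), ← Complex.ofReal_log (by norm_num)]
  norm_cast

theorem norm_sixth_root : ‖(1 / 2 + √3 / 2 * Complex.I : ℂ)‖ = 1 := by
  have h : (1 / 2 + √3 / 2 * Complex.I : ℂ) = ((1 / 2 : ℝ) : ℂ) + ((√3 / 2 : ℝ) : ℂ) * Complex.I := by
    push_cast
    rfl
  rw [h, Complex.norm_add_mul_I, Real.sqrt_eq_one, div_pow, div_pow, Real.sq_sqrt (by norm_num)]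
  norm_num

/-- With w = e^{iπ/3} one has w² = w − 1 and w³ = −1, so w^{2k+1} depends only on k mod 3 and is w,
−1 or 1 − w. -/
theorem sixth_root_pow_im (k : ℕ) : ((1 / 2 + √3 / 2 * Complex.I : ℂ) ^ (2 * k + 1)).im =
    √3 / 2 * (legendreSym 3 ((2 * k + 1 : ℕ) : ℤ) : ℤ) := by
  have h3 : (√3 : ℂ) ^ 2 = 3 := by
    rw [← Complex.ofReal_pow, Real.sq_sqrt (by norm_num)]
    norm_num
  set w : ℂ := 1 / 2 + √3 / 2 * Complex.I with hw
  have h2 : w ^ 2 = w - 1 := by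
    rw [hw]
    linear_combination (√3 : ℂ) ^ 2 / 4 * Complex.I_sq - 1 / 4 * h3
  have hc : w ^ 3 = -1 := by linear_combination (w + 1) * h2
  have h6 : ∀ j : ℕ, w ^ (6 * j) = 1 := fun j => by
    rw [pow_mul, show w ^ 6 = (w ^ 3) ^ 2 by ring, hc]
    norm_num
  have him : w.im = √3 / 2 := by simp [hw]
  obtain ⟨j, rfl | rfl | rfl⟩ : ∃ j, k = 3 * j ∨ k = 3 * j + 1 ∨ k = 3 * j + 2 :=
    ⟨k / 3, by omega⟩
  · rw [show 2 * (3 * j) + 1 = 3 * (2 * j) + 1 by ring, (legendreSym_three_mul_add _).2.1,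
      pow_succ, show 3 * (2 * j) = 6 * j by ring, h6, one_mul, him]
    norm_num
  · rw [show 2 * (3 * j + 1) + 1 = 3 * (2 * j + 1) by ring, (legendreSym_three_mul_add _).1,
      show 3 * (2 * j + 1) = 6 * j + 3 by ring, pow_add, h6, hc]
    norm_num
  · rw [show 2 * (3 * j + 2) + 1 = 3 * (2 * j + 1) + 2 by ring, (legendreSym_three_mul_add _).2.2,
      show 3 * (2 * j + 1) + 2 = 6 * j + 3 + 2 by ring, pow_add, pow_add, h6, hc, h2]
    simp [him]

/-- Since (2/3) = −1, the even-indexed terms of K sum to −K/4, leaving 5K/4 for the odd ones. -/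
theorem hasSum_constK_odd :
    HasSum (fun k : ℕ => ((legendreSym 3 ((2 * k + 1 : ℕ) : ℤ) : ℤ) : ℝ) / (2 * (k : ℝ) + 1) ^ 2)
      (5 / 4 * constK) := by
  obtain ⟨f, hf⟩ : ∃ f : ℕ → ℝ,
      ∀ k : ℕ, f k = ((legendreSym 3 (k : ℤ) : ℤ) : ℝ) / (k : ℝ) ^ 2 := ⟨_, fun _ => rfl⟩
  have hK : HasSum f constK := hasSum_constK_nat.congr_fun hf
  have he : ∀ k : ℕ, f (2 * k) = -(1 / 4) * f k := fun k => by
    rw [hf, hf, Nat.cast_mul, legendreSym.mul, show legendreSym 3 ((2 : ℕ) : ℤ) = -1 by decide]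
    push_cast
    ring
  have ho : Summable fun k => f (2 * k + 1) :=
    hK.summable.comp_injective (i := fun k => 2 * k + 1) fun a b h => by simpa using h
  have h := (hK.mul_left (-(1 / 4))).congr_fun he |>.even_add_odd ho.hasSum
  refine ho.hasSum.of_eq (fun k => by rw [hf]; push_cast; rfl) ?_
  have := h.unique hK
  linarith

theorem legendreChi_sixth_root_im :
    (legendreChi (1 / 2 + √3 / 2 * Complex.I)).im = 5 * √3 / 8 * constK := by
  have hn := norm_sixth_root.le
  have h := Complex.hasSum_im (hasSum_legendreChi hn)
  have h2 := hasSum_constK_odd.mul_left (√3 / 2)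
  refine (h.unique (h2.of_eq (fun k => ?_) rfl)).trans (by ring)
  rw [show (2 * (k : ℂ) + 1) ^ 2 = (((2 * (k : ℝ) + 1) ^ 2 : ℝ) : ℂ) by push_cast; ring,
    Complex.div_ofReal_im, sixth_root_pow_im]
  push_cast
  ring

theorem one_sub_div_one_add_sixth_root :
    (1 - (1 / 2 + √3 / 2 * Complex.I)) / (1 + (1 / 2 + √3 / 2 * Complex.I)) =
      (((√3)⁻¹ : ℝ) : ℂ) * -Complex.I := by
  have h3 : (√3 : ℂ) ^ 2 = 3 := by
    rw [← Complex.ofReal_pow, Real.sq_sqrt (by norm_num)]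
    norm_num
  have h0 : (√3 : ℂ) ≠ 0 := fun h => by simp [h] at h3
  have n1 : (1 : ℂ) + (1 / 2 + √3 / 2 * Complex.I) ≠ 0 := fun h => by
    have := congrArg Complex.re h
    norm_num at this
  rw [div_eq_iff n1]
  push_cast
  field_simp
  linear_combination (√3 : ℂ) * Complex.I_sq - Complex.I * h3

/-- The point lies on the unit circle, outside the open region treated above, and is reached
radially; `legendreChi` is continuous up to the boundary because its series converges uniformly
there. -/
theorem chiPair_sixth_root_im : (chiPair (1 / 2 + √3 / 2 * Complex.I)).im = 0 := by
  set w : ℂ := 1 / 2 + √3 / 2 * Complex.I with hw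
  have hwr : w.re = 1 / 2 := by simp [hw]
  have hwi : w.im = √3 / 2 := by simp [hw]
  have hwn : ‖w‖ = 1 := norm_sixth_root
  have hline : ∀ r ∈ Set.Ioo (0 : ℝ) 1, (chiPair (r * w)).im = 0 := fun r hr =>
    chiPair_im_eq_zero (by rw [norm_mul, hwn, Complex.norm_real, Real.norm_of_nonneg hr.1.le]
                           linarith [hr.2])
      (by rw [Complex.re_ofReal_mul, hwr]; linarith [hr.1])
  have hcont : ContinuousWithinAt (fun r : ℝ => chiPair (r * w)) (Set.Ioo 0 1) 1 := by
    have n1 : (1 : ℂ) + ((1 : ℝ) : ℂ) * w ≠ 0 := fun h => by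
      have := congrArg Complex.re h
      simp [hwr] at this
      norm_num at this
    have hm : ContinuousWithinAt (fun r : ℝ => (r : ℂ) * w) (Set.Ioo 0 1) 1 := by fun_prop
    have hq : ContinuousWithinAt (fun r : ℝ => (1 - (r : ℂ) * w) / (1 + (r : ℂ) * w))
        (Set.Ioo 0 1) 1 := (continuousWithinAt_const.sub hm).div (continuousWithinAt_const.add hm) n1
    have c1 : ContinuousWithinAt (fun r : ℝ => legendreChi (r * w)) (Set.Ioo 0 1) 1 :=
      ContinuousWithinAt.comp (g := legendreChi) (f := fun r : ℝ => (r : ℂ) * w)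
        (t := Metric.closedBall 0 1)
        (continuousOn_legendreChi (((1 : ℝ) : ℂ) * w) (by simp [hwn])) hm fun r hr => by
          rw [mem_closedBall_zero_iff, norm_mul, hwn, Complex.norm_real,
            Real.norm_of_nonneg hr.1.le, mul_one]
          exact hr.2.le
    have hlt : ‖(1 - ((1 : ℝ) : ℂ) * w) / (1 + ((1 : ℝ) : ℂ) * w)‖ < 1 :=
      norm_one_sub_div_one_add_lt (by simp [hwr])
    have c2 := ContinuousAt.comp_continuousWithinAt (g := legendreChi)
      (f := fun r : ℝ => (1 - (r : ℂ) * w) / (1 + (r : ℂ) * w))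
      (continuousOn_legendreChi.continuousAt (Metric.closedBall_mem_nhds_of_mem
        (mem_ball_zero_iff.2 hlt))) hq
    have c3 := hm.clog (Or.inl (by simp [hwr]))
    have c4 := hq.clog (by
      rw [Complex.ofReal_one, one_mul, one_sub_div_one_add_sixth_root]
      exact Or.inr (by simp))
    exact ((c1.add c2).add ((c3.mul c4).div_const 2))
  have hne : (𝓝[Set.Ioo (0 : ℝ) 1] 1).NeBot := right_nhdsWithin_Ioo_neBot (by norm_num)
  have h1 := (Complex.continuous_im.tendsto _).comp hcont.tendsto
  have h2 : Tendsto (fun _ : ℝ => (0 : ℝ)) (𝓝[Set.Ioo (0 : ℝ) 1] 1) (𝓝 0) := tendsto_const_nhds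
  have h3 := tendsto_nhds_unique (h1.congr' (eventually_nhdsWithin_of_forall hline)) h2
  simpa using h3

/-- At e^{iπ/3} the involution gives −i/√3, and the chi function there is −i Ti₂(1/√3). The
imaginary part of the functional equation reads (5√3/8)K − Ti₂(1/√3) − (π/12) log 3 = 0. -/
theorem hasSum_inverse_tangent_integral :
    HasSum (fun k : ℕ => (-1 : ℝ) ^ k * (√3)⁻¹ ^ (2 * k + 1) / (2 * (k : ℝ) + 1) ^ 2)
      (5 * √3 / 8 * constK - π / 12 * Real.log 3) := by
  have hlt : ‖(((√3)⁻¹ : ℝ) : ℂ) * -Complex.I‖ < 1 := by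
    rw [← one_sub_div_one_add_sixth_root]
    exact norm_one_sub_div_one_add_lt (by simp)
  have h := chiPair_sixth_root_im
  have hl : Complex.log (1 / 2 + √3 / 2 * Complex.I) = ((π / 3 : ℝ) : ℂ) * Complex.I := by
    rw [show (1 / 2 + √3 / 2 * Complex.I : ℂ) = Complex.exp (((π / 3 : ℝ) : ℂ) * Complex.I) by
      rw [Complex.exp_mul_I, ← Complex.ofReal_cos, ← Complex.ofReal_sin, Real.cos_pi_div_three,
        Real.sin_pi_div_three]
      push_cast
      rfl, Complex.log_exp]
    · simpa using by linarith [Real.pi_pos]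
    · simpa using by linarith [Real.pi_pos]
  rw [chiPair, one_sub_div_one_add_sixth_root, hl, Complex.log_ofReal_mul (by positivity)
    (neg_ne_zero.2 Complex.I_ne_zero), Complex.log_neg_I, Complex.add_im, Complex.add_im,
    legendreChi_sixth_root_im] at h
  have hprod : (((π / 3 : ℝ) : ℂ) * Complex.I *
      (((Real.log (√3)⁻¹ : ℝ) : ℂ) + -(π / 2) * Complex.I) / 2).im = -(π / 12 * Real.log 3) := by
    rw [Real.log_inv, Real.log_sqrt (by norm_num)]
    generalize Real.log 3 = l
    simp
    ring
  rw [hprod] at h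
  have hs := (Complex.hasSum_im (hasSum_legendreChi hlt.le)).neg
  refine hs.of_eq (fun k => ?_) (by linarith)
  rw [show (2 * (k : ℂ) + 1) ^ 2 = (((2 * (k : ℝ) + 1) ^ 2 : ℝ) : ℂ) by push_cast; ring,
    Complex.div_ofReal_im, mul_pow, pow_succ (-Complex.I), pow_mul (-Complex.I), neg_sq,
    Complex.I_sq, ← Complex.ofReal_pow, Complex.im_ofReal_mul]
  have : ((-1 : ℂ) ^ k * -Complex.I).im = -(-1) ^ k := by
    have := Complex.im_ofReal_mul ((-1) ^ k) (-Complex.I)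
    push_cast at this
    rw [this]
    simp
  rw [this]
  ring

/-! ### Evaluation of the series at −144 -/

theorem quadTerm_neg_144_eq (N : ℕ) : ((quadTerm (-144) N : ℝ) : ℂ) = 2 * deformCore 0 N := by
  induction N with
  | zero =>
    norm_num [quadTerm, deformCore, sqProd, halfProd, Nat.choose]
  | succ N ih =>
    rw [quadTerm_succ, deformCore_succ (by simp) (by simp)]
    push_cast
    rw [ih]
    have e1 : (2 * (N : ℂ) + 3) ≠ 0 := by exact_mod_cast (by omega : 2 * N + 3 ≠ 0)
    have e2 : (4 * (N : ℂ) + 5) ≠ 0 := by exact_mod_cast (by omega : 4 * N + 5 ≠ 0)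
    have e3 : (4 * (N : ℂ) + 7) ≠ 0 := by exact_mod_cast (by omega : 4 * N + 7 ≠ 0)
    rw [show (-0 + ((N : ℂ) + 3 / 2)) = (2 * N + 3) / 2 by ring,
      show (0 + (2 * (N : ℂ) + 1 + 3 / 2)) = (4 * N + 5) / 2 by ring,
      show (0 + (2 * (N : ℂ) + 2 + 3 / 2)) = (4 * N + 7) / 2 by ring]
    generalize (2 * (N : ℂ) + 3) = a at *
    generalize (4 * (N : ℂ) + 5) = b at *
    generalize (4 * (N : ℂ) + 7) = c at *
    field_simp
    ring

theorem hasSum_quadTerm_neg_144 :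
    HasSum (fun n : ℕ => (5 * ((n : ℝ) + 1) - 1) * quadTerm (-144) n) (-(45 / 2) * constK) := by
  have h3 : √3 * √3 = 3 := Real.mul_self_sqrt (by norm_num)
  have hi : (√3)⁻¹ = √3 / 3 := by
    have : √3 ≠ 0 := by positivity
    field_simp
    linarith
  have hp : ∀ k : ℕ, (√3)⁻¹ ^ (2 * k + 1) = √3 / 3 * (1 / 3) ^ k := fun k => by
    rw [pow_succ, pow_mul, hi, show (√3 / 3) ^ 2 = 1 / 3 by
      rw [div_pow, sq, h3]; norm_num, mul_comm]
  -- At 0 the pole sum is the series of arctan(1/√3) = π/6, up to the factor −2√3/3.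
  have hA : poleSum 0 = ((-(√3 * π / 9) : ℝ) : ℂ) := by
    have h := (Real.hasSum_arctan (x := (√3)⁻¹) (by
      rw [Real.norm_of_nonneg (by positivity)]
      exact inv_lt_one_of_one_lt₀ (Real.lt_sqrt_of_sq_lt (by norm_num)))).mul_left (-(2 * √3 / 3))
    rw [Real.arctan_inv_sqrt_three] at h
    rw [poleSum, ← (Complex.hasSum_ofReal.2 (h.of_eq
      (g := fun k : ℕ => (-1 / 3 : ℝ) ^ k / 3 * (0 - ((k : ℝ) + 1 / 2))⁻¹) (fun k => ?_)
      (b := -(√3 * π / 9)) (by ring))).tsum_eq]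
    · push_cast
      rfl
    · rw [hp]
      have : (k : ℝ) + 1 / 2 ≠ 0 := by positivity
      have : 2 * (k : ℝ) + 1 ≠ 0 := by positivity
      rw [show (-1 / 3 : ℝ) = -1 * (1 / 3) by norm_num, mul_pow,
        show (0 - ((k : ℝ) + 1 / 2)) = -((2 * k + 1) / 2) by ring]
      push_cast
      generalize 2 * (k : ℝ) + 1 = a at *
      field_simp
      nlinarith [h3]
  have hB : ∑' j : ℕ, -((-1 / 3) ^ j / 3 / ((0 : ℂ) - (j + 1 / 2)) ^ 2) =
      ((-(4 * √3 / 3 * (5 * √3 / 8 * constK - π / 12 * Real.log 3)) : ℝ) : ℂ) := by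
    have h := hasSum_inverse_tangent_integral.mul_left (-(4 * √3 / 3))
    rw [← (Complex.hasSum_ofReal.2 (h.of_eq
      (g := fun k : ℕ => -((-1 / 3 : ℝ) ^ k / 3 / (0 - ((k : ℝ) + 1 / 2)) ^ 2)) (fun k => ?_)
      (b := -(4 * √3 / 3 * (5 * √3 / 8 * constK - π / 12 * Real.log 3))) (by ring))).tsum_eq]
    · push_cast
      rfl
    · rw [hp]
      have : 2 * (k : ℝ) + 1 ≠ 0 := by positivity
      rw [show (-1 / 3 : ℝ) = -1 * (1 / 3) by norm_num, mul_pow,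
        show (0 - ((k : ℝ) + 1 / 2)) = -((2 * k + 1) / 2) by ring]
      generalize 2 * (k : ℝ) + 1 = a at *
      field_simp
      nlinarith [h3]
  have hs := summable_deformTerm (x := 0) (by simp) (by simp)
  have h := hs.hasSum.mul_left 2
  have key : 2 * ∑' N : ℕ, (5 * (N : ℂ) + 4 + 0) * deformCore 0 N =
      ((-(45 / 2) * constK : ℝ) : ℂ) := by
    rw [← deformSum, two_mul_deformSum_zero, hA, hB, show (3 : ℂ) = ((3 : ℝ) : ℂ) by norm_num,
      ← Complex.ofReal_log (by norm_num)]
    norm_cast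
    -- The log 3 from L(0) log 3 cancels the one in Ti₂(1/√3), leaving −(15/2)(√3)² K.
    linear_combination (-(15 / 2) * constK) * h3
  rw [key] at h
  refine Complex.hasSum_ofReal.1 (h.congr_fun fun N => ?_)
  push_cast
  rw [quadTerm_neg_144_eq]
  ring

/-! ### The sixteen series -/

set_option maxHeartbeats 1000000 in
theorem theorem1p2 :
    HasSum (fun k : ℕ =>
        (198 * (k : ℝ) ^ 2 - 227 * (k : ℝ) + 47)
          / (Nat.choose (2 * k) k : ℝ) ^ 3)
      ((3264 - 4 * π ^ 2) / 63) ∧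
    HasSum (fun k : ℕ+ =>
        (4884741 * ((k : ℕ) : ℝ) ^ 2 - 7292783 * ((k : ℕ) : ℝ) + 2041168)
          / (Nat.choose (2 * (k : ℕ)) ((k : ℕ) + 1) : ℝ) ^ 3)
      ((68102148 - 10093535 * π ^ 2) / 126) ∧
    HasSum (fun k : ℕ =>
        (54 * (k : ℝ) ^ 2 - 33 * (k : ℝ) + 18) * (-8 : ℝ) ^ k
          / (Nat.choose (2 * k) k : ℝ) ^ 3)
      (8 + 2 * catalanG) ∧
    HasSum (fun k : ℕ+ =>
        (11277 * ((k : ℕ) : ℝ) ^ 2 - 13124 * ((k : ℕ) : ℝ) + 3212) * (-8 : ℝ) ^ (k : ℕ)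
          / (Nat.choose (2 * (k : ℕ)) ((k : ℕ) + 1) : ℝ) ^ 3)
      ((38954 * catalanG - 24679) / 3) ∧
    HasSum (fun k : ℕ =>
        (850 * (k : ℝ) ^ 2 - 1133 * (k : ℝ) + 69) * (8 : ℝ) ^ k
          / ((Nat.choose (2 * k) k : ℝ) ^ 2 * (Nat.choose (3 * k) k : ℝ)))
      ((885 - 12 * π ^ 2) / 5) ∧
    HasSum (fun k : ℕ+ =>
        (4621650 * ((k : ℕ) : ℝ) ^ 2 - 7550827 * ((k : ℕ) : ℝ) + 1785654) * (8 : ℝ) ^ (k : ℕ)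
          / ((Nat.choose (2 * (k : ℕ)) ((k : ℕ) + 1) : ℝ) ^ 2 * (Nat.choose (3 * (k : ℕ)) ((k : ℕ) + 1) : ℝ)))
      ((6728880 - 1468127 * π ^ 2) / 5) ∧
    HasSum (fun k : ℕ =>
        (18 * (k : ℝ) ^ 2 - 39 * (k : ℝ) - 6) * (16 : ℝ) ^ k
          / (Nat.choose (2 * k) k : ℝ) ^ 3)
      ((16 - π ^ 2) / 4) ∧
    HasSum (fun k : ℕ+ =>
        (2778 * ((k : ℕ) : ℝ) ^ 2 - 6499 * ((k : ℕ) : ℝ) + 1679) * (16 : ℝ) ^ (k : ℕ)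
          / (Nat.choose (2 * (k : ℕ)) ((k : ℕ) + 1) : ℝ) ^ 3)
      ((89008 - 20305 * π ^ 2) / 12) ∧
    HasSum (fun k : ℕ =>
        (315 * (k : ℝ) ^ 2 - 54 * (k : ℝ) + 119) * (-27 : ℝ) ^ k
          / ((Nat.choose (2 * k) k : ℝ) ^ 2 * (Nat.choose (3 * k) k : ℝ)))
      ((10 + 216 * constK) / 5) ∧
    HasSum (fun k : ℕ+ =>
        (3391155 * ((k : ℕ) : ℝ) ^ 2 - 3249747 * ((k : ℕ) : ℝ) + 646792) * (-27 : ℝ) ^ ((k : ℕ) - 1)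
          / ((Nat.choose (2 * (k : ℕ)) ((k : ℕ) + 1) : ℝ) ^ 2 * (Nat.choose (3 * (k : ℕ)) ((k : ℕ) + 1) : ℝ)))
      ((2344210 - 5115501 * constK) / 30) ∧
    HasSum (fun k : ℕ =>
        (1298 * (k : ℝ) ^ 2 - 7807 * (k : ℝ) - 3165) * (64 : ℝ) ^ k
          / ((Nat.choose (2 * k) k : ℝ) ^ 2 * (Nat.choose (3 * k) k : ℝ)))
      (195 - 192 * π ^ 2) ∧
    HasSum (fun k : ℕ+ =>
        (3470742 * ((k : ℕ) : ℝ) ^ 2 - 20527615 * ((k : ℕ) : ℝ) + 4631490) * (64 : ℝ) ^ ((k : ℕ) - 1)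
          / ((Nat.choose (2 * (k : ℕ)) ((k : ℕ) + 1) : ℝ) ^ 2 * (Nat.choose (3 * (k : ℕ)) ((k : ℕ) + 1) : ℝ)))
      (387807 - 198173 * π ^ 2) ∧
    HasSum (fun k : ℕ =>
        (2050 * (k : ℝ) ^ 2 - 5331 * (k : ℝ) - 1357) * (81 : ℝ) ^ k
          / ((Nat.choose (2 * k) k : ℝ) ^ 2 * (Nat.choose (4 * k) (2 * k) : ℝ)))
      ((8800 - 2592 * π ^ 2) / 35) ∧
    HasSum (fun k : ℕ+ =>
        (17439700 * ((k : ℕ) : ℝ) ^ 2 - 47250409 * ((k : ℕ) : ℝ) + 8929776) * (81 : ℝ) ^ ((k : ℕ) - 1)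
          / ((Nat.choose (2 * (k : ℕ)) ((k : ℕ) + 1) : ℝ) ^ 2 * (Nat.choose (4 * (k : ℕ)) (2 * (k : ℕ) + 1) : ℝ)))
      ((143153685 - 44613764 * π ^ 2) / 210) ∧
    HasSum (fun k : ℕ =>
        (50 * (k : ℝ) ^ 2 + 93 * (k : ℝ) + 22) * (-144 : ℝ) ^ k
          / ((Nat.choose (2 * k) k : ℝ) ^ 2 * (Nat.choose (4 * k) (2 * k) : ℝ)))
      ((243 * constK - 200) / 4) ∧
    HasSum (fun k : ℕ+ =>
        (53725 * ((k : ℕ) : ℝ) ^ 2 - 27494 * ((k : ℕ) : ℝ) + 3675) * (-144 : ℝ) ^ ((k : ℕ) - 1)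
          / ((Nat.choose (2 * (k : ℕ)) ((k : ℕ) + 1) : ℝ) ^ 2 * (Nat.choose (4 * (k : ℕ)) (2 * (k : ℕ) + 1) : ℝ)))
      ((78296 - 122235 * constK) / 128) := by
  refine ⟨?_, ?_, ?_, ?_, ?_, ?_, ?_, ?_, ?_, ?_, ?_, ?_, ?_, ?_, ?_, ?_⟩
  -- In each case the four numbers are A, w₀, w₁, w₂, which solve the linear system matching the
  -- given quadratic. For a series starting at k = 0, `of_nat_succ` adds that initial term.
  · refine (hasSum_cubeTerm_one.cubeTerm_telescope (by norm_num) (-8/21) (64/21) (72/7) (176/7)).of_nat_succ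
      (fun n => ?_) ?_
    · rw [div_eq_mul_one_div, one_div_choose_cube]
      push_cast
      ring
    · norm_num
      ring
  · refine (hasSum_cubeTerm_one.cubeTerm_telescope (by norm_num)
      (-10093535/21) (37883752/21) (13297712/7) (4341992/7)).of_succPNat (fun n => ?_) (by ring)
    simp only [Nat.succPNat_coe, Nat.succ_eq_add_one]
    rw [div_eq_mul_one_div, one_div_choose_succ_cube]
    push_cast
    ring
  · refine (hasSum_cubeTerm_neg_eight.cubeTerm_telescope (by norm_num) (-1) 1 3 6).of_nat_succ
      (fun n => ?_) ?_
    · rw [mul_div_assoc, pow_div_choose_cube]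
      push_cast
      ring
    · norm_num
      ring
  · refine (hasSum_cubeTerm_neg_eight.cubeTerm_telescope (by norm_num)
      (-19477/3) (9841/3) 3693 1253).of_succPNat (fun n => ?_) (by ring)
    simp only [Nat.succPNat_coe, Nat.succ_eq_add_one]
    rw [mul_div_assoc, pow_div_choose_succ_cube]
    push_cast
    ring
  · refine (hasSum_tripleTerm_eight.tripleTerm_telescope (by norm_num) (-24/5) (36/5) (114/5) 51).of_nat_succ
      (fun n => ?_) ?_
    · rw [mul_div_assoc, pow_div_choose_triple]
      push_cast
      ring
    · norm_num
      ring
  · refine (hasSum_tripleTerm_eight.tripleTerm_telescope (by norm_num)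
      (-2936254/5) (4344627/10) (2181099/5) (277299/2)).of_succPNat (fun n => ?_) (by ring)
    simp only [Nat.succPNat_coe, Nat.succ_eq_add_one]
    rw [mul_div_assoc, pow_div_choose_succ_triple]
    push_cast
    ring
  · refine (hasSum_cubeTerm_sixteen.cubeTerm_telescope (by norm_num) (-1/2) (1/2) (3/2) 3).of_nat_succ
      (fun n => ?_) ?_
    · rw [mul_div_assoc, pow_div_choose_cube]
      push_cast
      ring
    · norm_num
      ring
  · refine (hasSum_cubeTerm_sixteen.cubeTerm_telescope (by norm_num)
      (-20305/6) (10231/6) (3081/2) 463).of_succPNat (fun n => ?_) (by ring)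
    simp only [Nat.succPNat_coe, Nat.succ_eq_add_one]
    rw [mul_div_assoc, pow_div_choose_succ_cube]
    push_cast
    ring
  · refine (hasSum_tripleTerm_neg_twentySeven.tripleTerm_telescope (by norm_num) (-8/5) (16/5) (44/5) 14).of_nat_succ
      (fun n => ?_) ?_
    · rw [mul_div_assoc, pow_div_choose_triple]
      push_cast
      ring
    · norm_num
      ring
  · refine (hasSum_tripleTerm_neg_twentySeven.tripleTerm_telescope (by norm_num)
      (189463/30) (-896677/135) (-1070738/135) (-75359/27)).of_succPNat (fun n => ?_) (by ring)
    simp only [Nat.succPNat_coe, Nat.succ_eq_add_one]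
    -- The exponent is k − 1 here, so a factor z⁻¹ is split off; it is already included in the
    -- chosen coefficients.
    rw [add_tsub_cancel_right, mul_div_assoc, pow_div_eq_pow_succ_div (by norm_num : (-27 : ℝ) ≠ 0), pow_div_choose_succ_triple]
    push_cast
    ring
  · refine (hasSum_tripleTerm_sixtyFour.tripleTerm_telescope (by norm_num) (-24) 36 102 177).of_nat_succ
      (fun n => ?_) ?_
    · rw [mul_div_assoc, pow_div_choose_triple]
      push_cast
      ring
    · norm_num
      ring
  · refine (hasSum_tripleTerm_sixtyFour.tripleTerm_telescope (by norm_num)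
      (-198173/8) (2440407/128) (869997/64) (473283/128)).of_succPNat (fun n => ?_) (by ring)
    simp only [Nat.succPNat_coe, Nat.succ_eq_add_one]
    rw [add_tsub_cancel_right, mul_div_assoc, pow_div_eq_pow_succ_div (by norm_num : (64 : ℝ) ≠ 0), pow_div_choose_succ_triple]
    push_cast
    ring
  · refine (hasSum_quadTerm_eightyOne.quadTerm_telescope (by norm_num) (-216/35) (576/35) (1704/35) (656/7)).of_nat_succ
      (fun n => ?_) ?_
    · rw [mul_div_assoc, pow_div_choose_quad]
      push_cast
      ring
    · norm_num
      ring
  · refine (hasSum_quadTerm_eightyOne.quadTerm_telescope (by norm_num)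
      (-11153441/630) (81750932/2835) (27072376/945) (5580704/567)).of_succPNat (fun n => ?_) (by ring)
    simp only [Nat.succPNat_coe, Nat.succ_eq_add_one]
    rw [add_tsub_cancel_right, mul_div_assoc, pow_div_eq_pow_succ_div (by norm_num : (81 : ℝ) ≠ 0), pow_div_choose_succ_quad]
    push_cast
    ring
  · refine (hasSum_quadTerm_neg_144.quadTerm_telescope (by norm_num) (-27/10) (9/10) (21/10) 1).of_nat_succ
      (fun n => ?_) ?_
    · rw [mul_div_assoc, pow_div_choose_quad]
      push_cast
      ring
    · norm_num
      ring
  · refine (hasSum_quadTerm_neg_144.quadTerm_telescope (by norm_num)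
      (8149/192) (-5699/576) (-9577/576) (-2149/288)).of_succPNat (fun n => ?_) (by ring)
    simp only [Nat.succPNat_coe, Nat.succ_eq_add_one]
    rw [add_tsub_cancel_right, mul_div_assoc, pow_div_eq_pow_succ_div (by norm_num : (-144 : ℝ) ≠ 0), pow_div_choose_succ_quad]
    push_cast
    ring
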